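/- **Theorem.** Throughout, $\log$ denotes the logarithm to base $2$, and graphs are finite, undirected and unweighted; they may have parallel edges but no self-loops. Let $G=(V,E)$ be a graph and let $A_1,B_1,\dots,A_k,B_k\subseteq V$ be pairwise disjoint with $|A_i|\le |B_i|$ for all $i$. A *partial routing* of $A_1,B_1,\dots,A_k,B_k$ consists of matchings $M_1,\dots,M_k$, where $M_i\subseteq A_i\times B_i$ is a set of pairs no two of which share a vertex, and of a path $P(u,v)$ in $G$ connecting $u$ to $v$ for every pair $(u,v)\in M=\bigcup_i M_i$. Its *value* is $\sum_i|M_i|$; it *causes congestion at most* $\eta$ if every edge of $G$ lies on at most $\eta$ of the paths $P(u,v)$, $(u,v)\in M$. A *cut* $(X,Y)$ in $G$ is a partition of $V$ into two non-empty sets, and its *sparsity* is $\Psi_G(X,Y)=|E_G(X,Y)|/\min\{|X|,|Y|\}$, where $E_G(X,Y)$ is the set of edges with one endpoint in $X$ and the other in $Y$. There is a deterministic algorithm that, given a graph $G=(V,E)$ with $n\ge 1$ vertices and maximum vertex degree $\Delta$, pairwise disjoint sets $A_1,B_1,\dots,A_k,B_k\subseteq V$ ($k\ge 1$) with $|A_i|\le|B_i|$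 for all $1\le i\le k$, and integers $z\ge 0$ and $\ell\ge 1$ with $\ell\ge 32\Delta\log n$, computes one of the following: - either a partial routing of $A_1,B_1,\dots,A_k,B_k$ of value at least $\sum_{i=1}^k|A_i|-z$ that causes congestion at most $\ell^2$; - or a cut $(X,Y)$ in $G$ with $|X|,|Y|\ge z/2$ and $\Psi_G(X,Y)\le 72\Delta\log n/\ell$. The running time of the algorithm is $\tilde O(\ell^3k|E|+\ell^2kn)$, where $\tilde O$ hides factors polylogarithmic in $n$. That is, there are absolute constants $c,C,d$ such that on every such input the algorithm halts after at most $C(1+\log n)^d(\ell^3k|E|+\ell^2kn)$ steps on a unit-cost random access machine with arithmetic on words of at most $c\log(n+|E|+k+z+\ell+2)$ bits. The graph is given to it by its list of edges, and the sets by lists of their elements. -/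

import Mathlib

/-! ### Cuts, paths and partial routings in multigraphs -/

namespace RouteOrCut

/-- The maximum vertex degree of a loopless multigraph on the vertices `0, …, n - 1`. -/
noncomputable def maxDegree {n m : ℕ} (G : Graph (Fin n) (Fin m)) : ℕ :=
  Finset.univ.sup fun v => (G.incidenceSet v).ncard

/-- `(X, Y)` is a cut: a partition of the vertex set into two nonempty parts. -/
def IsCut {n : ℕ} (X Y : Finset (Fin n)) : Prop :=
  Disjoint X Y ∧ X ∪ Y = Finset.univ ∧ X.Nonempty ∧ Y.Nonempty

/-- The edges with one endpoint in `X` and another in `Y`. -/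
def edgesBetween {n m : ℕ} (G : Graph (Fin n) (Fin m)) (X Y : Finset (Fin n)) : Set (Fin m) :=
  {e | ∃ x ∈ X, ∃ y ∈ Y, G.IsLink e x y}

/-- The sparsity of the cut `(X, Y)`. -/
noncomputable def sparsity {n m : ℕ} (G : Graph (Fin n) (Fin m)) (X Y : Finset (Fin n)) : ℝ :=
  ((edgesBetween G X Y).ncard : ℝ) / (min X.card Y.card : ℕ)

/-- `IsWalk G u p v`: starting at `u` and following the list `p` of steps (traversed edge,
vertex reached) in `G`, one ends at `v`. -/
def IsWalk {n m : ℕ} (G : Graph (Fin n) (Fin m)) :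
    Fin n → List (Fin m × Fin n) → Fin n → Prop
  | u, [], v => u = v
  | u, (e, w) :: p, v => G.IsLink e u w ∧ IsWalk G w p v

/-- A path connecting `u` to `v`: a walk that visits no vertex twice. -/
def IsPath {n m : ℕ} (G : Graph (Fin n) (Fin m)) (u : Fin n) (p : List (Fin m × Fin n))
    (v : Fin n) : Prop :=
  IsWalk G u p v ∧ (u :: p.map Prod.snd).Nodup

/-- `M` (one matching `M i` between `A i` and `B i` for each `i`) together with the paths
`P (u, v)`, for the pairs `(u, v)` in some `M i`, is a partial routing of the sets `A i`, `B i`.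
Values of `P` at other pairs are irrelevant. -/
structure IsPartialRouting {n m k : ℕ} (G : Graph (Fin n) (Fin m)) (A B : Fin k → Finset (Fin n))
    (M : Fin k → Finset (Fin n × Fin n)) (P : Fin n × Fin n → List (Fin m × Fin n)) : Prop where
  mem : ∀ i, ∀ q ∈ M i, q.1 ∈ A i ∧ q.2 ∈ B i
  matching : ∀ i, ∀ q ∈ M i, ∀ q' ∈ M i, q.1 = q'.1 ∨ q.2 = q'.2 → q = q'
  path : ∀ i, ∀ q ∈ M i, IsPath G q.1 (P q) q.2

/-- The value `∑ i, |M i|` of a routing. -/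
def routingValue {n k : ℕ} (M : Fin k → Finset (Fin n × Fin n)) : ℕ := ∑ i, (M i).card

/-- Every edge belongs to at most `c` of the paths `P (u, v)`, `(u, v) ∈ ⋃ i, M i`. -/
def CongestionAtMost {n m k : ℕ} (M : Fin k → Finset (Fin n × Fin n))
    (P : Fin n × Fin n → List (Fin m × Fin n)) (c : ℕ) : Prop :=
  ∀ e : Fin m, ((Finset.univ.biUnion M).filter fun q => e ∈ (P q).map Prod.fst).card ≤ c

/-! ### A word RAM

Programs are given in structured form. The machine has registers and finitely many (as many as the
program mentions) random access arrays, all of whose cells hold machine words. Each instruction and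
each evaluation of a branching condition takes one time unit. -/

/-- An operand: a constant of the program or the content of a register. -/
inductive Operand where
  | const (c : ℕ)
  | reg (r : ℕ)

/-- Arithmetic instructions: addition, subtraction (truncated at `0`), multiplication and
integer division. -/
inductive ArithOp where
  | plus | minus | times | quot

/-- Tests `x < y` and `x = y`. -/
inductive Test where
  | lt (x y : Operand)
  | eq (x y : Operand)

/-- Programs. `arith r f x y` puts `f x y` into register `r`; `load r a x` puts cell number `x` of
array `a` into register `r`; `store a x y` puts `y` into cell number `x` of array `a`. -/
inductive Prog where
  | skip
  | arith (r : ℕ) (f : ArithOp) (x y : Operand)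
  | load (r a : ℕ) (x : Operand)
  | store (a : ℕ) (x y : Operand)
  | seq (p q : Prog)
  | cond (b : Test) (p q : Prog)
  | loop (b : Test) (p : Prog)

/-- Memory contents: `reg r` is register `r`, `arr a j` is cell `j` of array `a`. -/
structure Memory where
  reg : ℕ → ℕ
  arr : ℕ → ℕ → ℕ

def Operand.eval (s : Memory) : Operand → ℕ
  | const c => c
  | reg r => s.reg r

def ArithOp.eval : ArithOp → ℕ → ℕ → ℕ
  | plus, x, y => x + y
  | minus, x, y => x - y
  | times, x, y => x * y
  | quot, x, y => x / y

def Test.Holds (s : Memory) : Test → Prop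
  | lt x y => x.eval s < y.eval s
  | eq x y => x.eval s = y.eval s

def Memory.setReg (s : Memory) (r v : ℕ) : Memory :=
  { s with reg := Function.update s.reg r v }

def Memory.setCell (s : Memory) (a j v : ℕ) : Memory :=
  { s with arr := Function.update s.arr a (Function.update (s.arr a) j v) }

/-- `Exec W p s t s'`: started in memory `s`, program `p` halts after exactly `t` time units in
memory `s'`, and all words written and all addresses used on the way are less than `W`
(an instruction that would exceed the word range has no successor). -/
inductive Exec (W : ℕ) : Prog → Memory → ℕ → Memory → Prop where
  | skip (s) : Exec W .skip s 1 s
  | arith (s r f x y) (hv : ArithOp.eval f (x.eval s) (y.eval s) < W) :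
      Exec W (.arith r f x y) s 1 (s.setReg r (ArithOp.eval f (x.eval s) (y.eval s)))
  | load (s r a x) (hx : x.eval s < W) (hv : s.arr a (x.eval s) < W) :
      Exec W (.load r a x) s 1 (s.setReg r (s.arr a (x.eval s)))
  | store (s a x y) (hx : x.eval s < W) (hv : y.eval s < W) :
      Exec W (.store a x y) s 1 (s.setCell a (x.eval s) (y.eval s))
  | seq {p q s t s' t' s''} (h : Exec W p s t s') (h' : Exec W q s' t' s'') :
      Exec W (.seq p q) s (t + t') s''
  | condTrue {b p q s t s'} (hb : b.Holds s) (h : Exec W p s t s') :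
      Exec W (.cond b p q) s (1 + t) s'
  | condFalse {b p q s t s'} (hb : ¬ b.Holds s) (h : Exec W q s t s') :
      Exec W (.cond b p q) s (1 + t) s'
  | loopTrue {b p s t s' t' s''} (hb : b.Holds s) (h : Exec W p s t s')
      (h' : Exec W (.loop b p) s' t' s'') : Exec W (.loop b p) s (1 + t + t') s''
  | loopFalse {b p s} (hb : ¬ b.Holds s) : Exec W (.loop b p) s 1 s

/-- Programs are deterministic: running time and final memory are determined by the start. -/
theorem Exec.deterministic {W : ℕ} {p : Prog} {s s₁ s₂ : Memory} {t₁ t₂ : ℕ}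
    (h₁ : Exec W p s t₁ s₁) (h₂ : Exec W p s t₂ s₂) : t₁ = t₂ ∧ s₁ = s₂ := by
  induction h₁ generalizing t₂ s₂ with
  | skip | arith | load | store => cases h₂; exact ⟨rfl, rfl⟩
  | seq _ _ ih ih' =>
    cases h₂ with
    | seq g g' =>
      obtain ⟨rfl, rfl⟩ := ih g
      obtain ⟨rfl, rfl⟩ := ih' g'
      exact ⟨rfl, rfl⟩
  | condTrue hb _ ih =>
    cases h₂ with
    | condTrue _ g => obtain ⟨rfl, rfl⟩ := ih g; exact ⟨rfl, rfl⟩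
    | condFalse hb' _ => exact absurd hb hb'
  | condFalse hb _ ih =>
    cases h₂ with
    | condTrue hb' _ => exact absurd hb' hb
    | condFalse _ g => obtain ⟨rfl, rfl⟩ := ih g; exact ⟨rfl, rfl⟩
  | loopTrue hb _ _ ih ih' =>
    cases h₂ with
    | loopTrue _ g g' =>
      obtain ⟨rfl, rfl⟩ := ih g
      obtain ⟨rfl, rfl⟩ := ih' g'
      exact ⟨rfl, rfl⟩
    | loopFalse hb' => exact absurd hb hb'
  | loopFalse hb =>
    cases h₂ with
    | loopTrue hb' _ _ => exact absurd hb' hb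
    | loopFalse _ => exact ⟨rfl, rfl⟩

/-- The start of a computation: the input `x` stands in array `0`, everything else is `0`. -/
def startMemory (x : List ℕ) : Memory where
  reg := fun _ => 0
  arr := fun a j => if a = 0 then x.getD j 0 else 0

/-- The word list `y` stands at the beginning of array `1`. -/
def HasOutput (s : Memory) (y : List ℕ) : Prop :=
  ∀ j, j < y.length → s.arr 1 j = y.getD j 0

/-! ### Input and output formats -/

/-- A list of vertices as words, preceded by its length. -/
def encodeList {n : ℕ} (l : List (Fin n)) : List ℕ := l.length :: l.map Fin.val

/-- `l` lists the elements of `S`, each once. -/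
def Enumerates {n : ℕ} (l : List (Fin n)) (S : Finset (Fin n)) : Prop := l.Nodup ∧ l.toFinset = S

/-- `x` is an encoding of the input `(G, (A i, B i)_i, z, ℓ)`: the numbers `n, m, k, z, ℓ`, the
two endpoints of each edge, and, for each `i`, a listing of `A i` and one of `B i`. The order of the
endpoints and of the listings is arbitrary. -/
def IsInput {n m k : ℕ} (G : Graph (Fin n) (Fin m)) (A B : Fin k → Finset (Fin n)) (z ℓ : ℕ)
    (x : List ℕ) : Prop :=
  ∃ (u v : Fin m → Fin n) (a b : Fin k → List (Fin n)),
    (∀ e, G.IsLink e (u e) (v e)) ∧ (∀ i, Enumerates (a i) (A i)) ∧ (∀ i, Enumerates (b i) (B i)) ∧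
    x = [n, m, k, z, ℓ] ++ (List.finRange m).flatMap (fun e => [(u e : ℕ), (v e : ℕ)]) ++
      (List.finRange k).flatMap (fun i => encodeList (a i) ++ encodeList (b i))

/-- `y` is an encoding of the cut `(X, Y)`: the word `0` and listings of `X` and of `Y`. -/
def IsCutOutput {n : ℕ} (X Y : Finset (Fin n)) (y : List ℕ) : Prop :=
  ∃ a b : List (Fin n), Enumerates a X ∧ Enumerates b Y ∧ y = 0 :: (encodeList a ++ encodeList b)

/-- `y` is an encoding of the routing `(M, P)`: the word `1`, the number of routed pairs and, for
each `i` and `(u, v) ∈ M i` (in any order), the numbers `i, u, v`, the length of the path `P (u, v)`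
and its sequence of edges and vertices after `u`. -/
def IsRoutingOutput {n m k : ℕ} (M : Fin k → Finset (Fin n × Fin n))
    (P : Fin n × Fin n → List (Fin m × Fin n)) (y : List ℕ) : Prop :=
  ∃ L : List (Fin k × Fin n × Fin n), L.Nodup ∧ (∀ i q, (i, q) ∈ L ↔ q ∈ M i) ∧
    y = 1 :: L.length :: L.flatMap (fun r =>
      [(r.1 : ℕ), (r.2.1 : ℕ), (r.2.2 : ℕ), (P r.2).length] ++
        (P r.2).flatMap (fun ew => [(ew.1 : ℕ), (ew.2 : ℕ)]))

/-- `y` encodes one of the two allowed outcomes. -/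
def IsCorrectOutput {n m k : ℕ} (G : Graph (Fin n) (Fin m)) (A B : Fin k → Finset (Fin n))
    (z ℓ : ℕ) (y : List ℕ) : Prop :=
  (∃ (M : Fin k → Finset (Fin n × Fin n)) (P : Fin n × Fin n → List (Fin m × Fin n)),
    IsPartialRouting G A B M P ∧
    ((∑ i, (A i).card : ℕ) : ℝ) - z ≤ routingValue M ∧
    CongestionAtMost M P (ℓ ^ 2) ∧ IsRoutingOutput M P y) ∨
  (∃ X Y : Finset (Fin n), IsCut X Y ∧ (z : ℝ) / 2 ≤ X.card ∧ (z : ℝ) / 2 ≤ Y.card ∧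
    sparsity G X Y ≤ 72 * maxDegree G * Real.logb 2 n / ℓ ∧ IsCutOutput X Y y)

end RouteOrCut

/-!
The algorithm works in phases. In a phase every edge may carry at most `cap = ℓ² / log n` paths,
and for each `i` in turn one routes, along edges that still have capacity, a maximal set of pairs
of unmatched vertices of `A i` and `B i` by paths of length at most `ℓ`. The search is that of
blocking flow algorithms by relabeling: labels `lab` with `lab u ≤ lab w + 1` along open edges and
`lab = 0` on the unmatched part of `B i` are lower bounds for the distance to it. A depth first
search advances only along edges on which the label drops by one, and raises the label of a dead
end by one. Labels only grow and stop at `ℓ + 1`, so all searches for one `i` together take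
`O(n ℓ)` steps of time `O(Δ)`; see `runs_routeIndex`. When an index has been dealt with, its labels
remain valid for the rest of the phase, as edges only get blocked and vertices only get matched,
and they certify that the unmatched vertices of `A i` have distance more than `ℓ` from those of
`B i` (`Separated`).

If at most `z` sources are unmatched, the paths found are output. If a phase has matched more than
half of the unmatched sources, there is a further phase. There are at most `log n` of these,
whence the congestion is at most `ℓ²` (`runs_routing`). Otherwise some number `left > z` of
sources remains unmatched, and at most `left` paths have been routed in the last phase, so that at
most `ℓ left / cap`, that is about `left log n / ℓ`, edges are blocked (`Stuck`).

In this case a cut is found in the graph `H` of the edges that are not blocked. Its one side `U`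
is collected from balls: as long as `2 |U| < left`, take the next `i` and grow in `H - U` the ball
around the unmatched vertices of `A i` until its boundary is at most a fraction `1 / q` of it,
where `q = ℓ / (2 (log n + 1))`. Since `(1 + 1 / q) ^ q ≥ 2`, this happens at a radius of at most
`q (log n + 1) ≤ ℓ / 2` (`rounds_le`). The ball around the unmatched vertices of `B i` is
therefore disjoint from it, so that one of the two takes at most half of the vertices outside `U`
(`two_mul_size_add_le`). It is added to `U`. The number of edges of `H` leaving `U` is at most
`Δ |U| / q`, and `U` has at most `5 n / 8` vertices (`CutInv.union`). In the end `2 |U| ≥ left`,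
since otherwise `U` would contain, for each `i`, all unmatched vertices of `A i` or of `B i`, and
hence at least `left` vertices (`CutInv.left_le`). Adding the blocked edges one gets the bound for
the sparsity (`edges_mul_le`).

Programs are treated by a calculus of total correctness with running times, `Runs`, in which the
word length is ignored. Short words suffice, because products are used only as addresses, in tests
and in quotients, but never in further products (`Exec.of_tame`).
-/

namespace RouteOrCut

/-! ### Reasoning about programs -/

theorem Exec.mono {W W' : ℕ} {p : Prog} {s s' : Memory} {t : ℕ} (hW : W ≤ W')
    (h : Exec W p s t s') : Exec W' p s t s' := by
  induction h with
  | skip => exact .skip _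
  | arith _ _ _ _ _ hv => exact .arith _ _ _ _ _ (hv.trans_le hW)
  | load _ _ _ _ hx hv => exact .load _ _ _ _ (hx.trans_le hW) (hv.trans_le hW)
  | store _ _ _ _ hx hv => exact .store _ _ _ _ (hx.trans_le hW) (hv.trans_le hW)
  | seq _ _ ih ih' => exact .seq ih ih'
  | condTrue hb _ ih => exact .condTrue hb ih
  | condFalse hb _ ih => exact .condFalse hb ih
  | loopTrue hb _ _ ih ih' => exact .loopTrue hb ih ih'
  | loopFalse hb => exact .loopFalse hb

@[simp] theorem Operand.eval_const (s : Memory) (c : ℕ) : (Operand.const c).eval s = c := rfl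

@[simp] theorem Operand.eval_reg (s : Memory) (r : ℕ) : (Operand.reg r).eval s = s.reg r := rfl

@[simp] theorem Test.holds_lt (s : Memory) (x y : Operand) :
    (Test.lt x y).Holds s ↔ x.eval s < y.eval s := Iff.rfl

@[simp] theorem Test.holds_eq (s : Memory) (x y : Operand) :
    (Test.eq x y).Holds s ↔ x.eval s = y.eval s := Iff.rfl

@[simp] theorem ArithOp.eval_plus (x y : ℕ) : ArithOp.plus.eval x y = x + y := rfl

@[simp] theorem ArithOp.eval_minus (x y : ℕ) : ArithOp.minus.eval x y = x - y := rfl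

@[simp] theorem ArithOp.eval_times (x y : ℕ) : ArithOp.times.eval x y = x * y := rfl

@[simp] theorem ArithOp.eval_quot (x y : ℕ) : ArithOp.quot.eval x y = x / y := rfl

/-- Total correctness with running time, on a machine with words of unlimited length: started in
`s`, the program `p` halts after some time `t` in some memory `s'` with `Q t s'`. That short words
suffice is shown separately, for all programs of a certain shape; see `Exec.of_tame`. -/
def Runs (p : Prog) (s : Memory) (Q : ℕ → Memory → Prop) : Prop :=
  ∃ W t s', Exec W p s t s' ∧ Q t s'

/-- Does the program contain an instruction that writes register `r`? -/
def Prog.writesReg : Prog → ℕ → Bool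
  | skip, _ => false
  | arith r' _ _ _, r => r' == r
  | load r' _ _, r => r' == r
  | store _ _ _, _ => false
  | seq p q, r => p.writesReg r || q.writesReg r
  | cond _ p q, r => p.writesReg r || q.writesReg r
  | loop _ p, r => p.writesReg r

/-- Does the program contain an instruction that writes array `a`? -/
def Prog.writesArr : Prog → ℕ → Bool
  | skip, _ => false
  | arith _ _ _ _, _ => false
  | load _ _ _, _ => false
  | store a' _ _, a => a' == a
  | seq p q, a => p.writesArr a || q.writesArr a
  | cond _ p q, a => p.writesArr a || q.writesArr a
  | loop _ p, a => p.writesArr a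

/-- The memories agree on everything that `p` has no instruction to write. -/
structure SameOff (p : Prog) (s s' : Memory) : Prop where
  reg : ∀ r, p.writesReg r = false → s'.reg r = s.reg r
  arr : ∀ a, p.writesArr a = false → s'.arr a = s.arr a

theorem SameOff.refl (p : Prog) (s : Memory) : SameOff p s s := ⟨fun _ _ => rfl, fun _ _ => rfl⟩

theorem SameOff.trans {p : Prog} {s s' s'' : Memory} (h : SameOff p s s') (h' : SameOff p s' s'') :
    SameOff p s s'' :=
  ⟨fun r hr => (h'.reg r hr).trans (h.reg r hr), fun a ha => (h'.arr a ha).trans (h.arr a ha)⟩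

theorem SameOff.weaken {p q : Prog} {s s' : Memory} (h : SameOff p s s')
    (hr : ∀ r, q.writesReg r = false → p.writesReg r = false)
    (ha : ∀ a, q.writesArr a = false → p.writesArr a = false) : SameOff q s s' :=
  ⟨fun r h' => h.reg r (hr r h'), fun a h' => h.arr a (ha a h')⟩

@[simp] theorem Memory.reg_setReg (s : Memory) (r v r' : ℕ) :
    (s.setReg r v).reg r' = if r' = r then v else s.reg r' := by
  simp [Memory.setReg, Function.update_apply]

@[simp] theorem Memory.arr_setReg (s : Memory) (r v : ℕ) : (s.setReg r v).arr = s.arr := rfl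

@[simp] theorem Memory.reg_setCell (s : Memory) (a j v : ℕ) : (s.setCell a j v).reg = s.reg := rfl

@[simp] theorem Memory.arr_setCell (s : Memory) (a j v a' : ℕ) :
    (s.setCell a j v).arr a' = if a' = a then Function.update (s.arr a) j v else s.arr a' := by
  simp only [Memory.setCell, Function.update_apply]

theorem Exec.sameOff {W : ℕ} {p : Prog} {s s' : Memory} {t : ℕ} (h : Exec W p s t s') :
    SameOff p s s' := by
  induction h with
  | skip => exact .refl _ _
  | arith _ _ _ _ _ hv =>
    refine ⟨fun r hr => ?_, fun _ _ => rfl⟩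
    simp only [Prog.writesReg, beq_eq_false_iff_ne] at hr
    simp [hr.symm]
  | load _ _ _ _ hx hv =>
    refine ⟨fun r hr => ?_, fun _ _ => rfl⟩
    simp only [Prog.writesReg, beq_eq_false_iff_ne] at hr
    simp [hr.symm]
  | store _ _ _ _ hx hv =>
    refine ⟨fun _ _ => rfl, fun r hr => ?_⟩
    simp only [Prog.writesArr, beq_eq_false_iff_ne] at hr
    simp [hr.symm]
  | seq _ _ ih ih' =>
    refine SameOff.trans (ih.weaken ?_ ?_) (ih'.weaken ?_ ?_) <;>
      simp +contextual [Prog.writesReg, Prog.writesArr]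
  | condTrue hb _ ih =>
    refine ih.weaken ?_ ?_ <;> simp +contextual [Prog.writesReg, Prog.writesArr]
  | condFalse hb _ ih =>
    refine ih.weaken ?_ ?_ <;> simp +contextual [Prog.writesReg, Prog.writesArr]
  | loopTrue hb _ _ ih ih' => exact SameOff.trans (ih.weaken (fun _ h => h) (fun _ h => h)) ih'
  | loopFalse hb => exact .refl _ _

theorem Runs.mono {p : Prog} {s : Memory} {Q Q' : ℕ → Memory → Prop} (h : Runs p s Q)
    (hQ : ∀ t s', SameOff p s s' → Q t s' → Q' t s') : Runs p s Q' := by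
  obtain ⟨W, t, s', he, hq⟩ := h
  exact ⟨W, t, s', he, hQ t s' he.sameOff hq⟩

theorem runs_skip {s : Memory} {Q : ℕ → Memory → Prop} : Runs .skip s Q ↔ Q 1 s := by
  constructor
  · rintro ⟨W, t, s', ⟨⟩, hq⟩; exact hq
  · exact fun h => ⟨0, 1, s, .skip s, h⟩

theorem runs_arith {r : ℕ} {f : ArithOp} {x y : Operand} {s : Memory} {Q : ℕ → Memory → Prop} :
    Runs (.arith r f x y) s Q ↔ Q 1 (s.setReg r (f.eval (x.eval s) (y.eval s))) := by
  constructor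
  · rintro ⟨W, t, s', ⟨⟩, hq⟩; exact hq
  · exact fun h => ⟨_, 1, _, .arith s r f x y (Nat.lt_succ_self _), h⟩

theorem runs_load {r a : ℕ} {x : Operand} {s : Memory} {Q : ℕ → Memory → Prop} :
    Runs (.load r a x) s Q ↔ Q 1 (s.setReg r (s.arr a (x.eval s))) := by
  constructor
  · rintro ⟨W, t, s', ⟨⟩, hq⟩; exact hq
  · exact fun h => ⟨x.eval s + s.arr a (x.eval s) + 1, 1, _,
      .load s r a x (by omega) (by omega), h⟩

theorem runs_store {a : ℕ} {x y : Operand} {s : Memory} {Q : ℕ → Memory → Prop} :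
    Runs (.store a x y) s Q ↔ Q 1 (s.setCell a (x.eval s) (y.eval s)) := by
  constructor
  · rintro ⟨W, t, s', ⟨⟩, hq⟩; exact hq
  · exact fun h => ⟨x.eval s + y.eval s + 1, 1, _,
      .store s a x y (by omega) (by omega), h⟩

theorem runs_seq {p q : Prog} {s : Memory} {Q : ℕ → Memory → Prop} :
    Runs (.seq p q) s Q ↔ Runs p s fun t s' => Runs q s' fun t' s'' => Q (t + t') s'' := by
  constructor
  · rintro ⟨W, t, s', h, hq⟩
    cases h with
    | seq h h' => exact ⟨W, _, _, h, W, _, _, h', hq⟩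
  · rintro ⟨W, t, s', h, W', t', s'', h', hq⟩
    exact ⟨max W W', _, _, .seq (h.mono (le_max_left _ _)) (h'.mono (le_max_right _ _)), hq⟩

theorem runs_cond {b : Test} {p q : Prog} {s : Memory} {Q : ℕ → Memory → Prop} :
    Runs (.cond b p q) s Q ↔ (b.Holds s → Runs p s fun t s' => Q (1 + t) s') ∧
      (¬ b.Holds s → Runs q s fun t s' => Q (1 + t) s') := by
  constructor
  · rintro ⟨W, t, s', h, hq⟩
    cases h with
    | condTrue hb h => exact ⟨fun _ => ⟨W, _, _, h, hq⟩, fun hb' => absurd hb hb'⟩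
    | condFalse hb h => exact ⟨fun hb' => absurd hb' hb, fun _ => ⟨W, _, _, h, hq⟩⟩
  · rintro ⟨h₁, h₂⟩
    by_cases hb : b.Holds s
    · obtain ⟨W, t, s', h, hq⟩ := h₁ hb
      exact ⟨W, _, _, .condTrue hb h, hq⟩
    · obtain ⟨W, t, s', h, hq⟩ := h₂ hb
      exact ⟨W, _, _, .condFalse hb h, hq⟩

/-- The rule for loops: an invariant `I φ`, where `φ` is a bound for the time that is left. -/
theorem Runs.loop {b : Test} {p : Prog} {s : Memory} {φ : ℕ} (I : ℕ → Memory → Prop) (hI : I φ s)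
    (body : ∀ φ s', SameOff p s s' → I φ s' → b.Holds s' →
      Runs p s' fun t s'' => ∃ φ', I φ' s'' ∧ t + 1 + φ' ≤ φ) :
    Runs (.loop b p) s fun t s' => ∃ φ', I φ' s' ∧ ¬ b.Holds s' ∧ t + φ' ≤ φ + 1 := by
  suffices H : ∀ φ s', SameOff p s s' → I φ s' →
      Runs (.loop b p) s' fun t s'' => ∃ φ', I φ' s'' ∧ ¬ b.Holds s'' ∧ t + φ' ≤ φ + 1 from
    H φ s (.refl _ _) hI
  clear hI φ
  intro φ
  induction φ using Nat.strong_induction_on with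
  | _ φ ih =>
    intro s' hs hI
    by_cases hb : b.Holds s'
    · obtain ⟨W, t, s₁, he, φ₁, hI₁, ht⟩ := body φ s' hs hI hb
      obtain ⟨W', t', s₂, he', φ₂, hI₂, hb₂, ht'⟩ := ih φ₁ (by omega) s₁ (hs.trans he.sameOff) hI₁
      exact ⟨max W W', _, s₂, .loopTrue hb (he.mono (le_max_left _ _)) (he'.mono (le_max_right _ _)),
        φ₂, hI₂, hb₂, by omega⟩
    · exact ⟨0, 1, s', .loopFalse hb, φ, hI, hb, by omega⟩

/-- Sequential composition of several programs. -/
def block : List Prog → Prog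
  | [] => .skip
  | p :: l => .seq p (block l)

theorem runs_block_nil {s : Memory} {Q : ℕ → Memory → Prop} : Runs (block []) s Q ↔ Q 1 s :=
  runs_skip

theorem runs_block_cons {p : Prog} {l : List Prog} {s : Memory} {Q : ℕ → Memory → Prop} :
    Runs (block (p :: l)) s Q ↔
      Runs p s fun t s' => Runs (block l) s' fun t' s'' => Q (t + t') s'' :=
  runs_seq

/-- Run `p` with `0, …, N - 1` in register `r`, where `N` is the value of `x`. -/
def forLoop (r : ℕ) (x : Operand) (p : Prog) : Prog :=
  .seq (.arith r .plus (.const 0) (.const 0))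
    (.loop (.lt (.reg r) x) (.seq p (.arith r .plus (.reg r) (.const 1))))

/-- The program does not change the value of the operand. -/
def Operand.fixedBy : Operand → Prog → Bool
  | const _, _ => true
  | reg r, p => !p.writesReg r

theorem Operand.eval_of_fixedBy {x : Operand} {p : Prog} (h : x.fixedBy p = true) {s s' : Memory}
    (hs : SameOff p s s') : x.eval s' = x.eval s := by
  cases x with
  | const => rfl
  | reg r => exact hs.reg r (by simpa [fixedBy] using h)

/-- The rule for `forLoop`, with an invariant `I j φ` that depends on the counter `j` and on a bound
`φ` for the time that is left. -/
theorem Runs.forLoop {r N φ : ℕ} {x : Operand} {p : Prog} {s : Memory} (I : ℕ → ℕ → Memory → Prop)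
    (hN : x.eval s = N) (hr : p.writesReg r = false) (hx : x.fixedBy (forLoop r x p) = true)
    (h0 : I 0 φ (s.setReg r 0))
    (body : ∀ j φ s', SameOff (RouteOrCut.forLoop r x p) s s' → s'.reg r = j → j < N → I j φ s' →
      Runs p s' fun t s'' => ∃ φ', I (j + 1) φ' (s''.setReg r (j + 1)) ∧ t + 2 + φ' ≤ φ) :
    Runs (RouteOrCut.forLoop r x p) s fun t s' => ∃ φ', I N φ' s' ∧ t + φ' ≤ φ + 2 := by
  rw [RouteOrCut.forLoop, runs_seq, runs_arith]
  have hs0 : SameOff (RouteOrCut.forLoop r x p) s (s.setReg r 0) := by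
    refine ⟨fun r' hr' => ?_, fun _ _ => rfl⟩
    have : r' ≠ r := by
      rintro rfl
      simp [RouteOrCut.forLoop, Prog.writesReg] at hr'
    simp [this]
  have key := Runs.loop (b := .lt (.reg r) x) (p := .seq p (.arith r .plus (.reg r) (.const 1)))
    (s := s.setReg r 0) (φ := φ) (fun φ s' => SameOff (RouteOrCut.forLoop r x p) s s' ∧
      s'.reg r ≤ N ∧ I (s'.reg r) φ s') ⟨hs0, by simp, by simpa using h0⟩ ?_
  · refine key.mono ?_
    rintro t s' - ⟨φ', ⟨hs, hle, hI⟩, hb, ht⟩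
    rw [Test.holds_lt, Operand.eval_of_fixedBy hx hs, hN, not_lt, Operand.eval_reg] at hb
    obtain rfl : s'.reg r = N := le_antisymm hle hb
    exact ⟨φ', hI, by omega⟩
  · rintro φ s' - ⟨hs, hle, hI⟩ hb
    rw [Test.holds_lt, Operand.eval_of_fixedBy hx hs, hN, Operand.eval_reg] at hb
    rw [runs_seq]
    refine (body _ φ s' hs rfl hb hI).mono ?_
    rintro t s'' hs'' ⟨φ', hI', ht⟩
    rw [runs_arith]
    have hreg := hs''.reg r hr
    refine ⟨φ', ⟨hs.trans ?_, ?_, ?_⟩, by omega⟩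
    · refine SameOff.trans (hs''.weaken ?_ ?_) ⟨fun r' hr' => ?_, fun _ _ => rfl⟩
      · simp +contextual [RouteOrCut.forLoop, Prog.writesReg]
      · simp +contextual [RouteOrCut.forLoop, Prog.writesArr]
      · have : r' ≠ r := by
          rintro rfl
          simp [RouteOrCut.forLoop, Prog.writesReg] at hr'
        simp [this]
    · simp [hreg]; omega
    · simpa [hreg] using hI'

/-- The rule for `forLoop` when each round takes time at most `T`. -/
theorem Runs.forLoop' {r N : ℕ} {x : Operand} {p : Prog} {s : Memory} (T : ℕ)
    (I : ℕ → Memory → Prop)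
    (hN : x.eval s = N) (hr : p.writesReg r = false) (hx : x.fixedBy (RouteOrCut.forLoop r x p) = true)
    (h0 : I 0 (s.setReg r 0))
    (body : ∀ j s', SameOff (RouteOrCut.forLoop r x p) s s' → s'.reg r = j → j < N → I j s' →
      Runs p s' fun t s'' => I (j + 1) (s''.setReg r (j + 1)) ∧ t ≤ T) :
    Runs (RouteOrCut.forLoop r x p) s fun t s' => I N s' ∧ t ≤ (T + 2) * N + 2 := by
  have := Runs.forLoop (φ := (T + 2) * N) (fun j φ s => I j s ∧ φ = (T + 2) * (N - j)) hN hr hx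
    ⟨h0, by simp⟩ ?_
  · refine this.mono ?_
    rintro t s' - ⟨φ', ⟨hI, rfl⟩, ht⟩
    exact ⟨hI, by omega⟩
  · rintro j φ s' hs hj hjN ⟨hI, rfl⟩
    refine (body j s' hs hj hjN hI).mono ?_
    rintro t s'' - ⟨hI', ht⟩
    refine ⟨_, ⟨hI', rfl⟩, ?_⟩
    have : N - j = (N - (j + 1)) + 1 := by omega
    rw [this, Nat.mul_add]
    omega

/-! ### Short words suffice -/

/-- A small operand: a constant that is at most `5` or a register other than `0`, `1`, `2`. -/
def Operand.small : Operand → Bool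
  | const c => c ≤ 5
  | reg r => 3 ≤ r

/-- A constant that is at most `5` or any register. -/
def Operand.fits : Operand → Bool
  | const c => c ≤ 5
  | reg _ => true

/-- Arithmetic instructions of a tame program; see `Prog.tame`. -/
def ArithOp.tame (r : ℕ) (f : ArithOp) (x y : Operand) : Bool :=
  match r, f, x, y with
  | 0, _, x, y => x.small && y.small
  | 1, .plus, .reg 0, y => y.small
  | 2, .quot, .reg 0, _ => true
  | _ + 3, .plus, x, .const c => x.small && decide (c ≤ 5)
  | _ + 3, .minus, x, _ => x.small
  | _ + 3, .quot, x, _ => x.small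
  | _, _, _, _ => false

/-- In a tame program the registers from `3` on and the cells of the arrays grow by at most `5` in
each step. Products and sums of two of them are formed only in the registers `0`, `1` and `2`, which
are not copied to other places. -/
def Prog.tame : Prog → Bool
  | skip => true
  | arith r f x y => ArithOp.tame r f x y
  | load r _ x => 3 ≤ r && x.fits
  | store _ x y => x.fits && y.small
  | seq p q => p.tame && q.tame
  | cond _ p q => p.tame && q.tame
  | loop _ p => p.tame

/-- Bounds for the words in memory that tame programs maintain, with `V` growing slowly. -/
structure Memory.Bounded (V : ℕ) (s : Memory) : Prop where
  cell : ∀ a j, s.arr a j ≤ V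
  reg : ∀ r, s.reg (r + 3) ≤ V
  zero : s.reg 0 ≤ V * V
  one : s.reg 1 ≤ V * V + V
  two : s.reg 2 ≤ V * V + V

theorem Memory.Bounded.mono {V V' : ℕ} {s : Memory} (h : s.Bounded V) (hV : V ≤ V') :
    s.Bounded V' := by
  have := Nat.mul_le_mul hV hV
  exact ⟨fun a j => (h.cell a j).trans hV, fun r => (h.reg r).trans hV, h.zero.trans this,
    h.one.trans (by omega), h.two.trans (by omega)⟩

theorem Memory.Bounded.eval_small {V : ℕ} {s : Memory} (h : s.Bounded V) (hV : 5 ≤ V) {x : Operand}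
    (hx : x.small = true) : x.eval s ≤ V := by
  cases x with
  | const c => simp only [Operand.small, decide_eq_true_eq] at hx; exact hx.trans hV
  | reg r =>
    simp only [Operand.small, decide_eq_true_eq] at hx
    obtain ⟨r, rfl⟩ := Nat.exists_eq_add_of_le' hx
    exact h.reg r

theorem Memory.Bounded.eval_fits {V : ℕ} {s : Memory} (h : s.Bounded V) (hV : 5 ≤ V) {x : Operand}
    (hx : x.fits = true) : x.eval s ≤ V * V + V := by
  match x with
  | .const c => simp only [Operand.fits, decide_eq_true_eq] at hx; simp only [Operand.eval]; omega
  | .reg 0 => exact h.zero.trans (by omega)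
  | .reg 1 => exact h.one
  | .reg 2 => exact h.two
  | .reg (r + 3) => exact (h.reg r).trans (by omega)

theorem Memory.Bounded.setReg {V : ℕ} {s : Memory} (h : s.Bounded V) (r : ℕ) {v : ℕ} (hv : v ≤ V) :
    (s.setReg r v).Bounded V := by
  have : V ≤ V * V := Nat.le_mul_self V
  refine ⟨h.cell, fun r' => ?_, ?_, ?_, ?_⟩ <;> rw [Memory.reg_setReg] <;> split_ifs
  exacts [hv, h.reg r', by omega, h.zero, by omega, h.one, by omega, h.two]

theorem Memory.Bounded.setCell {V : ℕ} {s : Memory} (h : s.Bounded V) (a j : ℕ) {v : ℕ}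
    (hv : v ≤ V) : (s.setCell a j v).Bounded V := by
  refine ⟨fun a' j' => ?_, h.reg, h.zero, h.one, h.two⟩
  rw [Memory.arr_setCell]
  split_ifs
  · rw [Function.update_apply]
    split_ifs
    exacts [hv, h.cell _ _]
  · exact h.cell _ _

theorem Memory.Bounded.arith {V : ℕ} {s : Memory} (h : s.Bounded V) (hV : 5 ≤ V) {r : ℕ}
    {f : ArithOp} {x y : Operand} (ht : ArithOp.tame r f x y = true) :
    (s.setReg r (f.eval (x.eval s) (y.eval s))).Bounded (V + 5) ∧
      f.eval (x.eval s) (y.eval s) ≤ V * V + V := by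
  have hVV : 5 * V ≤ V * V := Nat.mul_le_mul_right V hV
  have h5 := h.mono (Nat.le_add_right V 5)
  unfold ArithOp.tame at ht
  split at ht
  · simp only [Bool.and_eq_true] at ht
    have h1 := h.eval_small hV ht.1
    have h2 := h.eval_small hV ht.2
    have key : f.eval (x.eval s) (y.eval s) ≤ V * V := by
      cases f with
      | plus => simp only [ArithOp.eval]; omega
      | minus => simp only [ArithOp.eval]; omega
      | times => exact Nat.mul_le_mul h1 h2
      | quot => exact (Nat.div_le_self _ _).trans (by omega)
    refine ⟨⟨h5.cell, fun r' => ?_, ?_, ?_, ?_⟩, by omega⟩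
    · simpa using h5.reg r'
    · simp only [Memory.reg_setReg, ite_true]; nlinarith
    · simpa using h5.one
    · simpa using h5.two
  · have h2 := h.eval_small hV ht
    have h1 := h.zero
    have key : ArithOp.plus.eval (Operand.eval s (.reg 0)) (y.eval s) ≤ V * V + V :=
      Nat.add_le_add h1 h2
    refine ⟨⟨h5.cell, fun r' => ?_, ?_, ?_, ?_⟩, key⟩
    · simpa using h5.reg r'
    · simpa using h5.zero
    · simp only [Memory.reg_setReg, ite_true]; nlinarith
    · simpa using h5.two
  · have h1 := h.zero
    have key : ArithOp.quot.eval (Operand.eval s (.reg 0)) (y.eval s) ≤ V * V + V :=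
      (Nat.div_le_self _ _).trans (h1.trans (by omega))
    refine ⟨⟨h5.cell, fun r' => ?_, ?_, ?_, ?_⟩, key⟩
    · simpa using h5.reg r'
    · simpa using h5.zero
    · simpa using h5.one
    · simp only [Memory.reg_setReg, ite_true]; nlinarith
  · simp only [Bool.and_eq_true, decide_eq_true_eq] at ht
    have h1 := h.eval_small hV ht.1
    simp only [ArithOp.eval_plus, Operand.eval_const]
    exact ⟨h5.setReg _ (by omega), by omega⟩
  · have h1 := h.eval_small hV ht
    simp only [ArithOp.eval]
    exact ⟨h5.setReg _ (by omega), by omega⟩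
  · have h1 := (Nat.div_le_self _ (y.eval s)).trans (h.eval_small hV ht)
    simp only [ArithOp.eval]
    exact ⟨h5.setReg _ (by omega), by omega⟩
  · simp at ht

/-- A tame program needs only words that are polynomial in the running time and the words that are
in memory at the start. -/
theorem Exec.of_tame {W W' : ℕ} {p : Prog} {s s' : Memory} {t : ℕ} (h : Exec W p s t s')
    (hp : p.tame = true) {V : ℕ} (hV : 5 ≤ V) (hs : s.Bounded V)
    (hW : (V + 5 * t) * (V + 5 * t) + (V + 5 * t) < W') :
    Exec W' p s t s' ∧ s'.Bounded (V + 5 * t) := by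
  have hmono : ∀ {V₁ V₂ : ℕ}, V₁ ≤ V₂ → V₁ * V₁ + V₁ ≤ V₂ * V₂ + V₂ := fun h =>
    Nat.add_le_add (Nat.mul_le_mul h h) h
  induction h generalizing V with
  | skip => exact ⟨.skip _, hs.mono (by omega)⟩
  | arith s r f x y hv =>
    have h1 := hs.arith hV hp
    exact ⟨.arith _ _ _ _ _ ((h1.2.trans (hmono (by omega))).trans_lt hW), h1.1⟩
  | load s r a x hx hv =>
    simp only [Prog.tame, Bool.and_eq_true, decide_eq_true_eq] at hp
    have h1 := hs.cell a (x.eval s)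
    exact ⟨.load _ _ _ _ (((hs.eval_fits hV hp.2).trans (hmono (by omega))).trans_lt hW)
      (by omega), (hs.setReg _ h1).mono (by omega)⟩
  | store s a x y hx hv =>
    simp only [Prog.tame, Bool.and_eq_true] at hp
    have h1 := hs.eval_small hV hp.2
    exact ⟨.store _ _ _ _ (((hs.eval_fits hV hp.1).trans (hmono (by omega))).trans_lt hW)
      (by omega), (hs.setCell _ _ h1).mono (by omega)⟩
  | seq _ _ ih ih' =>
    simp only [Prog.tame, Bool.and_eq_true] at hp
    have h1 := ih hp.1 hV hs ((hmono (by omega)).trans_lt hW)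
    have h2 := ih' hp.2 (by omega) h1.2 ((hmono (by omega)).trans_lt hW)
    exact ⟨.seq h1.1 h2.1, h2.2.mono (by omega)⟩
  | condTrue hb _ ih =>
    simp only [Prog.tame, Bool.and_eq_true] at hp
    have h1 := ih hp.1 hV hs ((hmono (by omega)).trans_lt hW)
    exact ⟨.condTrue hb h1.1, h1.2.mono (by omega)⟩
  | condFalse hb _ ih =>
    simp only [Prog.tame, Bool.and_eq_true] at hp
    have h1 := ih hp.2 hV hs ((hmono (by omega)).trans_lt hW)
    exact ⟨.condFalse hb h1.1, h1.2.mono (by omega)⟩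
  | loopTrue hb _ _ ih ih' =>
    have h1 := ih hp hV hs ((hmono (by omega)).trans_lt hW)
    have h2 := ih' hp (by omega) h1.2 ((hmono (by omega)).trans_lt hW)
    exact ⟨.loopTrue hb h1.1 h2.1, h2.2.mono (by omega)⟩
  | loopFalse hb => exact ⟨.loopFalse hb, hs.mono (by omega)⟩

/-! ### The program -/

/-! Names for the registers. Registers `0` and `1` are used to compute products and addresses, and
register `2` holds a quotient of a product; `Prog.tame` permits products in these registers only. -/

notation "rCap" => 2
notation "rN" => 3
notation "rM" => 4
notation "rK" => 5
notation "rZ" => 6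
notation "rEll" => 7
notation "rLog" => 8
notation "rQ" => 9
notation "rLeft" => 10
notation "rOld" => 11
notation "rStop" => 12
notation "rOut" => 13
notation "rCnt" => 14
notation "rI" => 15
notation "rTag" => 16
notation "rSrc" => 17
notation "rV" => 18
notation "rTop" => 19
notation "rDone" => 20
notation "rLabV" => 21
notation "rDeg" => 22
notation "rFound" => 23
notation "rNext" => 24
notation "rJ" => 25
notation "rE" => 26
notation "rC" => 27
notation "rW" => 28
notation "rLabW" => 29
notation "rT" => 30
notation "rX" => 31
notation "rPtr" => 32
notation "rLen" => 33
notation "rU" => 34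
notation "rSize" => 35
notation "rSizeNew" => 36
notation "rNew" => 37
notation "rRad" => 38
notation "rRadNew" => 39
notation "rGo" => 40
notation "rTotal" => 41

/-! Names for the arrays; array `0` holds the input and array `1` the output. -/

notation "aTagA" => 2
notation "aTagB" => 3
notation "aEndL" => 4
notation "aEndR" => 5
notation "aDeg" => 6
notation "aAdjE" => 7
notation "aAdjV" => 8
notation "aLab" => 9
notation "aCong" => 10
notation "aStackV" => 11
notation "aStackE" => 12
notation "aBall" => 13
notation "aCut" => 14

/-- Put the value of `x` into register `r`. -/
abbrev setTo (r : ℕ) (x : Operand) : Prog := .arith r .plus x (.const 0)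

/-- Increase register `r` by one. -/
abbrev incr (r : ℕ) : Prog := .arith r .plus (.reg r) (.const 1)

/-- Read the five parameters, and compute the binary logarithm of `n`, the number of paths per phase
that may use an edge, and the inverse of the expansion rate at which balls stop growing. -/
def readHeader : Prog := block [
  .load rN 0 (.const 0), .load rM 0 (.const 1), .load rK 0 (.const 2), .load rZ 0 (.const 3),
  .load rEll 0 (.const 4),
  setTo rX (.reg rN), setTo rLog (.const 0),
  .loop (.lt (.const 1) (.reg rX)) (block [.arith rX .quot (.reg rX) (.const 2), incr rLog]),
  .arith 0 .times (.reg rEll) (.reg rEll), .arith rCap .quot (.reg 0) (.reg rLog),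
  .arith rX .plus (.reg rLog) (.const 1), .arith 0 .times (.reg rX) (.const 2),
  .arith rQ .quot (.reg rEll) (.reg 0),
  setTo rPtr (.const 5)]

/-- Append edge `rE`, leading to the vertex in register `y`, to the list of the vertex in register
`x`. -/
def addIncidence (x y : ℕ) : Prog := block [
  .load rDeg aDeg (.reg x),
  .arith 0 .times (.reg x) (.reg rM), .arith 1 .plus (.reg 0) (.reg rDeg),
  .store aAdjE (.reg 1) (.reg rE), .store aAdjV (.reg 1) (.reg y),
  incr rDeg, .store aDeg (.reg x) (.reg rDeg)]

/-- Read the list of edges and build the incidence lists. -/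
def readEdges : Prog := forLoop rE (.reg rM) (block [
  .load rU 0 (.reg rPtr), incr rPtr, .load rW 0 (.reg rPtr), incr rPtr,
  .store aEndL (.reg rE) (.reg rU), .store aEndR (.reg rE) (.reg rW),
  addIncidence rU rW, addIncidence rW rU])

/-- Read a list of vertices and tag them with `rTag` in array `a`. -/
def readList (a : ℕ) : Prog := block [
  .load rLen 0 (.reg rPtr), incr rPtr,
  forLoop rJ (.reg rLen) (block [
    .load rW 0 (.reg rPtr), incr rPtr, .store a (.reg rW) (.reg rTag)])]

/-- Read the sets: the elements of `A i` and of `B i` receive the tag `i + 1` in two arrays. -/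
def readSets : Prog := forLoop rI (.reg rK) (block [
  .arith rTag .plus (.reg rI) (.const 1), readList aTagA, readList aTagB])

/-- Look for an edge below its capacity from `rV` to a vertex whose label is smaller by one. -/
def scan : Prog := block [
  .load rLabV aLab (.reg rV), .load rDeg aDeg (.reg rV), setTo rFound (.const 0),
  forLoop rJ (.reg rDeg) (block [
    .arith 0 .times (.reg rV) (.reg rM), .arith 1 .plus (.reg 0) (.reg rJ),
    .load rE aAdjE (.reg 1), .load rC aCong (.reg rE),
    .cond (.lt (.reg rC) (.reg rCap))
      (block [.load rW aAdjV (.reg 1), .load rLabW aLab (.reg rW), incr rLabW,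
        .cond (.eq (.reg rLabW) (.reg rLabV))
          (block [.arith rFound .plus (.reg rE) (.const 1), setTo rNext (.reg rW)]) .skip])
      .skip])]

/-- Extend the path on the stack by the edge found. -/
def push : Prog := block [
  incr rTop, .store aStackV (.reg rTop) (.reg rNext),
  .arith rFound .minus (.reg rFound) (.const 1), .store aStackE (.reg rTop) (.reg rFound),
  setTo rV (.reg rNext)]

/-- Increase the label of the last vertex of the path and remove it from the path; give up if it is
the first one and has got a label above `ℓ`. -/
def relabel : Prog := block [
  incr rLabV, .store aLab (.reg rV) (.reg rLabV),
  .cond (.lt (.const 0) (.reg rTop))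
    (block [.arith rTop .minus (.reg rTop) (.const 1), .load rV aStackV (.reg rTop)])
    (.cond (.lt (.reg rEll) (.reg rLabV)) (setTo rDone (.const 2)) .skip)]

/-- One step of the search for a path. -/
def searchStep : Prog := block [
  .load rT aTagB (.reg rV),
  .cond (.eq (.reg rT) (.reg rTag)) (setTo rDone (.const 1))
    (block [scan, .cond (.eq (.reg rFound) (.const 0)) relabel push])]

/-- Search for a path of length at most `ℓ` from `rSrc` to a vertex of `B i` that is still
unmatched. -/
def search : Prog := block [
  setTo rTop (.const 0), setTo rV (.reg rSrc), .store aStackV (.const 0) (.reg rSrc),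
  .load rLabV aLab (.reg rSrc),
  .cond (.lt (.reg rEll) (.reg rLabV)) (setTo rDone (.const 2)) (setTo rDone (.const 0)),
  .loop (.eq (.reg rDone) (.const 0)) searchStep]

/-- Append a word to the output. -/
def emit (x : Operand) : Prog := block [.store 1 (.reg rOut) x, incr rOut]

/-- Output the path on the stack, and count it on its edges. -/
def recordPath : Prog := block [
  emit (.reg rI), emit (.reg rSrc), emit (.reg rV), emit (.reg rTop),
  forLoop rJ (.reg rTop) (block [
    .arith rX .plus (.reg rJ) (.const 1),
    .load rE aStackE (.reg rX), emit (.reg rE),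
    .load rW aStackV (.reg rX), emit (.reg rW),
    .load rC aCong (.reg rE), incr rC, .store aCong (.reg rE) (.reg rC)]),
  .store aTagA (.reg rSrc) (.const 0), .store aTagB (.reg rV) (.const 0), incr rCnt]

/-- Search from every vertex of `A i` that is still unmatched. -/
def routeIndex : Prog := block [
  .arith rTag .plus (.reg rI) (.const 1),
  forLoop rX (.reg rN) (.store aLab (.reg rX) (.const 0)),
  forLoop rSrc (.reg rN) (block [
    .load rT aTagA (.reg rSrc),
    .cond (.eq (.reg rT) (.reg rTag))
      (block [search, .cond (.eq (.reg rDone) (.const 1)) recordPath .skip]) .skip])]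

/-- Count the sources that are still unmatched, and decide whether to stop. -/
def check : Prog := block [
  setTo rLeft (.const 0),
  forLoop rX (.reg rN) (block [
    .load rT aTagA (.reg rX), .cond (.eq (.reg rT) (.const 0)) .skip (incr rLeft)]),
  setTo rStop (.const 1),
  .cond (.lt (.reg rZ) (.reg rLeft))
    (block [.arith 0 .plus (.reg rLeft) (.reg rLeft),
      .cond (.lt (.reg 0) (.reg rOld)) (setTo rStop (.const 0)) .skip]) .skip]

/-- Reset the edge usage, and route what is possible for each `i`. -/
def phase : Prog := block [
  forLoop rX (.reg rM) (.store aCong (.reg rX) (.const 0)),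
  setTo rOld (.reg rLeft),
  forLoop rI (.reg rK) routeIndex]

/-- Phases until few sources are left or a phase has matched at most half of them. The value `n + 1`
of `rOld` before the first phase exceeds twice the number of sources. -/
def routing : Prog := block [
  setTo rOut (.const 2), setTo rCnt (.const 0),
  .arith rOld .plus (.reg rN) (.const 1), check,
  .loop (.eq (.reg rStop) (.const 0)) (block [phase, check])]

/-- Vertices of the ball have marks in array `aBall` that are one more than their distance from the
center, and the other vertices have mark `0`. The new distance class has mark `rRadNew`.
If the vertex in register `x` is in the ball and the one in register `y` is neither in the ball
nor in the cut, add the latter to the ball. -/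
def touch (x y : ℕ) : Prog := block [
  .load rT aBall (.reg x),
  .cond (.lt (.const 0) (.reg rT))
    (.cond (.lt (.reg rT) (.reg rRadNew))
      (block [.load rT aCut (.reg y),
        .cond (.eq (.reg rT) (.const 0))
          (block [.load rT aBall (.reg y),
            .cond (.eq (.reg rT) (.const 0))
              (block [.store aBall (.reg y) (.reg rRadNew), incr rNew, incr rSizeNew]) .skip])
          .skip])
      .skip)
    .skip]

/-- One round of growing a ball. -/
def growRound : Prog := block [
  setTo rNew (.const 0), .arith rRadNew .plus (.reg rRad) (.const 1),
  forLoop rE (.reg rM) (block [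
    .load rC aCong (.reg rE),
    .cond (.lt (.reg rC) (.reg rCap))
      (block [.load rU aEndL (.reg rE), .load rW aEndR (.reg rE), touch rU rW, touch rW rU])
      .skip]),
  .arith 0 .times (.reg rQ) (.reg rNew),
  .cond (.lt (.reg rSize) (.reg 0))
    (block [setTo rSize (.reg rSizeNew), setTo rRad (.reg rRadNew)]) (setTo rGo (.const 1))]

/-- Grow a ball around the vertices outside the cut with tag `rTag` in array `a`, until its boundary
is small. -/
def grow (a : ℕ) : Prog := block [
  setTo rSizeNew (.const 0),
  forLoop rX (.reg rN) (block [
    .store aBall (.reg rX) (.const 0), .load rT a (.reg rX),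
    .cond (.eq (.reg rT) (.reg rTag))
      (block [.load rT aCut (.reg rX),
        .cond (.eq (.reg rT) (.const 0))
          (block [.store aBall (.reg rX) (.const 1), incr rSizeNew]) .skip])
      .skip]),
  setTo rSize (.reg rSizeNew), setTo rRad (.const 1), setTo rGo (.const 0),
  .loop (.eq (.reg rGo) (.const 0)) growRound]

/-- Add the ball to one side of the cut, without the last distance class, which is the boundary. -/
def absorb : Prog := forLoop rX (.reg rN) (block [
  .load rT aBall (.reg rX),
  .cond (.lt (.const 0) (.reg rT))
    (.cond (.lt (.reg rT) (.reg rRadNew))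
      (block [.store aCut (.reg rX) (.const 1), incr rTotal]) .skip)
    .skip])

/-- Compute one side of a sparse cut as a union of balls. The ball around the vertices of `A i` is
replaced by that around the vertices of `B i` if it is too large. -/
def findCut : Prog := block [
  setTo rTotal (.const 0),
  forLoop rI (.reg rK) (block [
    .arith rTag .plus (.reg rI) (.const 1), .arith 0 .plus (.reg rTotal) (.reg rTotal),
    .cond (.lt (.reg 0) (.reg rLeft))
      (block [grow aTagA,
        .arith 0 .plus (.reg rSize) (.reg rSize), .arith 1 .plus (.reg 0) (.reg rTotal),
        .cond (.lt (.reg rN) (.reg 1)) (grow aTagB) .skip,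
        absorb])
      .skip])]

/-- Output the cut. -/
def printCut : Prog := block [
  setTo rOut (.const 0), emit (.const 0), emit (.reg rTotal),
  forLoop rX (.reg rN) (block [
    .load rT aCut (.reg rX), .cond (.eq (.reg rT) (.const 1)) (emit (.reg rX)) .skip]),
  .arith rT .minus (.reg rN) (.reg rTotal), emit (.reg rT),
  forLoop rX (.reg rN) (block [
    .load rT aCut (.reg rX), .cond (.eq (.reg rT) (.const 1)) .skip (emit (.reg rX))])]

/-- The whole program. -/
def routeOrCut : Prog := block [
  readHeader, readEdges, readSets, routing,
  .cond (.lt (.reg rZ) (.reg rLeft)) (block [findCut, printCut])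
    (block [.store 1 (.const 0) (.const 1), .store 1 (.const 1) (.reg rCnt)])]

theorem tame_routeOrCut : routeOrCut.tame = true := by rfl

attribute [simp] runs_skip runs_arith runs_load runs_store runs_cond runs_block_nil runs_block_cons

/-! ### Reading the input -/

/-- `G.IsLink` on numbers. -/
def NLink {n m : ℕ} (G : Graph (Fin n) (Fin m)) (e u w : ℕ) : Prop :=
  ∃ (he : e < m) (hu : u < n) (hw : w < n), G.IsLink ⟨e, he⟩ ⟨u, hu⟩ ⟨w, hw⟩

theorem NLink.symm {n m : ℕ} {G : Graph (Fin n) (Fin m)} {e u w : ℕ} (h : NLink G e u w) :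
    NLink G e w u := by
  obtain ⟨he, hu, hw, h⟩ := h
  exact ⟨he, hw, hu, h.symm⟩

theorem NLink.eq_or {n m : ℕ} {G : Graph (Fin n) (Fin m)} {e u w u' w' : ℕ} (h : NLink G e u w)
    (h' : NLink G e u' w') : u = u' ∧ w = w' ∨ u = w' ∧ w = u' := by
  obtain ⟨he, hu, hw, h⟩ := h
  obtain ⟨he', hu', hw', h'⟩ := h'
  simpa [Fin.ext_iff] using h.eq_and_eq_or_eq_and_eq h'

theorem NLink.ne {n m : ℕ} {G : Graph (Fin n) (Fin m)} (hG : G.Loopless) {e u w : ℕ}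
    (h : NLink G e u w) : u ≠ w := by
  obtain ⟨he, hu, hw, h⟩ := h
  have := h.ne
  simpa [Fin.ext_iff] using this

theorem ncard_incidenceSet_le {n m : ℕ} (G : Graph (Fin n) (Fin m)) (v : Fin n) :
    (G.incidenceSet v).ncard ≤ maxDegree G :=
  Finset.le_sup (f := fun v => (G.incidenceSet v).ncard) (Finset.mem_univ v)

open Classical in
/-- `maxDegree` bounds the number of edges at `v` with number less than `N`. -/
theorem card_incident_le {n m : ℕ} (G : Graph (Fin n) (Fin m)) {v : ℕ} (hv : v < n) (N : ℕ) :
    ((Finset.range N).filter fun e => ∃ w, NLink G e v w).card ≤ maxDegree G := by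
  refine le_trans ?_ (ncard_incidenceSet_le G ⟨v, hv⟩)
  rw [← Set.ncard_coe_finset]
  refine le_trans (Set.ncard_le_ncard (t := Fin.val '' G.incidenceSet ⟨v, hv⟩) ?_ (Set.toFinite _))
    (Set.ncard_image_le (Set.toFinite _))
  intro e he
  simp only [Finset.coe_filter, Set.mem_ofPred_eq] at he
  obtain ⟨-, w, he, hu, hw, h⟩ := he
  exact ⟨⟨e, he⟩, ⟨_, h⟩, rfl⟩

/-- The part of the memory that stays fixed once the input has been read: the parameters and the
representation of the graph. -/
structure Env {n m : ℕ} (G : Graph (Fin n) (Fin m)) (k z ℓ : ℕ) (s : Memory) : Prop where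
  regN : s.reg rN = n
  regM : s.reg rM = m
  regK : s.reg rK = k
  regZ : s.reg rZ = z
  regEll : s.reg rEll = ℓ
  cap : s.reg rCap = ℓ * ℓ / Nat.log 2 n
  q : s.reg rQ = ℓ / ((Nat.log 2 n + 1) * 2)
  ends : ∀ e < m, NLink G e (s.arr aEndL e) (s.arr aEndR e)
  deg : ∀ v < n, s.arr aDeg v ≤ maxDegree G
  adj : ∀ v < n, ∀ j < s.arr aDeg v, NLink G (s.arr aAdjE (v * m + j)) v (s.arr aAdjV (v * m + j))
  exists_adj : ∀ e v w, NLink G e v w → ∃ j < s.arr aDeg v,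
    s.arr aAdjE (v * m + j) = e ∧ s.arr aAdjV (v * m + j) = w

/-- Does the program leave alone what `Env` is about? -/
def Prog.keepsEnv (p : Prog) : Bool :=
  [rCap, rN, rM, rK, rZ, rEll, rQ].all (fun r => !p.writesReg r) &&
    [aEndL, aEndR, aDeg, aAdjE, aAdjV].all (fun a => !p.writesArr a)

theorem Env.of_sameOff {n m : ℕ} {G : Graph (Fin n) (Fin m)} {k z ℓ : ℕ} {s s' : Memory} {p : Prog}
    (h : Env G k z ℓ s) (hs : SameOff p s s') (hp : p.keepsEnv = true) : Env G k z ℓ s' := by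
  simp only [Prog.keepsEnv, List.all_cons, List.all_nil, Bool.and_true, Bool.and_eq_true,
    Bool.not_eq_eq_eq_not, Bool.not_true] at hp
  obtain ⟨⟨h1, h2, h3, h4, h5, h6, h7⟩, h8, h9, h10, h11, h12⟩ := hp
  constructor
  · rw [hs.reg _ h2, h.regN]
  · rw [hs.reg _ h3, h.regM]
  · rw [hs.reg _ h4, h.regK]
  · rw [hs.reg _ h5, h.regZ]
  · rw [hs.reg _ h6, h.regEll]
  · rw [hs.reg _ h1, h.cap]
  · rw [hs.reg _ h7, h.q]
  · rw [hs.arr _ h8, hs.arr _ h9]; exact h.ends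
  · rw [hs.arr _ h10]; exact h.deg
  · rw [hs.arr _ h10, hs.arr _ h11, hs.arr _ h12]; exact h.adj
  · rw [hs.arr _ h10, hs.arr _ h11, hs.arr _ h12]; exact h.exists_adj

theorem runs_readHeader {s : Memory} {n m k z ℓ : ℕ} (h0 : s.arr 0 0 = n) (h1 : s.arr 0 1 = m)
    (h2 : s.arr 0 2 = k) (h3 : s.arr 0 3 = z) (h4 : s.arr 0 4 = ℓ) :
    Runs readHeader s fun t s' => t ≤ 4 * Nat.log 2 n + 20 ∧
      s'.reg rN = n ∧ s'.reg rM = m ∧ s'.reg rK = k ∧ s'.reg rZ = z ∧ s'.reg rEll = ℓ ∧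
      s'.reg rCap = ℓ * ℓ / Nat.log 2 n ∧ s'.reg rQ = ℓ / ((Nat.log 2 n + 1) * 2) ∧
      s'.reg rPtr = 5 := by
  simp only [readHeader, runs_block_cons, runs_load, runs_arith]
  refine (Runs.loop (φ := 4 * Nat.log 2 n) (fun φ s' => s'.reg rLog + Nat.log 2 (s'.reg rX) =
    Nat.log 2 n ∧ φ = 4 * Nat.log 2 (s'.reg rX)) ?_ ?_).mono ?_
  · simp [h0]
  · rintro φ s' - ⟨h, rfl⟩ hb
    simp only [Test.holds_lt, Operand.eval_const, Operand.eval_reg] at hb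
    have : Nat.log 2 (s'.reg 31) = Nat.log 2 (s'.reg 31 / 2) + 1 :=
      Nat.log_of_one_lt_of_le (by norm_num) hb
    simp
    omega
  · rintro t s' hs ⟨φ, ⟨h, rfl⟩, hb, ht⟩
    simp only [Test.holds_lt, Operand.eval_const, Operand.eval_reg, not_lt] at hb
    have h0' : Nat.log 2 (s'.reg 31) = 0 := Nat.log_of_lt (by omega)
    have e1 := hs.reg rN rfl
    have e2 := hs.reg rM rfl
    have e3 := hs.reg rK rfl
    have e4 := hs.reg rZ rfl
    have e5 := hs.reg rEll rfl
    simp [h0, h1, h2, h3, h4] at e1 e2 e3 e4 e5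
    rw [h0', add_zero] at h
    simp [e1, e2, e3, e4, e5, h]
    omega

/-- The lists stored in arrays `D`, `AE`, `AV` (the length of the list of `v` is `D v`, its entries
are in cells `v * m + j` of `AE` and `AV`) represent the relation `S`. -/
structure IncidenceLists (n m : ℕ) (D AE AV : ℕ → ℕ) (S : ℕ → ℕ → ℕ → Prop) : Prop where
  sound : ∀ v < n, ∀ j < D v, S (AE (v * m + j)) v (AV (v * m + j))
  complete : ∀ e v w, S e v w → ∃ j < D v, AE (v * m + j) = e ∧ AV (v * m + j) = w
  le : ∀ v < n, D v ≤ m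

theorem mul_add_inj {m v j v' j' : ℕ} (hj : j < m) (hj' : j' < m) (h : v * m + j = v' * m + j') :
    v = v' ∧ j = j' := by
  have h1 := congrArg (· / m) h
  have h2 := congrArg (· % m) h
  simp only [mul_comm _ m, Nat.mul_add_mod, Nat.mul_add_div (by omega : 0 < m), Nat.div_eq_of_lt hj,
    Nat.div_eq_of_lt hj', Nat.mod_eq_of_lt hj, Nat.mod_eq_of_lt hj'] at h1 h2
  exact ⟨by omega, h2⟩

/-- Appending an entry to the list of `a`. -/
theorem IncidenceLists.insert {n m : ℕ} {D AE AV : ℕ → ℕ} {S : ℕ → ℕ → ℕ → Prop}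
    (h : IncidenceLists n m D AE AV S) (hS : ∀ e v w, S e v w → v < n) {a : ℕ} (b e : ℕ)
    (ha : a < n) (hD : D a < m) :
    IncidenceLists n m (Function.update D a (D a + 1)) (Function.update AE (a * m + D a) e)
      (Function.update AV (a * m + D a) b)
      (fun e' v w => S e' v w ∨ e' = e ∧ v = a ∧ w = b) := by
  have hne : ∀ v < n, ∀ j < D v, v * m + j ≠ a * m + D a := by
    intro v hv j hj heq
    obtain ⟨rfl, rfl⟩ := mul_add_inj (lt_of_lt_of_le hj (h.le v hv)) hD heq
    exact lt_irrefl _ hj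
  refine ⟨fun v hv j hj => ?_, fun e' v w hS' => ?_, fun v hv => ?_⟩
  · by_cases hj' : j < D v
    · rw [Function.update_of_ne (hne v hv j hj'), Function.update_of_ne (hne v hv j hj')]
      exact Or.inl (h.sound v hv j hj')
    · rw [Function.update_apply] at hj
      split_ifs at hj with hva
      · subst hva
        obtain rfl : j = D v := by omega
        simp
      · exact absurd hj hj'
  · rcases hS' with hS' | ⟨rfl, rfl, rfl⟩
    · obtain ⟨j, hj, h1, h2⟩ := h.complete e' v w hS'
      refine ⟨j, ?_, ?_⟩
      · rw [Function.update_apply]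
        split_ifs with hva
        · subst hva; omega
        · exact hj
      · rw [Function.update_of_ne (hne v (hS _ _ _ hS') j hj),
          Function.update_of_ne (hne v (hS _ _ _ hS') j hj)]
        exact ⟨h1, h2⟩
    · exact ⟨D v, by simp, by simp⟩
  · rw [Function.update_apply]
    split_ifs with hva
    · omega
    · exact h.le v hv

theorem IncidenceLists.congr {n m : ℕ} {D AE AV : ℕ → ℕ} {S S' : ℕ → ℕ → ℕ → Prop}
    (h : IncidenceLists n m D AE AV S) (hS : ∀ e v w, S e v w ↔ S' e v w) :
    IncidenceLists n m D AE AV S' :=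
  ⟨fun v hv j hj => (hS _ _ _).1 (h.sound v hv j hj),
    fun e v w hw => h.complete e v w ((hS _ _ _).2 hw), h.le⟩

open Classical in
theorem runs_readEdges {n m : ℕ} {G : Graph (Fin n) (Fin m)} (hG : G.Loopless) {s : Memory}
    {u v : Fin m → Fin n} (huv : ∀ e, G.IsLink e (u e) (v e))
    (hu : ∀ e : Fin m, s.arr 0 (5 + 2 * e) = u e) (hv : ∀ e : Fin m, s.arr 0 (5 + 2 * e + 1) = v e)
    (hm : s.reg rM = m) (hptr : s.reg rPtr = 5) (hdeg : ∀ v, s.arr aDeg v = 0) :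
    Runs readEdges s fun t s' => t ≤ 30 * m + 2 ∧ s'.reg rPtr = 5 + 2 * m ∧
      (∀ e < m, NLink G e (s'.arr aEndL e) (s'.arr aEndR e)) ∧
      (∀ v < n, s'.arr aDeg v ≤ maxDegree G) ∧
      IncidenceLists n m (s'.arr aDeg) (s'.arr aAdjE) (s'.arr aAdjV) (NLink G) := by
  refine (Runs.forLoop' (N := m) 28 (fun j s' => s'.reg rPtr = 5 + 2 * j ∧
    (∀ e < j, NLink G e (s'.arr aEndL e) (s'.arr aEndR e)) ∧
    (∀ v < n, s'.arr aDeg v = ((Finset.range j).filter fun e => ∃ w, NLink G e v w).card) ∧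
    IncidenceLists n m (s'.arr aDeg) (s'.arr aAdjE) (s'.arr aAdjV)
      (fun e v w => e < j ∧ NLink G e v w)) (by simpa using hm) rfl rfl ?_ ?_).mono ?_
  · simp only [Memory.reg_setReg, Memory.arr_setReg]
    refine ⟨by simpa using hptr, by simp, by simp [hdeg], ?_, ?_, ?_⟩
    · simp [hdeg]
    · simp
    · simp [hdeg]
  · rintro j s' hs hj hjm ⟨h1, h2, h3, h4⟩
    have hm' : s'.reg rM = m := by rw [hs.reg rM rfl, hm]
    have harr : s'.arr 0 = s.arr 0 := hs.arr 0 rfl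
    have hu' := hu ⟨j, hjm⟩
    have hv' := hv ⟨j, hjm⟩
    simp only at hu' hv'
    have hl : NLink G j (u ⟨j, hjm⟩) (v ⟨j, hjm⟩) :=
      ⟨hjm, Fin.isLt _, Fin.isLt _, huv ⟨j, hjm⟩⟩
    have hne := hl.ne hG
    have hun : ((u ⟨j, hjm⟩ : Fin n) : ℕ) < n := Fin.isLt _
    have hvn : ((v ⟨j, hjm⟩ : Fin n) : ℕ) < n := Fin.isLt _
    simp [addIncidence, harr, h1, hu', hv', hj, hm']
    generalize ((u ⟨j, hjm⟩ : Fin n) : ℕ) = a at *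
    generalize ((v ⟨j, hjm⟩ : Fin n) : ℕ) = b at *
    have hinc : ∀ v, (∃ w, NLink G j v w) ↔ v = a ∨ v = b := by
      refine fun v => ⟨fun ⟨w, hw⟩ => ?_, ?_⟩
      · rcases hw.eq_or hl with h | h <;> omega
      · rintro (rfl | rfl)
        exacts [⟨_, hl⟩, ⟨_, hl.symm⟩]
    have hle : ∀ v < n, s'.arr aDeg v < m := by
      intro v hv
      rw [h3 v hv]
      refine lt_of_le_of_lt (Finset.card_filter_le _ _) ?_
      simpa using hjm
    -- Without loops the second entry goes to another list than the first.
    have hb : Function.update (s'.arr aDeg) a (s'.arr aDeg a + 1) b = s'.arr aDeg b :=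
      Function.update_of_ne hne.symm _ _
    refine ⟨by ring, fun e he => ?_, fun v hv => ?_, ?_⟩
    · rcases he.lt_or_eq with he | rfl
      · rw [Function.update_of_ne he.ne, Function.update_of_ne he.ne]
        exact h2 e he
      · simpa using hl
    · rw [hb, Finset.range_add_one, Finset.filter_insert]
      simp only [hinc]
      by_cases hor : v = a ∨ v = b
      · rw [if_pos hor, Finset.card_insert_of_notMem (by simp)]
        rcases hor with rfl | rfl
        · rw [Function.update_of_ne hne, Function.update_self, h3 v hun]
        · rw [Function.update_self, h3 v hvn]
      · rw [not_or] at hor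
        rw [if_neg (not_or.2 hor), Function.update_of_ne hor.2, Function.update_of_ne hor.1,
          h3 v hv]
    · have hi := (h4.insert (fun e v w h => h.2.choose_spec.choose) b j hun (hle a hun)).insert
        (a := b) (fun e v w h => ?_) a j hvn (by rw [hb]; exact hle b hvn)
      · refine hi.congr fun e v w => ?_
        constructor
        · rintro ((⟨h, h'⟩ | ⟨rfl, rfl, rfl⟩) | ⟨rfl, rfl, rfl⟩)
          exacts [⟨by omega, h'⟩, ⟨le_rfl, hl⟩, ⟨le_rfl, hl.symm⟩]
        · rintro ⟨h, h'⟩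
          rcases h.lt_or_eq with h | rfl
          · exact Or.inl (Or.inl ⟨h, h'⟩)
          · rcases h'.eq_or hl with ⟨rfl, rfl⟩ | ⟨rfl, rfl⟩
            exacts [Or.inl (Or.inr ⟨rfl, rfl, rfl⟩), Or.inr ⟨rfl, rfl, rfl⟩]
      · rcases h with h | h
        exacts [h.2.choose_spec.choose, h.2.1 ▸ hun]
  · rintro t s' hs ⟨⟨h1, h2, h3, h4⟩, ht⟩
    refine ⟨by omega, h1, h2, fun v hv => ?_, h4.congr fun e v w => ?_⟩
    · rw [h3 v hv]; exact card_incident_le G hv m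
    · exact ⟨fun h => h.2, fun h => ⟨h.1, h⟩⟩

/-- In a list made of blocks `f 0, f 1, …` each block starts where the one before it ends. -/
theorem exists_offsets {m : ℕ} (f : Fin m → List ℕ) (x rest : List ℕ) (p₀ : ℕ)
    (hx : x.drop p₀ = (List.finRange m).flatMap f ++ rest) :
    ∃ p : ℕ → ℕ, p 0 = p₀ ∧ (∀ e : Fin m, p (e + 1) = p e + (f e).length) ∧
      (∀ e : Fin m, ∀ j < (f e).length, x.getD (p e + j) 0 = (f e).getD j 0) ∧
      x.drop (p m) = rest := by
  have hdrop : ∀ j, x.drop (p₀ + (((List.finRange m).take j).flatMap f).length) =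
      ((List.finRange m).drop j).flatMap f ++ rest := by
    intro j
    rw [← List.drop_drop, hx]
    nth_rewrite 2 [← List.take_append_drop j (List.finRange m)]
    rw [List.flatMap_append, List.append_assoc, List.drop_left]
  refine ⟨fun j => p₀ + (((List.finRange m).take j).flatMap f).length, by simp, fun e => ?_,
    fun e j hj => ?_, ?_⟩
  · simp only
    rw [List.take_add_one]
    simp [Nat.add_assoc]
  · have h := hdrop e
    rw [List.drop_eq_getElem_cons (i := (e : ℕ)) (by simp), List.flatMap_cons] at h
    simp only [List.getElem_finRange, Fin.cast_mk, Fin.eta] at h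
    have h2 := congrArg (fun l => l.getD j 0) h
    simp only [List.getD_eq_getElem?_getD, List.getElem?_drop] at h2
    rw [List.getD_eq_getElem?_getD, h2, List.append_assoc, List.getElem?_append_left hj,
      List.getD_eq_getElem?_getD]
  · rw [hdrop m, List.drop_of_length_le (by simp)]
    simp

theorem runs_readList {n : ℕ} {a : ℕ} (ha : a ≠ 0) {s : Memory} (l : List (Fin n))
    (hl : ∀ j < (encodeList l).length, s.arr 0 (s.reg rPtr + j) = (encodeList l).getD j 0) :
    Runs (readList a) s fun t s' => t ≤ 6 * l.length + 5 ∧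
      s'.reg rPtr = s.reg rPtr + (encodeList l).length ∧
      ∀ v, s'.arr a v = if v ∈ l.map Fin.val then s.reg rTag else s.arr a v := by
  have h0 : s.arr 0 (s.reg rPtr) = l.length := by
    simpa [encodeList] using hl 0 (by simp [encodeList])
  have h1 : ∀ j (hj : j < l.length), s.arr 0 (s.reg rPtr + 1 + j) = l[j] := by
    intro j hj
    have := hl (j + 1) (by simp [encodeList, hj])
    rw [Nat.add_assoc, Nat.add_comm 1 j, this]
    simp [encodeList, hj]
  simp only [readList, runs_block_cons, runs_load, runs_arith]
  refine (Runs.forLoop' (N := l.length) 4 (fun j s' => s'.reg rPtr = s.reg rPtr + 1 + j ∧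
    ∀ v, s'.arr a v = if v ∈ (l.take j).map Fin.val then s.reg rTag else s.arr a v)
    (by simp [h0]) rfl rfl ?_ ?_).mono ?_
  · simp
  · rintro j s' hs hj hjl ⟨hp, hv⟩
    have e0 : s'.arr 0 = s.arr 0 := by
      rw [hs.arr 0 (by simp [forLoop, block, Prog.writesArr, ha])]; rfl
    have e1 : s'.reg rTag = s.reg rTag := by
      rw [hs.reg rTag rfl]; simp
    simp [e0, e1, hp, h1 j hjl, -List.map_take, -List.mem_map]
    refine ⟨by ring, fun v => ?_⟩
    have hmem : v ∈ (l.take (j + 1)).map Fin.val ↔ v = l[j] ∨ v ∈ (l.take j).map Fin.val := by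
      rw [List.take_succ_eq_append_getElem hjl, List.map_append, List.mem_append, or_comm,
        List.map_singleton, List.mem_singleton]
    rw [Function.update_apply, hv]
    simp only [hmem]
    by_cases hvj : v = l[j] <;> simp only [hvj, if_true, true_or, if_false, false_or]
  · rintro t s' - ⟨⟨h, h'⟩, ht⟩
    simp only [List.take_length] at h'
    simp [encodeList, h, h']
    omega

theorem runs_readSets {n k : ℕ} {A B : Fin k → Finset (Fin n)} {a b : Fin k → List (Fin n)}
    (ha : ∀ i, Enumerates (a i) (A i)) (hb : ∀ i, Enumerates (b i) (B i))
    (hA : ∀ i j, i ≠ j → Disjoint (A i) (A j)) (hB : ∀ i j, i ≠ j → Disjoint (B i) (B j))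
    {s : Memory} {p : ℕ → ℕ}
    (hp : ∀ i : Fin k, p (i + 1) = p i + (encodeList (a i) ++ encodeList (b i)).length)
    (hx : ∀ i : Fin k, ∀ j < (encodeList (a i) ++ encodeList (b i)).length,
      s.arr 0 (p i + j) = (encodeList (a i) ++ encodeList (b i)).getD j 0)
    (hk : s.reg rK = k) (hptr : s.reg rPtr = p 0)
    (hTA : ∀ v, s.arr aTagA v = 0) (hTB : ∀ v, s.arr aTagB v = 0) :
    Runs readSets s fun t s' => t ≤ (12 * n + 14) * k + 2 ∧
      (∀ v : Fin n, (∀ i : Fin k, s'.arr aTagA v = i + 1 ↔ v ∈ A i) ∧ s'.arr aTagA v ≤ k) ∧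
      (∀ v : Fin n, (∀ i : Fin k, s'.arr aTagB v = i + 1 ↔ v ∈ B i) ∧ s'.arr aTagB v ≤ k) := by
  have key : ∀ (A : Fin k → Finset (Fin n)) (a : Fin k → List (Fin n)),
      (∀ i, Enumerates (a i) (A i)) → (∀ i j, i ≠ j → Disjoint (A i) (A j)) →
      ∀ (T T' : ℕ → ℕ) (i : ℕ) (hi : i < k),
      (∀ v : Fin n, (∀ j : Fin k, T v = j + 1 ↔ (j : ℕ) < i ∧ v ∈ A j) ∧ T v ≤ i) →
      (∀ v, T' v = if v ∈ (a ⟨i, hi⟩).map Fin.val then i + 1 else T v) →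
      (∀ v : Fin n, (∀ j : Fin k, T' v = j + 1 ↔ (j : ℕ) < i + 1 ∧ v ∈ A j) ∧ T' v ≤ i + 1) := by
    intro A a ha hA T T' i hi hT hT' v
    have hmem : (v : ℕ) ∈ (a ⟨i, hi⟩).map Fin.val ↔ v ∈ A ⟨i, hi⟩ := by
      rw [← (ha ⟨i, hi⟩).2]
      simp [Fin.val_inj]
    obtain ⟨h1, h2⟩ := hT v
    rw [hT']
    split_ifs with h <;> rw [hmem] at h
    · refine ⟨fun j => ⟨fun hj => ?_, fun ⟨hj, hv⟩ => ?_⟩, le_rfl⟩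
      · obtain rfl : j = ⟨i, hi⟩ := Fin.ext (by simp; omega)
        exact ⟨by simp, h⟩
      · by_contra hne
        have : j ≠ ⟨i, hi⟩ := by rintro rfl; exact hne rfl
        exact Finset.disjoint_left.1 (hA _ _ this) hv h
    · refine ⟨fun j => (h1 j).trans ⟨fun hj => ⟨by omega, hj.2⟩, fun ⟨hj, hv⟩ => ⟨?_, hv⟩⟩,
        by omega⟩
      rcases (Nat.lt_succ_iff.1 hj).lt_or_eq with h' | h'
      · exact h'
      · obtain rfl : j = ⟨i, hi⟩ := Fin.ext h'
        exact absurd hv h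
  have hlen : ∀ (A : Finset (Fin n)) (l : List (Fin n)), Enumerates l A → l.length ≤ n := by
    intro A l h
    simpa using h.1.length_le_card
  refine (Runs.forLoop' (N := k) (12 * n + 12) (fun i s' => s'.reg rPtr = p i ∧
    (∀ v : Fin n, (∀ j : Fin k, s'.arr aTagA v = j + 1 ↔ (j : ℕ) < i ∧ v ∈ A j) ∧
      s'.arr aTagA v ≤ i) ∧
    (∀ v : Fin n, (∀ j : Fin k, s'.arr aTagB v = j + 1 ↔ (j : ℕ) < i ∧ v ∈ B j) ∧
      s'.arr aTagB v ≤ i)) (by simpa using hk) rfl rfl ?_ ?_).mono ?_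
  · simp [hptr, hTA, hTB]
  · rintro i s₁ hs hi hik ⟨h1, h2, h3⟩
    have e0 : s₁.arr 0 = s.arr 0 := hs.arr 0 rfl
    have hxi := hx ⟨i, hik⟩
    have hpi := hp ⟨i, hik⟩
    simp only [List.length_append] at hxi hpi
    simp only [runs_block_cons, runs_arith]
    refine (runs_readList (by norm_num) (a ⟨i, hik⟩) ?_).mono ?_
    · intro j hj
      have := hxi j (by omega)
      simp only [Memory.arr_setReg, Memory.reg_setReg, e0, h1]
      norm_num
      rw [this, List.getD_append _ _ _ _ hj, List.getD_eq_getElem?_getD]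
    rintro t₂ s₂ hs₂ ⟨ht₂, hp₂, hv₂⟩
    simp [hi, h1] at hp₂ hv₂
    refine (runs_readList (by norm_num) (b ⟨i, hik⟩) ?_).mono ?_
    · intro j hj
      have := hxi ((encodeList (a ⟨i, hik⟩)).length + j) (by omega)
      have e2 : s₂.arr 0 = s.arr 0 := by rw [hs₂.arr 0 rfl, Memory.arr_setReg, e0]
      rw [e2, hp₂, Nat.add_assoc, this, List.getD_append_right _ _ _ _ (by omega)]
      simp
    rintro t₃ s₃ hs₃ ⟨ht₃, hp₃, hv₃⟩
    have e3 : s₂.reg rTag = i + 1 := by rw [hs₂.reg rTag rfl]; simp [hi]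
    have e4 : s₂.arr aTagB = s₁.arr aTagB := by rw [hs₂.arr aTagB rfl]; rfl
    have e5 : s₃.arr aTagA = s₂.arr aTagA := by rw [hs₃.arr aTagA rfl]
    rw [e3, e4] at hv₃
    simp only [runs_block_nil, Memory.reg_setReg, Memory.arr_setReg, e5]
    refine ⟨⟨?_, key A a ha hA _ _ i hik h2 ?_, key B b hb hB _ _ i hik h3 ?_⟩, ?_⟩
    · norm_num
      omega
    · simpa using hv₂
    · simpa using hv₃
    · have := hlen _ _ (ha ⟨i, hik⟩)
      have := hlen _ _ (hb ⟨i, hik⟩)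
      omega
  · rintro t s' - ⟨⟨-, h2, h3⟩, ht⟩
    refine ⟨ht, fun v => ⟨fun i => ?_, (h2 v).2⟩, fun v => ⟨fun i => ?_, (h3 v).2⟩⟩
    · rw [(h2 v).1 i]; simp
    · rw [(h3 v).1 i]; simp

/-! ### Searching for a path -/

theorem Env.setReg {n m : ℕ} {G : Graph (Fin n) (Fin m)} {k z ℓ : ℕ} {s : Memory}
    (h : Env G k z ℓ s) {r : ℕ} (hr : 10 ≤ r) (v : ℕ) : Env G k z ℓ (s.setReg r v) := by
  have h' : ∀ r' < 10, (s.setReg r v).reg r' = s.reg r' := fun r' hr' => by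
    rw [Memory.reg_setReg, if_neg (by omega)]
  refine ⟨?_, ?_, ?_, ?_, ?_, ?_, ?_, h.ends, h.deg, h.adj, h.exists_adj⟩ <;>
    rw [h' _ (by norm_num)]
  exacts [h.regN, h.regM, h.regK, h.regZ, h.regEll, h.cap, h.q]

theorem Env.setCell {n m : ℕ} {G : Graph (Fin n) (Fin m)} {k z ℓ : ℕ} {s : Memory}
    (h : Env G k z ℓ s) {a : ℕ} (ha : 9 ≤ a) (j v : ℕ) : Env G k z ℓ (s.setCell a j v) := by
  have h' : ∀ a' < 9, (s.setCell a j v).arr a' = s.arr a' := fun a' ha' => by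
    rw [Memory.arr_setCell, if_neg (by omega)]
  refine ⟨h.regN, h.regM, h.regK, h.regZ, h.regEll, h.cap, h.q, ?_, ?_, ?_, ?_⟩ <;>
    simp only [h' 4 (by norm_num), h' 5 (by norm_num), h' 6 (by norm_num), h' 7 (by norm_num),
      h' 8 (by norm_num)]
  exacts [h.ends, h.deg, h.adj, h.exists_adj]

theorem NLink.lt {n m : ℕ} {G : Graph (Fin n) (Fin m)} {e u w : ℕ} (h : NLink G e u w) :
    u < n := h.choose_spec.choose

theorem runs_scan {n m : ℕ} {G : Graph (Fin n) (Fin m)} {k z ℓ : ℕ} {s : Memory}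
    (h : Env G k z ℓ s) (hv : s.reg rV < n) :
    Runs scan s fun t s' => t ≤ 16 * maxDegree G + 6 ∧ s'.reg rLabV = s.arr aLab (s.reg rV) ∧
      (s'.reg rFound = 0 ∧ (∀ e w, NLink G e (s.reg rV) w → s.arr aCong e < s.reg rCap →
          s.arr aLab w + 1 ≠ s.arr aLab (s.reg rV)) ∨
        s'.reg rFound ≠ 0 ∧ NLink G (s'.reg rFound - 1) (s.reg rV) (s'.reg rNext) ∧
          s.arr aCong (s'.reg rFound - 1) < s.reg rCap ∧
          s.arr aLab (s'.reg rNext) + 1 = s.arr aLab (s.reg rV)) := by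
  simp only [scan, runs_block_cons, runs_load, runs_arith]
  refine (Runs.forLoop' (N := s.arr aDeg (s.reg rV)) 14 (fun j s' =>
    s'.reg rLabV = s.arr aLab (s.reg rV) ∧
      (s'.reg rFound = 0 ∧ (∀ i < j,
          s.arr aCong (s.arr aAdjE (s.reg rV * m + i)) < s.reg rCap →
          s.arr aLab (s.arr aAdjV (s.reg rV * m + i)) + 1 ≠ s.arr aLab (s.reg rV)) ∨
        s'.reg rFound ≠ 0 ∧ NLink G (s'.reg rFound - 1) (s.reg rV) (s'.reg rNext) ∧
          s.arr aCong (s'.reg rFound - 1) < s.reg rCap ∧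
          s.arr aLab (s'.reg rNext) + 1 = s.arr aLab (s.reg rV)))
    (by simp) rfl rfl ?_ ?_).mono ?_
  · simp
  · rintro j s' hs hj hjd ⟨h1, h2⟩
    have e1 := hs.reg rV rfl
    have e2 := hs.reg rM rfl
    have e3 := hs.arr aAdjE rfl
    have e4 := hs.arr aAdjV rfl
    have e5 := hs.arr aCong rfl
    have e6 := hs.arr aLab rfl
    have e7 := hs.reg rCap rfl
    have hadj := h.adj _ hv j hjd
    simp [h.regM] at e1 e2 e3 e4 e5 e6 e7
    simp [e1, e2, e3, e4, e5, e6, e7, hj, h1]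
    have hext : (s.arr aCong (s.arr aAdjE (s.reg rV * m + j)) < s.reg rCap →
        ¬ s.arr aLab (s.arr aAdjV (s.reg rV * m + j)) + 1 = s.arr aLab (s.reg rV)) →
        (∀ i < j, s.arr aCong (s.arr aAdjE (s.reg rV * m + i)) < s.reg rCap →
          ¬ s.arr aLab (s.arr aAdjV (s.reg rV * m + i)) + 1 = s.arr aLab (s.reg rV)) →
        ∀ i ≤ j, s.arr aCong (s.arr aAdjE (s.reg rV * m + i)) < s.reg rCap →
          ¬ s.arr aLab (s.arr aAdjV (s.reg rV * m + i)) + 1 = s.arr aLab (s.reg rV) := by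
      intro h3 h4 i hi
      rcases hi.lt_or_eq with hi | rfl
      exacts [h4 i hi, h3]
    exact ⟨fun hC => ⟨fun hlab => ⟨hadj, hC, hlab⟩, fun hlab =>
        h2.imp (fun h3 => ⟨h3.1, hext (fun _ => hlab) h3.2⟩) id⟩, fun hC =>
      h2.imp (fun h3 => ⟨h3.1, hext (fun h4 => absurd hC (not_le.2 h4)) h3.2⟩) id⟩
  · rintro t s' - ⟨⟨h1, h2⟩, ht⟩
    have := h.deg _ hv
    rw [runs_block_nil]
    refine ⟨?_, h1, h2.imp (fun ⟨h3, h4⟩ => ⟨h3, fun e w hl hC => ?_⟩) id⟩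
    · have := Nat.mul_le_mul_left 16 this
      omega
    · obtain ⟨j, hj, rfl, rfl⟩ := h.exists_adj _ _ _ hl
      exact h4 j hj hC

/-- `lab` is a lower bound for the distance to the vertices tagged `tag` in the graph of the edges
whose usage `C` is less than `cap`, in the form of local conditions. -/
structure LabelsOK {n m : ℕ} (G : Graph (Fin n) (Fin m)) (cap tag : ℕ) (C lab tagB : ℕ → ℕ) :
    Prop where
  le_succ : ∀ e u w, NLink G e u w → C e < cap → lab u ≤ lab w + 1
  target : ∀ v < n, tagB v = tag → lab v = 0

/-- The vertices `S 0, …, S top` form a path with edges `E 1, …, E top` of usage less than `cap`,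
along which the labels decrease by one. -/
def StackOK {n m : ℕ} (G : Graph (Fin n) (Fin m)) (cap : ℕ) (C lab S E : ℕ → ℕ) (top : ℕ) : Prop :=
  ∀ j < top, NLink G (E (j + 1)) (S j) (S (j + 1)) ∧ C (E (j + 1)) < cap ∧
    lab (S j) = lab (S (j + 1)) + 1

theorem StackOK.zero {n m : ℕ} {G : Graph (Fin n) (Fin m)} {cap : ℕ} {C lab S E : ℕ → ℕ} :
    StackOK G cap C lab S E 0 := fun _ h => absurd h (Nat.not_lt_zero _)

theorem StackOK.lab_add {n m : ℕ} {G : Graph (Fin n) (Fin m)} {cap : ℕ} {C lab S E : ℕ → ℕ}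
    {top : ℕ} (h : StackOK G cap C lab S E top) : ∀ j ≤ top, lab (S j) + j = lab (S 0) := by
  intro j hj
  induction j with
  | zero => rfl
  | succ j ih => have := (h j hj).2.2; have := ih (by omega); omega

theorem StackOK.lt {n m : ℕ} {G : Graph (Fin n) (Fin m)} {cap : ℕ} {C lab S E : ℕ → ℕ}
    {top : ℕ} (h : StackOK G cap C lab S E top) (h0 : S 0 < n) : ∀ j ≤ top, S j < n := by
  rintro (_ | j) hj
  · exact h0
  · exact NLink.lt (h j hj).1.symm

theorem StackOK.push {n m : ℕ} {G : Graph (Fin n) (Fin m)} {cap : ℕ} {C lab S E : ℕ → ℕ}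
    {top : ℕ} (h : StackOK G cap C lab S E top) {e w : ℕ} (hl : NLink G e (S top) w)
    (hC : C e < cap) (hlab : lab w + 1 = lab (S top)) :
    StackOK G cap C lab (Function.update S (top + 1) w) (Function.update E (top + 1) e)
      (top + 1) := by
  intro j hj
  rw [Function.update_of_ne (a := j) (by omega)]
  rcases (Nat.lt_succ_iff.1 hj).lt_or_eq with hj | rfl
  · rw [Function.update_of_ne (by omega), Function.update_of_ne (by omega)]
    exact h j hj
  · simp [hl, hC, hlab]

/-- Labels stay valid when that of a dead end is raised by one. -/
theorem LabelsOK.relabel {n m : ℕ} {G : Graph (Fin n) (Fin m)} {cap tag : ℕ} {C lab tagB : ℕ → ℕ}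
    (h : LabelsOK G cap tag C lab tagB) {v : ℕ} (hv : tagB v ≠ tag)
    (hno : ∀ e w, NLink G e v w → C e < cap → lab w + 1 ≠ lab v) :
    LabelsOK G cap tag C (Function.update lab v (lab v + 1)) tagB := by
  have hmono : ∀ w, lab w ≤ Function.update lab v (lab v + 1) w := by
    intro w
    rw [Function.update_apply]
    split_ifs with hw
    · rw [hw]; omega
    · exact le_rfl
  refine ⟨fun e u w hl hC => ?_, fun w hw ht => ?_⟩
  · have h1 := h.le_succ e u w hl hC
    have h2 := hmono w
    by_cases hu : u = v
    · subst hu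
      have h3 := hno e w hl hC
      rw [Function.update_self]
      omega
    · rw [Function.update_of_ne hu]
      omega
  · have : w ≠ v := by rintro rfl; exact hv ht
    rw [Function.update_of_ne this]
    exact h.target w hw ht

/-- The label of the last vertex of the path does not matter once this vertex has been removed. -/
theorem StackOK.relabel {n m : ℕ} {G : Graph (Fin n) (Fin m)} {cap : ℕ} {C lab S E : ℕ → ℕ}
    {top : ℕ} (h : StackOK G cap C lab S E top) (x : ℕ) :
    StackOK G cap C (Function.update lab (S top) x) S E (top - 1) := by
  intro j hj
  have hne : ∀ i < top, S i ≠ S top := by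
    intro i hi heq
    have h1 := h.lab_add i hi.le
    have h2 := h.lab_add top le_rfl
    rw [heq] at h1
    omega
  rw [Function.update_of_ne (hne j (by omega)), Function.update_of_ne (hne (j + 1) (by omega))]
  exact h j (by omega)

/-- How often labels can still be increased before all of them exceed `ℓ`. -/
def labelSlack (n ℓ : ℕ) (lab : ℕ → ℕ) : ℕ := ∑ v ∈ Finset.range n, (ℓ + 1 - lab v)

theorem labelSlack_relabel {n ℓ v : ℕ} {lab : ℕ → ℕ} (hv : v < n) (hlab : lab v ≤ ℓ) :
    labelSlack n ℓ (Function.update lab v (lab v + 1)) + 1 = labelSlack n ℓ lab := by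
  unfold labelSlack
  rw [← Finset.add_sum_erase _ _ (Finset.mem_range.2 hv),
    ← Finset.add_sum_erase (Finset.range n) (fun v => ℓ + 1 - lab v) (Finset.mem_range.2 hv),
    Function.update_self]
  rw [Finset.sum_congr rfl (g := fun v => ℓ + 1 - lab v)]
  · omega
  · intro w hw
    rw [Function.update_of_ne (Finset.ne_of_mem_erase hw)]

/-- What holds before and after each step of a search. The search from `rSrc` goes on while `rDone`
is `0`; it ends with `rDone = 1` if it is successful and with `rDone = 2` otherwise. -/
structure SearchInv {n m : ℕ} (G : Graph (Fin n) (Fin m)) (k z ℓ : ℕ) (s : Memory) : Prop where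
  env : Env G k z ℓ s
  labels : LabelsOK G (s.reg rCap) (s.reg rTag) (s.arr aCong) (s.arr aLab) (s.arr aTagB)
  stack : StackOK G (s.reg rCap) (s.arr aCong) (s.arr aLab) (s.arr aStackV) (s.arr aStackE)
    (s.reg rTop)
  bottom : s.arr aStackV 0 = s.reg rSrc
  top : s.arr aStackV (s.reg rTop) = s.reg rV
  src : s.reg rSrc < n
  zero : s.reg rDone = 0 → s.arr aLab (s.reg rSrc) ≤ ℓ
  one : s.reg rDone = 1 → s.arr aTagB (s.reg rV) = s.reg rTag ∧ s.reg rTop ≤ ℓ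
  two : s.reg rDone ≠ 0 → s.reg rDone ≠ 1 → ℓ < s.arr aLab (s.reg rSrc)

/-- Extending the path by an edge shortens the distance that it may still go, and a relabeling, which
may shorten the path by one, is paid for by two units of label slack. -/
theorem runs_searchStep {n m : ℕ} {G : Graph (Fin n) (Fin m)} {k z ℓ : ℕ} {s : Memory}
    (h : SearchInv G k z ℓ s) (h0 : s.reg rDone = 0) :
    Runs searchStep s fun t s' => t ≤ 16 * maxDegree G + 24 ∧ SearchInv G k z ℓ s' ∧
      (∀ v, s.arr aLab v ≤ s'.arr aLab v) ∧
      2 * labelSlack n ℓ (s'.arr aLab) +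
          (if s'.reg rDone = 0 then ℓ + 1 - s'.reg rTop else 0) + 1 ≤
        2 * labelSlack n ℓ (s.arr aLab) + (ℓ + 1 - s.reg rTop) := by
  have hsrc := h.zero h0
  have htop : s.arr aLab (s.reg rV) + s.reg rTop = s.arr aLab (s.reg rSrc) := by
    rw [← h.top, ← h.bottom]; exact h.stack.lab_add _ le_rfl
  have hv : s.reg rV < n := by
    rw [← h.top]; exact h.stack.lt (by rw [h.bottom]; exact h.src) _ le_rfl
  simp only [searchStep, runs_block_cons, runs_load, runs_cond, runs_block_nil]
  refine ⟨fun hb => ?_, fun hb => ?_⟩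
  · simp at hb ⊢
    refine ⟨⟨h.env.setReg (by norm_num) _ |>.setReg (by norm_num) _, by simpa using h.labels,
      by simpa using h.stack, by simpa using h.bottom, by simpa using h.top, by simpa using h.src,
      by simp, ?_, by simp⟩, by omega⟩
    simp [hb]; omega
  · simp at hb
    have hmono : ∀ w, s.arr aLab w ≤
        Function.update (s.arr aLab) (s.reg rV) (s.arr aLab (s.reg rV) + 1) w := by
      intro w
      rw [Function.update_apply]
      split_ifs with hw
      · rw [hw]; omega
      · exact le_rfl
    refine (runs_scan (h.env.setReg (by norm_num) _) (by simpa using hv)).mono ?_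
    rintro t s' hs ⟨ht, hl, hf⟩
    have env' := h.env.setReg (r := rT) (by norm_num) (s.arr aTagB (s.reg rV)) |>.of_sameOff hs rfl
    have e1 := hs.reg rV rfl
    have e2 := hs.reg rTop rfl
    have e3 := hs.reg rCap rfl
    have e4 := hs.reg rTag rfl
    have e5 := hs.reg rSrc rfl
    have e6 := hs.reg rDone rfl
    have e7 := hs.reg rEll rfl
    have f1 := hs.arr aLab rfl
    have f2 := hs.arr aCong rfl
    have f3 := hs.arr aStackV rfl
    have f4 := hs.arr aStackE rfl
    have f5 := hs.arr aTagB rfl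
    simp [h0] at e1 e2 e3 e4 e5 e6 e7 hl hf
    simp only [Memory.arr_setReg] at f1 f2 f3 f4 f5
    refine ⟨fun hb' => ?_, fun hb' => ?_⟩
    · simp at hb'
      simp [hb'] at hf
      have hlab := h.labels.relabel hb hf
      have hstack := h.stack.relabel (s.arr aLab (s.reg rV) + 1)
      rw [h.top] at hstack
      have hslack := labelSlack_relabel (lab := s.arr aLab) (ℓ := ℓ) hv (by omega)
      simp only [relabel, runs_block_cons, runs_arith, runs_store, runs_cond, runs_block_nil,
        runs_load, runs_skip]
      refine ⟨fun hb2 => ?_, fun hb2 => ⟨fun hb3 => ?_, fun hb3 => ?_⟩⟩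
      · simp [e2] at hb2
        have hne : s.reg rSrc ≠ s.reg rV := by
          intro heq
          rw [heq] at htop
          omega
        simp [e1, e2, f1, f3, hl]
        refine ⟨by omega, ⟨((env'.setReg (by norm_num) _).setCell (by norm_num) _ _).setReg
          (by norm_num) _ |>.setReg (by norm_num) _, by simpa [e3, e4, f1, f2, f5] using hlab,
          by simpa [e3, f1, f2, f3, f4] using hstack, by simpa [f3, e5] using h.bottom,
          by simp [f3], by simpa [e5] using h.src, ?_, by simp [e6], by simp [e6]⟩, ?_⟩
        · simpa [e5, e6, f1, hne] using hsrc
        · refine ⟨hmono, ?_⟩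
          simp [e6]
          omega
      · simp [e2] at hb2
        have hvs : s.reg rV = s.reg rSrc := by rw [← h.bottom, ← h.top, hb2]
        simp [e7, hl, h.env.regEll] at hb3
        simp [e1, f1, hl]
        refine ⟨by omega, ⟨((env'.setReg (by norm_num) _).setCell (by norm_num) _ _).setReg
          (by norm_num) _, by simpa [e3, e4, f1, f2, f5] using hlab,
          by simpa [e2, hb2] using StackOK.zero (G := G), by simpa [f3, e5] using h.bottom,
          by simpa [f3, e1, e2] using h.top, by simpa [e5] using h.src, by simp, by simp, ?_⟩, ?_⟩
        · simp [e5, ← hvs]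
          omega
        · exact ⟨hmono, by omega⟩
      · simp [e2] at hb2
        have hvs : s.reg rV = s.reg rSrc := by rw [← h.bottom, ← h.top, hb2]
        simp [e7, hl, h.env.regEll] at hb3
        simp [e1, f1, hl]
        refine ⟨by omega, ⟨((env'.setReg (by norm_num) _).setCell (by norm_num) _ _),
          by simpa [e3, e4, f1, f2, f5] using hlab,
          by simpa [e2, hb2] using StackOK.zero (G := G), by simpa [f3, e5] using h.bottom,
          by simpa [f3, e1, e2] using h.top, by simpa [e5] using h.src, ?_, by simp [e6],
          by simp [e6]⟩, ?_⟩
        · simp [e5, ← hvs]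
          omega
        · refine ⟨hmono, ?_⟩
          simp [e6]
          omega
    · simp at hb'
      simp [hb'] at hf
      obtain ⟨hf1, hf2, hf3⟩ := hf
      have hstack := h.stack.push (by rw [h.top]; exact hf1) hf2 (by rw [h.top]; exact hf3)
      have hlt := hstack.lab_add _ le_rfl
      rw [Function.update_self, Function.update_of_ne (by omega), h.bottom] at hlt
      simp only [push, runs_block_cons, runs_arith, runs_store, runs_block_nil]
      simp [e2]
      refine ⟨by omega, ⟨((env'.setReg (by norm_num) _).setCell (by norm_num) _ _).setReg
          (by norm_num) _ |>.setCell (by norm_num) _ _ |>.setReg (by norm_num) _,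
          by simpa [e3, e4, f1, f2, f5] using h.labels, by simpa [e2, e3, f1, f2, f3, f4] using hstack,
          by simpa [f3, e5] using h.bottom, by simp, by simpa [e5] using h.src, ?_, by simp [e6],
          by simp [e6]⟩, ?_⟩
      · simpa [e5, e6, f1] using hsrc
      · simp [e6, f1]
        omega

/-- A search takes `O(ℓ)` steps, apart from those paid for by changes of labels. -/
theorem runs_search {n m : ℕ} {G : Graph (Fin n) (Fin m)} {k z ℓ : ℕ} {s : Memory}
    (henv : Env G k z ℓ s) (hsrc : s.reg rSrc < n)
    (hlab : LabelsOK G (s.reg rCap) (s.reg rTag) (s.arr aCong) (s.arr aLab) (s.arr aTagB)) :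
    Runs search s fun t s' => SearchInv G k z ℓ s' ∧ s'.reg rDone ≠ 0 ∧
      (∀ v, s.arr aLab v ≤ s'.arr aLab v) ∧
      t + (16 * maxDegree G + 25) * (2 * labelSlack n ℓ (s'.arr aLab)) ≤
        (16 * maxDegree G + 25) * (2 * labelSlack n ℓ (s.arr aLab) + (ℓ + 1)) + 10 := by
  have key : ∀ s₁, SearchInv G k z ℓ s₁ → s₁.arr aLab = s.arr aLab → s₁.reg rTop = 0 →
      Runs (.loop (.eq (.reg rDone) (.const 0)) searchStep) s₁ fun t s' => SearchInv G k z ℓ s' ∧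
        s'.reg rDone ≠ 0 ∧ (∀ v, s.arr aLab v ≤ s'.arr aLab v) ∧
        t + (16 * maxDegree G + 25) * (2 * labelSlack n ℓ (s'.arr aLab)) ≤
        (16 * maxDegree G + 25) * (2 * labelSlack n ℓ (s.arr aLab) + (ℓ + 1)) + 1 := by
    intro s₁ h₁ hl₁ ht₁
    refine (Runs.loop (φ := (16 * maxDegree G + 25) * (2 * labelSlack n ℓ (s₁.arr aLab) +
      if s₁.reg rDone = 0 then ℓ + 1 - s₁.reg rTop else 0))
      (fun φ s' => SearchInv G k z ℓ s' ∧ (∀ v, s.arr aLab v ≤ s'.arr aLab v) ∧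
      φ = (16 * maxDegree G + 25) * (2 * labelSlack n ℓ (s'.arr aLab) +
        if s'.reg rDone = 0 then ℓ + 1 - s'.reg rTop else 0)) ⟨h₁, fun v => by rw [hl₁], rfl⟩ ?_).mono ?_
    · rintro φ s' - ⟨h, hm, rfl⟩ hb
      simp only [Test.holds_eq, Operand.eval_reg, Operand.eval_const] at hb
      refine (runs_searchStep h hb).mono ?_
      rintro t s'' - ⟨ht, h', hm', hd⟩
      refine ⟨_, ⟨h', fun v => (hm v).trans (hm' v), rfl⟩, ?_⟩
      rw [if_pos hb]
      have := Nat.mul_le_mul_left (16 * maxDegree G + 25) hd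
      rw [Nat.mul_add _ _ 1] at this
      omega
    · rintro t s' - ⟨φ', ⟨h, hm, rfl⟩, hb, ht⟩
      simp only [Test.holds_eq, Operand.eval_reg, Operand.eval_const] at hb
      refine ⟨h, hb, hm, ?_⟩
      rw [if_neg hb, hl₁, ht₁] at ht
      refine ht.trans (Nat.add_le_add_right (Nat.mul_le_mul_left _ ?_) _)
      split_ifs <;> omega
  -- If the source already has a label above `ℓ`, the search ends at once.
  simp only [search, runs_block_cons, runs_arith, runs_store, runs_load, runs_cond, runs_block_nil]
  refine ⟨fun hb => ?_, fun hb => ?_⟩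
  · refine (key _ ⟨?_, by simpa using hlab, by simpa using StackOK.zero, by simp, by simp, by simpa using hsrc,
      by simp, by simp, ?_⟩ (by simp) (by simp)).mono ?_
    · exact (((henv.setReg (by norm_num) _).setReg (by norm_num) _).setCell (by norm_num) _ _).setReg
        (by norm_num) _ |>.setReg (by norm_num) _
    · simpa [henv.regEll] using hb
    · rintro t s' - ⟨h1, h2, h3, h4⟩
      exact ⟨h1, h2, h3, by omega⟩
  · refine (key _ ⟨?_, by simpa using hlab, by simpa using StackOK.zero, by simp, by simp, by simpa using hsrc,
      ?_, by simp, by simp⟩ (by simp) (by simp)).mono ?_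
    · exact (((henv.setReg (by norm_num) _).setReg (by norm_num) _).setCell (by norm_num) _ _).setReg
        (by norm_num) _ |>.setReg (by norm_num) _
    · simpa [henv.regEll] using hb
    · rintro t s' - ⟨h1, h2, h3, h4⟩
      exact ⟨h1, h2, h3, by omega⟩

/-! ### Recording a path -/

/-- A routed pair of vertices of `A idx` and `B idx`, with its path. -/
structure Route (n m k : ℕ) where
  idx : Fin k
  src : Fin n
  tgt : Fin n
  path : List (Fin m × Fin n)

/-- The words of the output that describe a routed pair. -/
def Route.words {n m k : ℕ} (r : Route n m k) : List ℕ :=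
  [(r.idx : ℕ), (r.src : ℕ), (r.tgt : ℕ), r.path.length] ++
    r.path.flatMap fun ew => [(ew.1 : ℕ), (ew.2 : ℕ)]

/-- How often the path traverses the edge `e`. -/
def Route.count {n m k : ℕ} (r : Route n m k) (e : ℕ) : ℕ :=
  (r.path.map fun ew => (ew.1 : ℕ)).count e

/-- How often the paths of the list traverse the edge `e`. -/
def usage {n m k : ℕ} (L : List (Route n m k)) (e : ℕ) : ℕ := (L.map fun r => r.count e).sum

/-- The words `w` stand in the array from cell `o` on, and `out` is the next cell. -/
def Printed (o : ℕ) (w : List ℕ) (out : ℕ) (arr : ℕ → ℕ) : Prop :=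
  out = o + w.length ∧ ∀ j < w.length, arr (o + j) = w.getD j 0

theorem Printed.snoc {o : ℕ} {w : List ℕ} {out : ℕ} {arr : ℕ → ℕ} (h : Printed o w out arr)
    (x : ℕ) : Printed o (w ++ [x]) (out + 1) (Function.update arr out x) := by
  obtain ⟨rfl, h⟩ := h
  refine ⟨by simp [Nat.add_assoc], fun j hj => ?_⟩
  rw [List.length_append, List.length_singleton, Nat.lt_succ_iff] at hj
  rcases hj.lt_or_eq with hj | rfl
  · rw [Function.update_of_ne (by omega), h j hj, List.getD_append _ _ _ _ hj]
  · simp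

/-- The list `L` of routed pairs has been output, and the tags are up to date: the vertices of `A i`
and `B i` that are still unmatched have tag `i + 1`. -/
structure LogInv {n m k : ℕ} (G : Graph (Fin n) (Fin m)) (A B : Fin k → Finset (Fin n))
    (L : List (Route n m k)) (s : Memory) : Prop where
  path : ∀ r ∈ L, IsPath G r.src r.path r.tgt
  memA : ∀ r ∈ L, r.src ∈ A r.idx
  memB : ∀ r ∈ L, r.tgt ∈ B r.idx
  nodupA : (L.map Route.src).Nodup
  nodupB : (L.map Route.tgt).Nodup
  tagA : ∀ (v : Fin n) (i : Fin k), s.arr aTagA v = i + 1 ↔ v ∈ A i ∧ v ∉ L.map Route.src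
  tagB : ∀ (v : Fin n) (i : Fin k), s.arr aTagB v = i + 1 ↔ v ∈ B i ∧ v ∉ L.map Route.tgt
  tagA_le : ∀ v : Fin n, s.arr aTagA v ≤ k
  tagB_le : ∀ v : Fin n, s.arr aTagB v ≤ k
  printed : Printed 2 (L.flatMap Route.words) (s.reg rOut) (s.arr 1)
  cnt : s.reg rCnt = L.length

theorem LogInv.of_eq {n m k : ℕ} {G : Graph (Fin n) (Fin m)} {A B : Fin k → Finset (Fin n)}
    {L : List (Route n m k)} {s s' : Memory} (h : LogInv G A B L s)
    (h1 : s'.arr aTagA = s.arr aTagA) (h2 : s'.arr aTagB = s.arr aTagB) (h3 : s'.arr 1 = s.arr 1)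
    (h4 : s'.reg rOut = s.reg rOut) (h5 : s'.reg rCnt = s.reg rCnt) : LogInv G A B L s' := by
  obtain ⟨a1, a2, a3, a4, a5, a6, a7, a8, a9, a10, a11⟩ := h
  exact ⟨a1, a2, a3, a4, a5, by rwa [h1], by rwa [h2], by rwa [h1], by rwa [h2], by rwa [h3, h4],
    by rwa [h5]⟩

theorem isWalk_of_nlink {n m : ℕ} {G : Graph (Fin n) (Fin m)} (p : List (Fin m × Fin n)) :
    ∀ (S : ℕ → ℕ) (u v : Fin n), (u : ℕ) = S 0 → (v : ℕ) = S p.length →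
      (∀ j (hj : j < p.length), NLink G p[j].1 (S j) (S (j + 1)) ∧ (p[j].2 : ℕ) = S (j + 1)) →
      IsWalk G u p v := by
  induction p with
  | nil => intro S u v hu hv _; exact Fin.ext (hu.trans hv.symm)
  | cons ew p ih =>
    intro S u v hu hv h
    obtain ⟨⟨he, hu', hw', hl⟩, h2⟩ := h 0 (by simp)
    refine ⟨?_, ih (fun j => S (j + 1)) _ v h2 (by simpa using hv) fun j hj => ?_⟩
    · simp only [List.getElem_cons_zero] at hl h2
      convert hl using 1
      · exact Fin.ext hu
      · exact Fin.ext h2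
    · have := h (j + 1) (by simpa using hj)
      simpa only [List.getElem_cons_succ] using this

theorem StackOK.inj {n m : ℕ} {G : Graph (Fin n) (Fin m)} {cap : ℕ} {C lab S E : ℕ → ℕ}
    {top : ℕ} (h : StackOK G cap C lab S E top) {i j : ℕ} (hi : i ≤ top) (hj : j ≤ top)
    (hij : S i = S j) : i = j := by
  have h1 := h.lab_add i hi
  have h2 := h.lab_add j hj
  rw [hij] at h1
  omega

theorem StackOK.inj_edge {n m : ℕ} {G : Graph (Fin n) (Fin m)} {cap : ℕ} {C lab S E : ℕ → ℕ}
    {top : ℕ} (h : StackOK G cap C lab S E top) {i j : ℕ} (hi : i < top) (hj : j < top)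
    (hij : E (i + 1) = E (j + 1)) : i = j := by
  have h1 := (h i hi).1
  have h2 := (h j hj).1
  rw [hij] at h1
  rcases h1.eq_or h2 with ⟨h3, -⟩ | ⟨h3, h4⟩
  · exact h.inj hi.le hj.le h3
  · have := h.inj hi.le (by omega) h3
    have := h.inj (by omega) hj.le h4
    omega

/-- The stack of a search describes a path, which uses no edge twice. -/
theorem StackOK.exists_path {n m : ℕ} {G : Graph (Fin n) (Fin m)} {cap : ℕ} {C lab S E : ℕ → ℕ}
    {top : ℕ} (h : StackOK G cap C lab S E top) {u v : Fin n} (hu : S 0 = u) (hv : S top = v) :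
    ∃ p : List (Fin m × Fin n), IsPath G u p v ∧ p.length = top ∧
      (∀ j (hj : j < p.length), (p[j].1 : ℕ) = E (j + 1) ∧ (p[j].2 : ℕ) = S (j + 1)) ∧
      ∀ e, C e ≤ cap → C e + (p.map fun ew => (ew.1 : ℕ)).count e ≤ cap := by
  obtain ⟨p, hp⟩ : ∃ p : List (Fin m × Fin n), p = List.ofFn fun j : Fin top =>
      (⟨E (j + 1), (h j j.2).1.choose⟩, ⟨S (j + 1), (h j j.2).1.symm.lt⟩) := ⟨_, rfl⟩
  have hlen : p.length = top := by rw [hp, List.length_ofFn]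
  have hget : ∀ j (hj : j < p.length), (p[j].1 : ℕ) = E (j + 1) ∧ (p[j].2 : ℕ) = S (j + 1) := by
    subst hp
    simp
  have hE : (p.map fun ew => (ew.1 : ℕ)) = (List.range top).map fun j => E (j + 1) := by
    apply List.ext_getElem (by simp [hlen])
    intro j hj hj'
    simpa using (hget j (by simpa using hj)).1
  refine ⟨p, ⟨isWalk_of_nlink p S u v hu.symm (by rw [hlen, hv]) fun j hj => ?_, ?_⟩, hlen, hget,
    fun e he => ?_⟩
  · rw [(hget j hj).1, (hget j hj).2]
    exact ⟨(h j (hlen ▸ hj)).1, rfl⟩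
  · apply List.Nodup.of_map Fin.val
    have : (u :: p.map Prod.snd).map Fin.val = (List.range (top + 1)).map S := by
      apply List.ext_getElem (by simp [hlen])
      intro j hj hj'
      rcases j with _ | j
      · simp [hu]
      · simpa using (hget j (by simpa using hj)).2
    rw [this]
    refine List.Nodup.map_on (fun i hi j hj hij => ?_) List.nodup_range
    rw [List.mem_range] at hi hj
    exact h.inj (by omega) (by omega) hij
  · rw [hE]
    by_cases hmem : e ∈ (List.range top).map fun j => E (j + 1)
    · have hnd : ((List.range top).map fun j => E (j + 1)).Nodup := by
        refine List.Nodup.map_on (fun i hi j hj hij => ?_) List.nodup_range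
        exact h.inj_edge (List.mem_range.1 hi) (List.mem_range.1 hj) hij
      have h1 := List.nodup_iff_count_le_one.1 hnd e
      obtain ⟨j, hj, rfl⟩ := List.mem_map.1 hmem
      have h2 := (h j (List.mem_range.1 hj)).2.1
      omega
    · rw [List.count_eq_zero_of_not_mem hmem]
      exact he

/-- The path found is appended to the output and to the list of routed pairs. -/
theorem runs_recordPath {n m k : ℕ} {G : Graph (Fin n) (Fin m)} {z ℓ : ℕ}
    {A B : Fin k → Finset (Fin n)} {L : List (Route n m k)} {s : Memory} {i : Fin k}
    (h : SearchInv G k z ℓ s) (hL : LogInv G A B L s) (hdone : s.reg rDone = 1)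
    (hI : s.reg rI = i) (htag : s.reg rTag = i + 1) (hsrc : s.arr aTagA (s.reg rSrc) = i + 1)
    (hcap : ∀ e < m, s.arr aCong e ≤ s.reg rCap) :
    Runs recordPath s fun t s' => t ≤ 15 * ℓ + 30 ∧ ∃ r : Route n m k, LogInv G A B (L ++ [r]) s' ∧
      r.path.length ≤ ℓ ∧ (∀ e < m, s'.arr aCong e = s.arr aCong e + r.count e) ∧
      (∀ e < m, s'.arr aCong e ≤ s.reg rCap) ∧
      s'.arr aTagA = Function.update (s.arr aTagA) (s.reg rSrc) 0 ∧
      s'.arr aTagB = Function.update (s.arr aTagB) (s.reg rV) 0 := by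
  have hv : s.reg rV < n := by
    rw [← h.top]; exact h.stack.lt (by rw [h.bottom]; exact h.src) _ le_rfl
  obtain ⟨hB, htop⟩ := h.one hdone
  obtain ⟨p, hp, hlen, hget, hcount⟩ := h.stack.exists_path (u := ⟨s.reg rSrc, h.src⟩)
    (v := ⟨s.reg rV, hv⟩) h.bottom h.top
  have hA' := (hL.tagA ⟨_, h.src⟩ i).1 hsrc
  have hB' := (hL.tagB ⟨_, hv⟩ i).1 (hB.trans htag)
  simp only [recordPath, emit, runs_block_cons, runs_block_nil, runs_store, runs_arith]
  refine (Runs.forLoop' (N := s.reg rTop) 13 (fun j s' =>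
    Printed 2 (L.flatMap Route.words ++ [(i : ℕ)] ++ [s.reg rSrc] ++ [s.reg rV] ++ [s.reg rTop] ++
      (p.take j).flatMap fun ew => [(ew.1 : ℕ), (ew.2 : ℕ)]) (s'.reg rOut) (s'.arr 1) ∧
    ∀ e, s'.arr aCong e = s.arr aCong e + ((p.take j).map fun ew => (ew.1 : ℕ)).count e)
    (by simp) rfl rfl ?_ ?_).mono ?_
  · have := (((hL.printed.snoc (i : ℕ)).snoc (s.reg rSrc)).snoc (s.reg rV)).snoc (s.reg rTop)
    simp [hI]
    simpa using this
  · rintro j s' hs hj hjt ⟨h1, h2⟩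
    have e1 := hs.arr aStackV rfl
    have e2 := hs.arr aStackE rfl
    simp at e1 e2
    rw [← hlen] at hjt
    obtain ⟨g1, g2⟩ := hget j hjt
    simp [hj, e1, e2, ← g1, ← g2]
    refine ⟨?_, fun e => ?_⟩
    · have := (h1.snoc p[j].1).snoc p[j].2
      rw [List.take_succ_eq_append_getElem hjt, List.flatMap_append]
      simpa using this
    · have : (p.take (j + 1)).map (fun ew => (ew.1 : ℕ)) =
          (p.take j).map (fun ew => (ew.1 : ℕ)) ++ [(p[j].1 : ℕ)] := by
        rw [List.take_succ_eq_append_getElem hjt, List.map_append, List.map_singleton]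
      rw [← List.map_take, this, Function.update_apply, h2, h2, List.count_append,
        List.count_singleton]
      split_ifs <;> simp_all [Nat.add_assoc]
  · rintro t s' hs ⟨⟨h1, h2⟩, ht⟩
    have e1 := hs.arr aTagA rfl
    have e2 := hs.arr aTagB rfl
    have e3 := hs.reg rSrc rfl
    have e4 := hs.reg rV rfl
    have e5 := hs.reg rCnt rfl
    simp at e1 e2 e3 e4 e5
    rw [← hlen, List.take_length] at h1 h2
    refine ⟨by omega, ⟨i, ⟨_, h.src⟩, ⟨_, hv⟩, p⟩, ⟨?_, ?_, ?_, ?_, ?_, ?_, ?_, ?_, ?_, ?_, ?_⟩,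
      ?_, ?_, ?_, ?_, ?_⟩
    · simp only [List.mem_append, List.mem_singleton]
      rintro r (hr | rfl)
      exacts [hL.path r hr, hp]
    · simp only [List.mem_append, List.mem_singleton]
      rintro r (hr | rfl)
      exacts [hL.memA r hr, hA'.1]
    · simp only [List.mem_append, List.mem_singleton]
      rintro r (hr | rfl)
      exacts [hL.memB r hr, hB'.1]
    · rw [List.map_append, List.map_singleton, ← List.concat_eq_append]
      exact hL.nodupA.concat hA'.2
    · rw [List.map_append, List.map_singleton, ← List.concat_eq_append]
      exact hL.nodupB.concat hB'.2
    · intro v j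
      have := hL.tagA v j
      simp [e1, e3, Function.update_apply, Fin.ext_iff] at this ⊢
      by_cases hvs : (v : ℕ) = s.reg rSrc
      · simp [hvs]
      · simp [hvs, this]
    · intro v j
      have := hL.tagB v j
      simp [e2, e4, Function.update_apply, Fin.ext_iff] at this ⊢
      by_cases hvs : (v : ℕ) = s.reg rV
      · simp [hvs]
      · simp [hvs, this]
    · intro v
      have := hL.tagA_le v
      simp [e1, e3, Function.update_apply]
      split_ifs <;> omega
    · intro v
      have := hL.tagB_le v
      simp [e2, e4, Function.update_apply]
      split_ifs <;> omega
    · simp [Route.words, hlen]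
      simpa [hlen] using h1
    · simp [e5, hL.cnt]
    · exact hlen.trans_le htop
    · intro e _
      simpa [Route.count] using h2 e
    · intro e he
      have := hcount e (hcap e he)
      simp
      rw [h2 e]
      exact this
    · simp [e1, e3]
    · simp [e2, e4]

/-- The vertices tagged `tag` in `tagA` have distance more than `ℓ` from those tagged `tag` in
`tagB` in the graph of the edges of usage less than `cap`; this is witnessed by labels. -/
def Separated {n m : ℕ} (G : Graph (Fin n) (Fin m)) (ℓ cap tag : ℕ) (C tagA tagB : ℕ → ℕ) : Prop :=
  ∃ lab, LabelsOK G cap tag C lab tagB ∧ ∀ v < n, tagA v = tag → ℓ < lab v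

theorem LabelsOK.mono {n m : ℕ} {G : Graph (Fin n) (Fin m)} {cap tag : ℕ}
    {C C' lab tagB tagB' : ℕ → ℕ} (h : LabelsOK G cap tag C lab tagB)
    (hC : ∀ e < m, C e ≤ C' e) (hB : ∀ v < n, tagB' v = tag → tagB v = tag) :
    LabelsOK G cap tag C' lab tagB' :=
  ⟨fun e u w hl he => h.le_succ e u w hl ((hC e hl.choose).trans_lt he),
    fun v hv ht => h.target v hv (hB v hv ht)⟩

theorem Separated.mono {n m : ℕ} {G : Graph (Fin n) (Fin m)} {ℓ cap tag : ℕ}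
    {C C' tagA tagA' tagB tagB' : ℕ → ℕ} (h : Separated G ℓ cap tag C tagA tagB)
    (hC : ∀ e < m, C e ≤ C' e) (hA : ∀ v < n, tagA' v = tag → tagA v = tag)
    (hB : ∀ v < n, tagB' v = tag → tagB v = tag) : Separated G ℓ cap tag C' tagA' tagB' := by
  obtain ⟨lab, h1, h2⟩ := h
  exact ⟨lab, h1.mono hC hB, fun v hv ht => h2 v hv (hA v hv ht)⟩

theorem eq_of_update_zero {f : ℕ → ℕ} {a v t : ℕ} (h : Function.update f a 0 v = t + 1) :
    f v = t + 1 := by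
  rw [Function.update_apply] at h
  split_ifs at h
  exact h

/-- What holds during a phase that started when the pairs in `L₀` had been routed. -/
structure PhaseInv {n m k : ℕ} (G : Graph (Fin n) (Fin m)) (A B : Fin k → Finset (Fin n)) (ℓ : ℕ)
    (L₀ L : List (Route n m k)) (s : Memory) : Prop where
  log : LogInv G A B (L₀ ++ L) s
  length_le : ∀ r ∈ L, r.path.length ≤ ℓ
  usage_eq : ∀ e < m, s.arr aCong e = usage L e
  usage_le : ∀ e < m, s.arr aCong e ≤ s.reg rCap

/-- The time that `routeIndex` needs for each vertex, up to changes of labels. -/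
def sourceTime (Δ ℓ : ℕ) : ℕ := (16 * Δ + 25) * (ℓ + 1) + (15 * ℓ + 60)

theorem usage_append {n m k : ℕ} (L L' : List (Route n m k)) (e : ℕ) :
    usage (L ++ L') e = usage L e + usage L' e := by
  simp [usage]

theorem labelSlack_le {n ℓ : ℕ} (lab : ℕ → ℕ) : labelSlack n ℓ lab ≤ n * (ℓ + 1) := by
  unfold labelSlack
  refine (Finset.sum_le_card_nsmul _ _ (ℓ + 1) fun v _ => by omega).trans ?_
  simp

/-- One round of the loop of `routeIndex`. The label slack pays for changes of labels. -/
theorem runs_source {n m k : ℕ} {G : Graph (Fin n) (Fin m)} {z ℓ : ℕ}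
    {A B : Fin k → Finset (Fin n)} {L₀ L : List (Route n m k)} {s : Memory} {i : Fin k}
    (henv : Env G k z ℓ s) (h : PhaseInv G A B ℓ L₀ L s)
    (hI : s.reg rI = i) (htag : s.reg rTag = i + 1) (hsrc : s.reg rSrc < n)
    (hlab : LabelsOK G (s.reg rCap) (i + 1) (s.arr aCong) (s.arr aLab) (s.arr aTagB)) :
    Runs (block [
    .load rT aTagA (.reg rSrc),
    .cond (.eq (.reg rT) (.reg rTag))
      (block [search, .cond (.eq (.reg rDone) (.const 1)) recordPath .skip]) .skip]) s fun t s' =>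
      (∃ L', PhaseInv G A B ℓ L₀ L' s') ∧
      LabelsOK G (s.reg rCap) (i + 1) (s'.arr aCong) (s'.arr aLab) (s'.arr aTagB) ∧
      (∀ v, s.arr aLab v ≤ s'.arr aLab v) ∧
      (∀ e < m, s.arr aCong e ≤ s'.arr aCong e) ∧
      (∀ v t, s'.arr aTagA v = t + 1 → s.arr aTagA v = t + 1) ∧
      (∀ v t, s'.arr aTagB v = t + 1 → s.arr aTagB v = t + 1) ∧
      (s'.arr aTagA (s.reg rSrc) = i + 1 → ℓ < s'.arr aLab (s.reg rSrc)) ∧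
      t + (16 * maxDegree G + 25) * (2 * labelSlack n ℓ (s'.arr aLab)) + 2 ≤
        (16 * maxDegree G + 25) * (2 * labelSlack n ℓ (s.arr aLab)) + sourceTime (maxDegree G) ℓ := by
  unfold sourceTime
  simp only [runs_block_cons, runs_load, runs_cond, runs_skip, runs_block_nil]
  refine ⟨fun hb => ?_, fun hb => ?_⟩
  · simp at hb
    refine (runs_search (henv.setReg (by norm_num) _) (by simpa using hsrc)
      (by simpa [htag] using hlab)).mono ?_
    rintro t s₁ hs ⟨h1, h2, h3, h4⟩
    have e1 := hs.reg rSrc rfl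
    have e2 := hs.reg rTag rfl
    have e3 := hs.reg rCap rfl
    have e4 := hs.reg rI rfl
    have e5 := hs.reg rOut rfl
    have e6 := hs.reg rCnt rfl
    have f1 := hs.arr aTagA rfl
    have f2 := hs.arr aTagB rfl
    have f3 := hs.arr aCong rfl
    have f4 := hs.arr 1 rfl
    simp at e1 e2 e3 e4 e5 e6 f1 f2 f3 f4 h3 h4
    have hlog := h.log.of_eq f1 f2 f4 e5 e6
    have hlab₁ := h1.labels
    rw [e2, e3, htag] at hlab₁
    refine ⟨fun hb2 => ?_, fun hb2 => ?_⟩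
    · simp at hb2
      refine (runs_recordPath h1 hlog hb2 (by rw [e4, hI]) (by rw [e2, htag])
        (by rw [f1, e1, hb, htag]) (by rw [f3, e3]; exact h.usage_le)).mono ?_
      rintro t' s₂ hs₂ ⟨ht', r, g1, g2, g3, g4, g5, g6⟩
      have i1 := hs₂.arr aLab rfl
      have i2 := hs₂.reg rCap rfl
      rw [f1, e1] at g5
      rw [f2] at g6
      rw [f3] at g3
      have hC : ∀ e < m, s.arr aCong e ≤ s₂.arr aCong e := fun e he => by rw [g3 e he]; omega
      refine ⟨⟨L ++ [r], ⟨by rwa [← List.append_assoc], ?_, fun e he => ?_, ?_⟩⟩, ?_, ?_, hC, ?_, ?_,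
        ?_, ?_⟩
      · simp only [List.mem_append, List.mem_singleton]
        rintro r' (hr | rfl)
        exacts [h.length_le r' hr, g2]
      · rw [g3 e he, h.usage_eq e he, usage_append]
        simp [usage]
      · rwa [i2]
      · rw [i1]
        refine hlab₁.mono (by rwa [f3]) fun v hv hvt => ?_
        rw [g6] at hvt
        rw [f2]
        exact eq_of_update_zero hvt
      · rwa [i1]
      · intro v t hvt
        rw [g5] at hvt
        exact eq_of_update_zero hvt
      · intro v t hvt
        rw [g6] at hvt
        exact eq_of_update_zero hvt
      · rw [g5, Function.update_self]
        intro h0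
        omega
      · rw [i1]
        rw [Nat.mul_add] at h4
        omega
    · simp at hb2
      refine ⟨⟨L, ⟨hlog, h.length_le, by rw [f3]; exact h.usage_eq, by rw [f3, e3]; exact h.usage_le⟩⟩,
        hlab₁, h3, by rw [f3]; exact fun _ _ => le_rfl, by rw [f1]; exact fun _ _ h => h,
        by rw [f2]; exact fun _ _ h => h, fun _ => ?_, ?_⟩
      · rw [← e1]
        exact h1.two h2 hb2
      · rw [Nat.mul_add] at h4
        omega
  · simp at hb
    refine ⟨⟨L, ⟨h.log.of_eq rfl rfl rfl (by simp) (by simp), h.length_le, h.usage_eq,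
      by simpa using h.usage_le⟩⟩, hlab, fun _ => le_rfl, fun _ _ => le_rfl, fun _ _ h => h,
      fun _ _ h => h, fun h' => ?_, ?_⟩
    · rw [htag] at hb
      exact absurd h' hb
    · simp
      omega

/-- Afterwards the unmatched vertices of `A i` and `B i` are separated, as the last search from each
such vertex of `A i` has raised its label above `ℓ`. -/
theorem runs_routeIndex {n m k : ℕ} {G : Graph (Fin n) (Fin m)} {z ℓ : ℕ}
    {A B : Fin k → Finset (Fin n)} {L₀ L : List (Route n m k)} {s : Memory} {i : Fin k}
    (henv : Env G k z ℓ s) (h : PhaseInv G A B ℓ L₀ L s) (hI : s.reg rI = i)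
    (hsep : ∀ i' < (i : ℕ),
      Separated G ℓ (s.reg rCap) (i' + 1) (s.arr aCong) (s.arr aTagA) (s.arr aTagB)) :
    Runs routeIndex s fun t s' => (∃ L', PhaseInv G A B ℓ L₀ L' s') ∧
      (∀ i' < (i : ℕ) + 1,
        Separated G ℓ (s.reg rCap) (i' + 1) (s'.arr aCong) (s'.arr aTagA) (s'.arr aTagB)) ∧
      t ≤ 3 * n * sourceTime (maxDegree G) ℓ + 3 * n + 10 := by
  simp only [routeIndex, runs_block_cons, runs_arith]
  refine (Runs.forLoop' (N := n) 1 (fun j s' => ∀ v < j, s'.arr aLab v = 0)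
    (by simp [henv.regN]) rfl rfl (by simp) ?_).mono ?_
  · rintro j s' hs hj hjn h1
    simp [hj]
    intro v hv
    rw [Function.update_apply]
    split_ifs with hvj
    · rfl
    · exact h1 v (by omega)
  rintro t₁ s₁ hs₁ ⟨h1, ht₁⟩
  have e1 := hs₁.reg rCap rfl
  have e2 := hs₁.reg rI rfl
  have e3 := hs₁.reg rTag rfl
  have e4 := hs₁.reg rOut rfl
  have e5 := hs₁.reg rCnt rfl
  have f1 := hs₁.arr aTagA rfl
  have f2 := hs₁.arr aTagB rfl
  have f3 := hs₁.arr aCong rfl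
  have f4 := hs₁.arr 1 rfl
  have henv₁ := (henv.setReg (r := rTag) (by norm_num) _).of_sameOff hs₁ rfl
  simp [hI] at e1 e2 e3 e4 e5 f1 f2 f3 f4
  -- The bound for the time that is left consists of `sourceTime` for each source to come and of what
  -- the increases of labels that are still possible may cost.
  refine (Runs.forLoop (N := n) (φ := (16 * maxDegree G + 25) * (2 * labelSlack n ℓ (s₁.arr aLab)) +
    n * sourceTime (maxDegree G) ℓ) (fun a φ s' =>
    (∃ L', PhaseInv G A B ℓ L₀ L' s') ∧
    LabelsOK G (s.reg rCap) (i + 1) (s'.arr aCong) (s'.arr aLab) (s'.arr aTagB) ∧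
    (∀ v < a, s'.arr aTagA v = i + 1 → ℓ < s'.arr aLab v) ∧
    (∀ i' < (i : ℕ),
      Separated G ℓ (s.reg rCap) (i' + 1) (s'.arr aCong) (s'.arr aTagA) (s'.arr aTagB)) ∧
    φ = (16 * maxDegree G + 25) * (2 * labelSlack n ℓ (s'.arr aLab)) +
      (n - a) * sourceTime (maxDegree G) ℓ) (by simpa using henv₁.regN) rfl rfl ?_ ?_).mono ?_
  · refine ⟨⟨L, ⟨h.log.of_eq f1 f2 f4 (by simp [e4]) (by simp [e5]), h.length_le, ?_, ?_⟩⟩, ?_, ?_, ?_,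
      by simp⟩
    · simpa [f3] using h.usage_eq
    · simpa [f3, e1] using h.usage_le
    · refine ⟨fun e u w hl _ => ?_, fun v hv _ => ?_⟩
      · simp [h1 u hl.lt]
      · simp [h1 v hv]
    · simp
    · simpa [f1, f2, f3] using hsep
  · rintro a φ s₂ hs₂ ha han ⟨⟨L', g1⟩, g2, g3, g4, rfl⟩
    have i1 := hs₂.reg rCap rfl
    have i2 := hs₂.reg rI rfl
    have i3 := hs₂.reg rTag rfl
    have henv₂ := henv₁.of_sameOff hs₂ rfl
    rw [e1] at i1
    rw [← i1] at g2
    refine (runs_source henv₂ g1 (i2.trans e2) (i3.trans e3) (by rwa [ha]) g2).mono ?_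
    rintro t₃ s₃ hs₃ ⟨⟨L₃, k1⟩, k2, k3, k4, k5, k6, k7, k8⟩
    rw [ha] at k7
    rw [i1] at k2
    refine ⟨_, ⟨⟨L₃, k1.log.of_eq rfl rfl rfl (by simp) (by simp), k1.length_le, k1.usage_eq,
      by simpa using k1.usage_le⟩, k2, fun v hv hvt => ?_, fun i' hi' => ?_, rfl⟩, ?_⟩
    · rcases (Nat.lt_succ_iff.1 hv).lt_or_eq with hv | rfl
      · exact (g3 v hv (k5 v i hvt)).trans_le (k3 v)
      · exact k7 hvt
    · exact (g4 i' hi').mono k4 (fun v _ => k5 v i') (fun v _ => k6 v i')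
    · have : (n - a) * sourceTime (maxDegree G) ℓ =
          (n - (a + 1)) * sourceTime (maxDegree G) ℓ + sourceTime (maxDegree G) ℓ := by
        rw [← Nat.add_one_mul]
        congr 1
        omega
      simp only [Memory.arr_setReg]
      omega
  · rintro t₂ s₂ hs₂ ⟨φ, ⟨g1, g2, g3, g4, -⟩, ht₂⟩
    rw [runs_block_nil]
    refine ⟨g1, fun i' hi' => ?_, ?_⟩
    · rcases (Nat.lt_succ_iff.1 hi').lt_or_eq with hi' | rfl
      · exact g4 i' hi'
      · exact ⟨_, g2, g3⟩
    · have h5 := labelSlack_le (n := n) (ℓ := ℓ) (s₁.arr aLab)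
      have h6 : (16 * maxDegree G + 25) * (2 * labelSlack n ℓ (s₁.arr aLab)) ≤
          2 * (n * sourceTime (maxDegree G) ℓ) := by
        unfold sourceTime
        calc (16 * maxDegree G + 25) * (2 * labelSlack n ℓ (s₁.arr aLab))
            ≤ (16 * maxDegree G + 25) * (2 * (n * (ℓ + 1))) := by gcongr
          _ = 2 * (n * ((16 * maxDegree G + 25) * (ℓ + 1))) := by ring
          _ ≤ _ := by gcongr; omega
      have h7 : 3 * n * sourceTime (maxDegree G) ℓ = 3 * (n * sourceTime (maxDegree G) ℓ) := by ring
      omega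

/-! ### Phases -/

theorem card_filter_range {n : ℕ} (p : ℕ → Prop) [DecidablePred p] :
    ((Finset.range n).filter p).card =
      ((Finset.univ : Finset (Fin n)).filter fun v : Fin n => p v).card := by
  rw [← Finset.card_map Fin.valEmbedding]
  congr 1
  ext v
  simp only [Finset.mem_filter, Finset.mem_range, Finset.mem_map, Finset.mem_univ, true_and,
    Fin.valEmbedding_apply]
  exact ⟨fun ⟨h1, h2⟩ => ⟨⟨v, h1⟩, h2, rfl⟩, fun ⟨w, h1, h2⟩ => h2 ▸ ⟨w.2, h1⟩⟩

/-- The number of vertices with a tag. -/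
def countTagged (n : ℕ) (tag : ℕ → ℕ) : ℕ := ((Finset.range n).filter fun v => tag v ≠ 0).card

theorem LogInv.exists_tag {n m k : ℕ} {G : Graph (Fin n) (Fin m)} {A B : Fin k → Finset (Fin n)}
    {L : List (Route n m k)} {s : Memory} (h : LogInv G A B L s) {v : Fin n}
    (hv : s.arr aTagA v ≠ 0) : ∃ i : Fin k, s.arr aTagA v = i + 1 :=
  ⟨⟨s.arr aTagA v - 1, by have := h.tagA_le v; omega⟩, by simp only; omega⟩

/-- Each vertex of a set `A i` is either still unmatched or the first vertex of a routed pair. -/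
theorem LogInv.card {n m k : ℕ} {G : Graph (Fin n) (Fin m)} {A B : Fin k → Finset (Fin n)}
    {L : List (Route n m k)} {s : Memory} (h : LogInv G A B L s)
    (hA : ∀ i j, i ≠ j → Disjoint (A i) (A j)) :
    countTagged n (s.arr aTagA) + L.length = ∑ i, (A i).card := by
  rw [← Finset.card_biUnion (fun i _ j _ hij => hA i j hij), countTagged, card_filter_range,
    ← List.length_map Route.src, ← List.toFinset_card_of_nodup h.nodupA,
    ← Finset.card_union_of_disjoint]
  · congr 1
    ext v
    simp only [Finset.mem_union, Finset.mem_filter, Finset.mem_univ, true_and, List.mem_toFinset,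
      Finset.mem_biUnion]
    constructor
    · rintro (hv | hv)
      · obtain ⟨i, hi⟩ := h.exists_tag hv
        exact ⟨i, ((h.tagA v i).1 hi).1⟩
      · obtain ⟨r, hr, rfl⟩ := List.mem_map.1 hv
        exact ⟨_, h.memA r hr⟩
    · rintro ⟨i, hi⟩
      by_cases hv : v ∈ L.map Route.src
      · exact Or.inr hv
      · refine Or.inl ?_
        rw [(h.tagA v i).2 ⟨hi, hv⟩]
        omega
  · rw [Finset.disjoint_left]
    intro v hv hv'
    obtain ⟨i, hi⟩ := h.exists_tag (Finset.mem_filter.1 hv).2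
    exact ((h.tagA v i).1 hi).2 (List.mem_toFinset.1 hv')

theorem runs_check {n : ℕ} {s : Memory} (hn : s.reg rN = n) :
    Runs check s fun t s' => t ≤ 6 * n + 20 ∧ s'.reg rLeft = countTagged n (s.arr aTagA) ∧
      (s'.reg rStop = 0 ↔ s.reg rZ < countTagged n (s.arr aTagA) ∧
        2 * countTagged n (s.arr aTagA) < s.reg rOld) := by
  simp only [check, runs_block_cons, runs_arith]
  refine (Runs.forLoop' (N := n) 4 (fun j s' =>
    s'.reg rLeft = ((Finset.range j).filter fun v => s.arr aTagA v ≠ 0).card)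
    (by simpa using hn) rfl rfl (by simp) ?_).mono ?_
  · rintro j s' hs hj hjn h1
    have e1 := hs.arr aTagA rfl
    simp only [Memory.arr_setReg] at e1
    rw [Finset.range_add_one, Finset.filter_insert]
    simp [hj, e1, h1]
    by_cases h0 : s.arr aTagA j = 0
    · simp [h0]
    · simp [h0]
  · rintro t s' hs ⟨h1, ht⟩
    have e1 := hs.reg rZ rfl
    have e2 := hs.reg rOld rfl
    simp at e1 e2
    rw [← countTagged] at h1
    simp [h1, e1, e2]
    refine ⟨fun hz => ⟨fun h2 => ⟨by omega, by omega⟩, fun h2 => ⟨by omega, ?_⟩⟩,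
      fun hz => ⟨by omega, ?_⟩⟩
    · intro; omega
    · intro; omega

/-- What separates the vertices of an index remains in force while later indices are dealt with. -/
theorem runs_phase {n m k : ℕ} {G : Graph (Fin n) (Fin m)} {z ℓ : ℕ}
    {A B : Fin k → Finset (Fin n)} {L₀ : List (Route n m k)} {s : Memory}
    (henv : Env G k z ℓ s) (h : LogInv G A B L₀ s) :
    Runs phase s fun t s' => (∃ L, PhaseInv G A B ℓ L₀ L s') ∧
      (∀ i < k,
        Separated G ℓ (s.reg rCap) (i + 1) (s'.arr aCong) (s'.arr aTagA) (s'.arr aTagB)) ∧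
      s'.reg rOld = s.reg rLeft ∧
      t ≤ 3 * m + k * (3 * n * sourceTime (maxDegree G) ℓ + 3 * n + 12) + 10 := by
  simp only [phase, runs_block_cons]
  refine (Runs.forLoop' (N := m) 1 (fun j s' => ∀ e < j, s'.arr aCong e = 0)
    (by simp [henv.regM]) rfl rfl (by simp) ?_).mono ?_
  · rintro j s' hs hj hjn h1
    simp [hj]
    intro v hv
    rw [Function.update_apply]
    split_ifs with hvj
    · rfl
    · exact h1 v (by omega)
  rintro t₁ s₁ hs₁ ⟨h1, ht₁⟩
  have e1 := hs₁.reg rCap rfl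
  have e2 := hs₁.reg rLeft rfl
  have henv₁ := (henv.of_sameOff hs₁ rfl).setReg (r := rOld) (by norm_num) (s.reg rLeft)
  have hlog := h.of_eq (hs₁.arr aTagA rfl) (hs₁.arr aTagB rfl) (hs₁.arr 1 rfl) (hs₁.reg rOut rfl)
    (hs₁.reg rCnt rfl)
  simp only [runs_arith, Operand.eval_reg, Operand.eval_const, ArithOp.eval_plus, e2, add_zero]
  refine (Runs.forLoop' (N := k) (3 * n * sourceTime (maxDegree G) ℓ + 3 * n + 10) (fun i s' =>
    (∃ L, PhaseInv G A B ℓ L₀ L s') ∧ ∀ i' < i,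
      Separated G ℓ (s.reg rCap) (i' + 1) (s'.arr aCong) (s'.arr aTagA) (s'.arr aTagB))
    (by simpa using henv₁.regK) rfl rfl ?_ ?_).mono ?_
  · refine ⟨⟨[], ⟨?_, by simp, ?_, ?_⟩⟩, by simp⟩
    · rw [List.append_nil]
      exact hlog.of_eq rfl rfl rfl (by simp) (by simp)
    · simpa [usage] using h1
    · intro e he
      simp [h1 e he]
  · rintro i s₂ hs₂ hi hik ⟨⟨L, g1⟩, g2⟩
    have i1 := hs₂.reg rCap rfl
    simp [e1] at i1
    rw [← i1] at g2 ⊢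
    refine (runs_routeIndex (i := ⟨i, hik⟩) (henv₁.of_sameOff hs₂ rfl) g1 hi g2).mono ?_
    rintro t₃ s₃ hs₃ ⟨⟨L₃, k1⟩, k2, k3⟩
    exact ⟨⟨⟨L₃, k1.log.of_eq rfl rfl rfl (by simp) (by simp), k1.length_le, k1.usage_eq,
      by simpa using k1.usage_le⟩, k2⟩, k3⟩
  · rintro t₂ s₂ hs₂ ⟨⟨g1, g2⟩, ht₂⟩
    have i1 := hs₂.reg rOld rfl
    simp at i1
    rw [runs_block_nil]
    refine ⟨g1, g2, i1, ?_⟩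
    rw [show 3 * n * sourceTime (maxDegree G) ℓ + 3 * n + 10 + 2 =
      3 * n * sourceTime (maxDegree G) ℓ + 3 * n + 12 from rfl, Nat.mul_comm _ k] at ht₂
    omega

/-- The situation in which a sparse cut exists: the unmatched vertices of `A i` and `B i` are far
apart in the graph without the edges that have been used too often, and there are few of those. -/
structure Stuck {n m : ℕ} (G : Graph (Fin n) (Fin m)) (k ℓ : ℕ) (s : Memory) : Prop where
  sep : ∀ i < k, Separated G ℓ (s.reg rCap) (i + 1) (s.arr aCong) (s.arr aTagA) (s.arr aTagB)
  blocked : s.reg rCap * ((Finset.range m).filter fun e => s.reg rCap ≤ s.arr aCong e).card ≤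
    ℓ * s.reg rLeft

theorem sum_usage {n m k : ℕ} (L : List (Route n m k)) :
    ∑ e ∈ Finset.range m, usage L e = (L.map fun r => r.path.length).sum := by
  induction L with
  | nil => simp [usage]
  | cons r L ih =>
    have : ∀ e, usage (r :: L) e = r.count e + usage L e := fun e => by simp [usage]
    simp only [this, Finset.sum_add_distrib, ih, List.map_cons, List.sum_cons]
    congr 1
    have := Multiset.sum_count_eq_card (s := Finset.range m)
      (m := (r.path.map fun ew => (ew.1 : ℕ) : Multiset ℕ)) (by
        intro e he
        simp only [Multiset.mem_coe, List.mem_map] at he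
        obtain ⟨ew, -, rfl⟩ := he
        exact Finset.mem_range.2 ew.1.2)
    simpa [Route.count] using this

/-- The edges of usage `cap` are few, since the routed paths are short. -/
theorem PhaseInv.blocked {n m k : ℕ} {G : Graph (Fin n) (Fin m)} {A B : Fin k → Finset (Fin n)}
    {ℓ : ℕ} {L₀ L : List (Route n m k)} {s : Memory} (h : PhaseInv G A B ℓ L₀ L s) :
    s.reg rCap * ((Finset.range m).filter fun e => s.reg rCap ≤ s.arr aCong e).card ≤
      ℓ * L.length := by
  calc s.reg rCap * ((Finset.range m).filter fun e => s.reg rCap ≤ s.arr aCong e).card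
      = ∑ e ∈ (Finset.range m).filter fun e => s.reg rCap ≤ s.arr aCong e, s.reg rCap := by
        rw [Finset.sum_const, smul_eq_mul, mul_comm]
    _ ≤ ∑ e ∈ (Finset.range m).filter fun e => s.reg rCap ≤ s.arr aCong e, usage L e := by
        refine Finset.sum_le_sum fun e he => ?_
        rw [Finset.mem_filter, Finset.mem_range] at he
        rw [← h.usage_eq e he.1]
        exact he.2
    _ ≤ ∑ e ∈ Finset.range m, usage L e :=
        Finset.sum_le_sum_of_subset (Finset.filter_subset _ _)
    _ = (L.map fun r => r.path.length).sum := sum_usage L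
    _ ≤ (L.map fun r => r.path.length).length * ℓ := by
        refine List.sum_le_card_nsmul _ _ fun x hx => ?_
        obtain ⟨r, hr, rfl⟩ := List.mem_map.1 hx
        exact h.length_le r hr
    _ = ℓ * L.length := by rw [List.length_map, mul_comm]

/-- The time for a phase and the check that follows it. -/
def phaseTime (n m k Δ ℓ : ℕ) : ℕ :=
  3 * m + k * (3 * n * sourceTime Δ ℓ + 3 * n + 12) + 6 * n + 40

/-- Phases end after at most `log n` rounds, since the number of unmatched sources is halved in all
but the last one. In each phase every edge is used at most `ℓ ^ 2 / log n` times. -/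
theorem runs_routing {n m k : ℕ} {G : Graph (Fin n) (Fin m)} {z ℓ : ℕ}
    {A B : Fin k → Finset (Fin n)} {s : Memory}
    (hA : ∀ i j, i ≠ j → Disjoint (A i) (A j)) (hcard : 2 * ∑ i, (A i).card ≤ n)
    (henv : Env G k z ℓ s)
    (htagA : ∀ (v : Fin n), (∀ i : Fin k, s.arr aTagA v = i + 1 ↔ v ∈ A i) ∧ s.arr aTagA v ≤ k)
    (htagB : ∀ (v : Fin n), (∀ i : Fin k, s.arr aTagB v = i + 1 ↔ v ∈ B i) ∧ s.arr aTagB v ≤ k) :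
    Runs routing s fun t s' => (∃ L : List (Route n m k), LogInv G A B L s' ∧
        ∀ e < m, usage L e ≤ ℓ * ℓ) ∧
      s'.reg rLeft = countTagged n (s'.arr aTagA) ∧ (z < s'.reg rLeft → Stuck G k ℓ s') ∧
      t ≤ phaseTime n m k (maxDegree G) ℓ * (Nat.log 2 n + 2) := by
  simp only [routing, runs_block_cons, runs_arith]
  have henv₀ := ((henv.setReg (r := rOut) (by norm_num) 2).setReg (r := rCnt) (by norm_num) 0).setReg
    (r := rOld) (by norm_num) (n + 1)
  have hlog₀ : LogInv G A B ([] : List (Route n m k))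
      (((s.setReg rOut 2).setReg rCnt 0).setReg rOld (n + 1)) := by
    constructor <;> simp [Printed]
    · exact fun v i => (htagA v).1 i
    · exact fun v i => (htagB v).1 i
    · exact fun v => (htagA v).2
    · exact fun v => (htagB v).2
  have hc₀ := hlog₀.card hA
  simp at hc₀
  simp [henv.regN]
  refine (runs_check henv₀.regN).mono ?_
  rintro t₁ s₁ hs₁ ⟨ht₁, h1, h2⟩
  have henv₁ := henv₀.of_sameOff hs₁ rfl
  have hlog₁ := hlog₀.of_eq (hs₁.arr aTagA rfl) (hs₁.arr aTagB rfl) (hs₁.arr 1 rfl)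
    (hs₁.reg rOut rfl) (hs₁.reg rCnt rfl)
  have f1 := hs₁.arr aTagA rfl
  simp [hc₀, henv.regZ] at h1 h2 f1
  -- After `p` phases each edge lies on at most `p * cap` paths, and `2 ^ (p + 1)` times the number of
  -- unmatched sources is at most `n` unless this was the last phase.
  refine (Runs.loop (φ := phaseTime n m k (maxDegree G) ℓ *
    if s₁.reg rStop = 0 then Nat.log 2 (s₁.reg rLeft) + 1 else 0) (fun φ s' =>
    (∃ (L : List (Route n m k)) (p : ℕ), LogInv G A B L s' ∧ p ≤ Nat.log 2 n ∧
      (∀ e < m, usage L e ≤ p * s.reg rCap) ∧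
      (s'.reg rStop = 0 → z < s'.reg rLeft ∧ 2 ^ (p + 1) * s'.reg rLeft ≤ n)) ∧
    s'.reg rLeft = countTagged n (s'.arr aTagA) ∧
    (s'.reg rStop ≠ 0 → z < s'.reg rLeft → Stuck G k ℓ s') ∧
    φ = phaseTime n m k (maxDegree G) ℓ *
      if s'.reg rStop = 0 then Nat.log 2 (s'.reg rLeft) + 1 else 0) ?_ ?_).mono ?_
  · refine ⟨⟨[], 0, hlog₁, by simp, by simp [usage], fun h => ?_⟩, by rw [h1, f1, hc₀], fun h h' => ?_,
      rfl⟩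
    · rw [h1]
      exact ⟨(h2.1 h).1, by omega⟩
    · rw [h1] at h'
      exact absurd (h2.2 ⟨h', by omega⟩) h
  · rintro φ s₂ hs₂ ⟨⟨L, p, g1, g2, g3, g4⟩, g5, g6, rfl⟩ hb
    simp only [Test.holds_eq, Operand.eval_reg, Operand.eval_const] at hb
    obtain ⟨g7, g8⟩ := g4 hb
    have henv₂ := henv₁.of_sameOff hs₂ rfl
    have hcap₂ : s₂.reg rCap = s.reg rCap := by rw [henv₂.cap, henv.cap]
    simp only [runs_block_cons, runs_block_nil]
    refine (runs_phase henv₂ g1).mono ?_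
    rintro t₃ s₃ hs₃ ⟨⟨L', k1⟩, k2, k3, k4⟩
    have henv₃ := henv₂.of_sameOff hs₃ rfl
    have hcap₃ : s₃.reg rCap = s.reg rCap := by rw [henv₃.cap, henv.cap]
    have hc₂ := g1.card hA
    have hc₃ := k1.log.card hA
    rw [← g5] at hc₂
    refine (runs_check henv₃.regN).mono ?_
    rintro t₄ s₄ hs₄ ⟨ht₄, l1, l2⟩
    have i1 := hs₄.arr aTagA rfl
    have i2 := hs₄.arr aTagB rfl
    have i3 := hs₄.arr aCong rfl
    have i4 := hs₄.reg rCap rfl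
    rw [henv₃.regZ, k3, ← l1] at l2
    rw [← l1, List.length_append] at hc₃
    have hp : p + 1 ≤ Nat.log 2 n := by
      refine Nat.le_log_of_pow_le (by norm_num) (le_trans ?_ g8)
      exact Nat.le_mul_of_pos_right _ (by omega)
    refine ⟨_, ⟨⟨L ++ L', p + 1, k1.log.of_eq i1 i2 (hs₄.arr 1 rfl) (hs₄.reg rOut rfl)
      (hs₄.reg rCnt rfl), hp, fun e he => ?_, fun h => ?_⟩, by rw [l1, i1], fun h h' => ?_, rfl⟩, ?_⟩
    · have := k1.usage_le e he
      rw [k1.usage_eq e he, hcap₃] at this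
      rw [usage_append, Nat.add_mul, one_mul]
      exact Nat.add_le_add (g3 e he) this
    · obtain ⟨l3, l4⟩ := l2.1 h
      refine ⟨l3, le_trans ?_ g8⟩
      rw [pow_succ, mul_assoc]
      exact Nat.mul_le_mul_left _ l4.le
    · refine ⟨?_, ?_⟩
      · rw [i1, i2, i3, i4, hcap₃, ← hcap₂]
        exact k2
      · rw [i3, i4]
        refine k1.blocked.trans (Nat.mul_le_mul_left _ ?_)
        have : ¬ 2 * s₄.reg rLeft < s₂.reg rLeft := fun h3 => h (l2.2 ⟨h', h3⟩)
        omega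
    · rw [if_pos hb]
      have hX : t₃ + t₄ + 2 ≤ phaseTime n m k (maxDegree G) ℓ := by
        unfold phaseTime
        omega
      have hY : (if s₄.reg rStop = 0 then Nat.log 2 (s₄.reg rLeft) + 1 else 0) ≤
          Nat.log 2 (s₂.reg rLeft) := by
        split_ifs with h
        · obtain ⟨l3, l4⟩ := l2.1 h
          rw [← Nat.log_mul_base (by norm_num) (by omega)]
          exact Nat.log_mono_right (by omega)
        · omega
      have := Nat.mul_le_mul_left (phaseTime n m k (maxDegree G) ℓ) hY
      rw [Nat.mul_add _ (Nat.log 2 _) 1]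
      omega
  · rintro t₂ s₂ hs₂ ⟨φ, ⟨⟨L, p, g1, g2, g3, g4⟩, g5, g6, -⟩, hb, ht₂⟩
    simp only [Test.holds_eq, Operand.eval_reg, Operand.eval_const] at hb
    refine ⟨⟨L, g1, fun e he => (g3 e he).trans ?_⟩, g5, g6 hb, ?_⟩
    · rw [henv.cap]
      exact (Nat.mul_le_mul_right _ g2).trans (Nat.mul_div_le _ _)
    · have hY : (if s₁.reg rStop = 0 then Nat.log 2 (s₁.reg rLeft) + 1 else 0) ≤
          Nat.log 2 n + 1 := by
        split_ifs with h
        · have : s₁.reg rLeft ≤ n := by omega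
          have := Nat.log_mono_right (b := 2) this
          omega
        · omega
      have := Nat.mul_le_mul_left (phaseTime n m k (maxDegree G) ℓ) hY
      have hX : 6 * n + 40 ≤ phaseTime n m k (maxDegree G) ℓ := by
        unfold phaseTime
        omega
      rw [show Nat.log 2 n + 2 = Nat.log 2 n + 1 + 1 from rfl, Nat.mul_add _ (Nat.log 2 n + 1) 1]
      omega

/-! ### Growing balls -/

theorem countTagged_update {n : ℕ} {f : ℕ → ℕ} {w r : ℕ} (hw : w < n) (hf : f w = 0) (hr : r ≠ 0) :
    countTagged n (Function.update f w r) = countTagged n f + 1 := by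
  rw [countTagged, countTagged, ← Finset.card_insert_of_notMem (a := w) (by simp [hf])]
  congr 1
  ext v
  simp only [Finset.mem_filter, Finset.mem_range, Finset.mem_insert, Function.update_apply]
  by_cases h : v = w
  · simp [h, hw, hr]
  · simp [h]

theorem countTagged_le (n : ℕ) (f : ℕ → ℕ) : countTagged n f ≤ n :=
  (Finset.card_filter_le _ _).trans_eq (Finset.card_range n)

theorem runs_touch {x y : ℕ} (hy : y ≠ rT) (s : Memory) :
    Runs (touch x y) s fun t s' => t ≤ 14 ∧
      ((0 < s.arr aBall (s.reg x) ∧ s.arr aBall (s.reg x) < s.reg rRadNew ∧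
          s.arr aCut (s.reg y) = 0 ∧ s.arr aBall (s.reg y) = 0) ∧
        s'.arr aBall = Function.update (s.arr aBall) (s.reg y) (s.reg rRadNew) ∧
        s'.reg rNew = s.reg rNew + 1 ∧ s'.reg rSizeNew = s.reg rSizeNew + 1 ∨
      (0 < s.arr aBall (s.reg x) → s.arr aBall (s.reg x) < s.reg rRadNew →
          s.arr aCut (s.reg y) = 0 → s.arr aBall (s.reg y) ≠ 0) ∧
        s'.arr aBall = s.arr aBall ∧ s'.reg rNew = s.reg rNew ∧
        s'.reg rSizeNew = s.reg rSizeNew) := by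
  simp only [touch]
  by_cases h1 : 0 < s.arr aBall (s.reg x) <;>
  by_cases h2 : s.arr aBall (s.reg x) < s.reg rRadNew <;>
  by_cases h3 : s.arr aCut (s.reg y) = 0 <;>
  by_cases h4 : s.arr aBall (s.reg y) = 0 <;>
  simp [h1, h2, h3, h4, hy]
  simp_all [Nat.pos_iff_ne_zero]

/-- A ball of radius `R - 1` in the graph of the edges of usage less than `cap`, grown outside the
set `cut`: `b v` is one more than the distance of `v` from the center, and `0` outside the ball. The
vertices at distance `b v - 1` satisfy `P (b v) v`. -/
structure BallInv {n m : ℕ} (G : Graph (Fin n) (Fin m)) (cap : ℕ) (C cut : ℕ → ℕ)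
    (P : ℕ → ℕ → Prop) (b : ℕ → ℕ) (R : ℕ) : Prop where
  le : ∀ v < n, b v ≤ R
  mem : ∀ v < n, b v ≠ 0 → cut v = 0 ∧ P (b v) v
  closed : ∀ e u w, NLink G e u w → C e < cap → b u ≠ 0 → b u < R → cut w = 0 → b w ≠ 0

/-- A round adds all vertices outside `cut` that are adjacent to the ball. The `new` vertices either
enlarge the ball by more than the fraction `1 / q` or form its boundary. -/
theorem runs_growRound {n m : ℕ} {G : Graph (Fin n) (Fin m)} {k z ℓ : ℕ} {s : Memory}
    {P : ℕ → ℕ → Prop} (henv : Env G k z ℓ s)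
    (hP : ∀ t t' e u w, NLink G e u w → s.arr aCong e < s.reg rCap → t < t' → P t u → P t' w)
    (hB : BallInv G (s.reg rCap) (s.arr aCong) (s.arr aCut) P (s.arr aBall) (s.reg rRad))
    (hsize : s.reg rSize = countTagged n (s.arr aBall)) (hsn : s.reg rSizeNew = s.reg rSize) :
    Runs growRound s fun t s' => t ≤ 36 * m + 15 ∧
      BallInv G (s.reg rCap) (s.arr aCong) (s.arr aCut) P (s'.arr aBall) (s.reg rRad + 1) ∧
      (∀ v < n, s'.arr aBall v = s.arr aBall v ∨
        s.arr aBall v = 0 ∧ s'.arr aBall v = s.reg rRad + 1) ∧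
      s'.reg rRadNew = s.reg rRad + 1 ∧
      ∃ new, countTagged n (s'.arr aBall) = s.reg rSize + new ∧
        (s.reg rSize < s.reg rQ * new ∧ s'.reg rSize = s.reg rSize + new ∧
            s'.reg rSizeNew = s.reg rSize + new ∧ s'.reg rRad = s.reg rRad + 1 ∧
            s'.reg rGo = s.reg rGo ∨
          s.reg rQ * new ≤ s.reg rSize ∧ s'.reg rSize = s.reg rSize ∧
            s'.reg rGo = 1) := by
  simp only [growRound, runs_block_cons, runs_arith]
  refine (Runs.forLoop' (N := m) 34 (fun j s' =>
    (∀ v < n, s'.arr aBall v = s.arr aBall v ∨ s.arr aBall v = 0 ∧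
      s'.arr aBall v = s.reg rRad + 1 ∧ s.arr aCut v = 0 ∧ P (s.reg rRad + 1) v) ∧
    (∀ e u w, NLink G e u w → e < j → s.arr aCong e < s.reg rCap → s.arr aBall u ≠ 0 →
      s.arr aCut w = 0 → s'.arr aBall w ≠ 0) ∧
    s'.reg rSizeNew = countTagged n (s'.arr aBall) ∧
    s'.reg rSizeNew = s.reg rSize + s'.reg rNew) (by simpa using henv.regM) rfl rfl ?_ ?_).mono ?_
  · simp [hsn, hsize]
  · rintro j s₁ hs₁ hj hjm ⟨h1, h2, h3, h4⟩
    have hends := henv.ends j hjm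
    have e1 := hs₁.arr aEndL rfl
    have e2 := hs₁.arr aEndR rfl
    have e3 := hs₁.arr aCong rfl
    have e4 := hs₁.reg rCap rfl
    have e5 := hs₁.reg rRadNew rfl
    have e6 := hs₁.arr aCut rfl
    simp at e1 e2 e3 e4 e5 e6
    -- The effect of `touch` on the marks `b` and on the counters `S = rSizeNew` and `N = rNew`.
    have hstep : ∀ (b b' : ℕ → ℕ) (u w : ℕ) (S N S' N' : ℕ), NLink G j u w →
        s.arr aCong j < s.reg rCap →
        (∀ v < n, b v = s.arr aBall v ∨ s.arr aBall v = 0 ∧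
          b v = s.reg rRad + 1 ∧ s.arr aCut v = 0 ∧ P (s.reg rRad + 1) v) →
        S = countTagged n b → S = s.reg rSize + N →
        ((0 < b u ∧ b u < s.reg rRad + 1 ∧ s.arr aCut w = 0 ∧ b w = 0) ∧
          b' = Function.update b w (s.reg rRad + 1) ∧ N' = N + 1 ∧ S' = S + 1 ∨
        (0 < b u → b u < s.reg rRad + 1 → s.arr aCut w = 0 → b w ≠ 0) ∧
          b' = b ∧ N' = N ∧ S' = S) →
        (∀ v < n, b' v = s.arr aBall v ∨ s.arr aBall v = 0 ∧
          b' v = s.reg rRad + 1 ∧ s.arr aCut v = 0 ∧ P (s.reg rRad + 1) v) ∧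
        S' = countTagged n b' ∧ S' = s.reg rSize + N' ∧ (∀ v, b v ≠ 0 → b' v ≠ 0) ∧
        (s.arr aBall u ≠ 0 → s.arr aCut w = 0 → b' w ≠ 0) := by
      rintro b b' u w S N S' N' hl hC g1 g2 g3 (⟨⟨g4, g5, g6, g7⟩, rfl, rfl, rfl⟩ |
        ⟨g4, rfl, rfl, rfl⟩)
      · refine ⟨fun v hv => ?_, ?_, by omega, fun v hv => ?_, fun _ _ => by simp⟩
        · rw [Function.update_apply]
          split_ifs with hvw
          · subst hvw
            refine Or.inr ⟨?_, rfl, g6, ?_⟩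
            · rcases g1 _ hl.symm.lt with h | h <;> omega
            · have hu : b u = s.arr aBall u := by
                rcases g1 _ hl.lt with h | h
                · exact h
                · omega
              rw [hu] at g4 g5
              exact hP _ _ _ _ _ hl hC g5 (hB.mem _ hl.lt g4.ne').2
          · exact g1 v hv
        · rw [countTagged_update hl.symm.lt g7 (by omega), g2]
        · rw [Function.update_apply]
          split_ifs
          · omega
          · exact hv
      · refine ⟨g1, g2, g3, fun v hv => hv, fun hu hw => ?_⟩
        have hle := hB.le _ hl.lt
        rcases g1 _ hl.lt with h | h
        · exact g4 (by omega) (by omega) hw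
        · omega
    rw [runs_block_cons, runs_load]
    simp only [Memory.reg_setReg, Operand.eval_reg, hj, e3, runs_block_cons, runs_cond,
      Test.holds_lt, e4]
    simp only [if_true, if_false, show (2 : ℕ) ≠ 27 from by decide]
    refine ⟨fun hC => ?_, fun hC => ?_⟩
    · simp only [runs_load]
      refine (runs_touch (by decide) _).mono ?_
      rintro t₂ s₂ hs₂ ⟨ht₂, k1⟩
      have f1 := hs₂.arr aCut rfl
      have f2 := hs₂.reg rU rfl
      have f3 := hs₂.reg rW rfl
      have f4 := hs₂.reg rRadNew rfl
      simp [hj, e1, e2, e5, e6] at f1 f2 f3 f4 k1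
      obtain ⟨l1, l2, l3, l4, l5⟩ := hstep _ _ _ _ _ _ _ _ hends hC h1 h3 h4
        (by simpa [Nat.pos_iff_ne_zero] using k1)
      refine (runs_touch (by decide) _).mono ?_
      rintro t₃ s₃ hs₃ ⟨ht₃, k2⟩
      simp only [f1, f2, f3, f4] at k2
      obtain ⟨p1, p2, p3, p4, p5⟩ := hstep _ _ _ _ _ _ _ _ hends.symm hC l1 l2 l3 k2
      simp only [runs_block_nil, Memory.arr_setReg]
      refine ⟨⟨p1, ?_, p2, p3⟩, by omega⟩
      intro e u w hl hej hC hu hw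
      rcases Nat.lt_succ_iff_lt_or_eq.1 hej with hej | rfl
      · exact p4 _ (l4 _ (h2 e u w hl hej hC hu hw))
      · rcases hl.eq_or hends with ⟨rfl, rfl⟩ | ⟨rfl, rfl⟩
        · exact p4 _ (l5 hu hw)
        · exact p5 hu hw
    · simp only [runs_skip, runs_block_nil, Memory.reg_setReg, Memory.arr_setReg]
      refine ⟨⟨h1, ?_, h3, h4⟩, by omega⟩
      intro e u w hl hej hC' hu hw
      rcases Nat.lt_succ_iff_lt_or_eq.1 hej with hej | rfl
      · exact h2 e u w hl hej hC' hu hw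
      · exact absurd hC' hC
  · rintro t₁ s₁ hs₁ ⟨⟨h1, h2, h3, h4⟩, ht₁⟩
    have e1 := hs₁.reg rQ rfl
    have e2 := hs₁.reg rSize rfl
    have e3 := hs₁.reg rRadNew rfl
    have e4 := hs₁.reg rGo rfl
    simp at e1 e2 e3 e4
    have key : BallInv G (s.reg rCap) (s.arr aCong) (s.arr aCut) P (s₁.arr aBall)
          (s.reg rRad + 1) ∧
        (∀ v < n, s₁.arr aBall v = s.arr aBall v ∨
          s.arr aBall v = 0 ∧ s₁.arr aBall v = s.reg rRad + 1) := by
      refine ⟨⟨fun v hv => ?_, fun v hv hb => ?_, fun e u w hl hC hu hu' hw => ?_⟩, fun v hv =>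
        (h1 v hv).imp id fun h => ⟨h.1, h.2.1⟩⟩
      · have := hB.le v hv
        rcases h1 v hv with h | h <;> omega
      · rcases h1 v hv with h | h
        · rw [h] at hb ⊢
          exact hB.mem v hv hb
        · rw [h.2.1]
          exact h.2.2
      · refine h2 e u w hl hl.choose hC ?_ hw
        rcases h1 u hl.lt with h | h
        · rwa [← h]
        · omega
    simp only [runs_arith, runs_cond, runs_block_cons, runs_block_nil, Test.holds_lt,
      Operand.eval_reg, Memory.reg_setReg, ArithOp.eval_times, Memory.arr_setReg, e1, e2]
    refine ⟨fun hlt => ?_, fun hlt => ?_⟩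
    · simp at hlt
      refine ⟨by omega, key.1, key.2, by simp [e3], s₁.reg rNew, by omega, Or.inl ?_⟩
      simp [hlt, e3, e4, h4]
    · simp at hlt
      refine ⟨by omega, key.1, key.2, by simp [e3], s₁.reg rNew, by omega, Or.inr ?_⟩
      simp [hlt]

/-- Growing a ball by the factor `1 + 1 / q` in each round is possible only `q * (log n + 1)`
times. -/
theorem rounds_le {q r N n : ℕ} (hN : N ≤ n) (h : (q + 1) ^ r ≤ q ^ r * (N + 1)) :
    r ≤ q * (Nat.log 2 n + 1) := by
  rcases Nat.eq_zero_or_pos q with rfl | hq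
  · rcases Nat.eq_zero_or_pos r with rfl | hr
    · simp
    · simp [zero_pow hr.ne'] at h
  by_contra! hlt
  -- Bernoulli's inequality `(1 + 1 / q) ^ j ≥ 1 + j / q`, which gives `(1 + 1 / q) ^ q ≥ 2`.
  have h1 : ∀ j, q ^ j * (q + j) ≤ (q + 1) ^ j * q := by
    intro j
    induction j with
    | zero => simp
    | succ j ih =>
      calc q ^ (j + 1) * (q + (j + 1)) ≤ q ^ j * (q + j) * (q + 1) := by
            rw [pow_succ, mul_assoc, mul_assoc]
            refine Nat.mul_le_mul_left _ ?_
            nlinarith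
        _ ≤ (q + 1) ^ j * q * (q + 1) := Nat.mul_le_mul_right _ ih
        _ = (q + 1) ^ (j + 1) * q := by ring
  have h2 : 2 * q ^ q ≤ (q + 1) ^ q := by
    refine Nat.le_of_mul_le_mul_right (c := q) ?_ hq
    calc 2 * q ^ q * q = q ^ q * (q + q) := by ring
      _ ≤ _ := h1 q
  obtain ⟨d, rfl⟩ := Nat.exists_eq_add_of_lt hlt
  have h3 : 2 ^ (Nat.log 2 n + 1) * q ^ (q * (Nat.log 2 n + 1)) ≤
      (q + 1) ^ (q * (Nat.log 2 n + 1)) := by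
    rw [pow_mul, pow_mul, ← mul_pow]
    exact Nat.pow_le_pow_left h2 _
  have h4 : q ^ (d + 1) < (q + 1) ^ (d + 1) := Nat.pow_lt_pow_left (by omega) (by omega)
  have h5 : N + 1 ≤ 2 ^ (Nat.log 2 n + 1) :=
    Nat.succ_le_of_lt (hN.trans_lt (Nat.lt_pow_succ_log_self (by norm_num) n))
  have h6 : 0 < q ^ (q * (Nat.log 2 n + 1)) := Nat.pow_pos hq
  rw [add_assoc, pow_add, pow_add _ _ (d + 1)] at h
  have h7 := Nat.mul_le_mul_left (q ^ (q * (Nat.log 2 n + 1)) * q ^ (d + 1)) h5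
  have h8 := Nat.mul_le_mul_right (q ^ (d + 1)) h3
  have h9 : (q + 1) ^ (q * (Nat.log 2 n + 1)) * q ^ (d + 1) <
      (q + 1) ^ (q * (Nat.log 2 n + 1)) * (q + 1) ^ (d + 1) :=
    Nat.mul_lt_mul_of_pos_left h4 (Nat.pow_pos (by omega))
  nlinarith

open Classical in
/-- The number of edges of usage less than `cap` that lead from `S` to `T`. -/
noncomputable def openEdges {n m : ℕ} (G : Graph (Fin n) (Fin m)) (cap : ℕ) (C : ℕ → ℕ)
    (S T : ℕ → Prop) : ℕ :=
  ((Finset.range m).filter fun e => C e < cap ∧ ∃ u w, NLink G e u w ∧ S u ∧ T w).card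

open Classical in
/-- If all open edges from `S` to `T` end in `W`, there are at most `Δ |W|` of them. -/
theorem openEdges_le {n m : ℕ} {G : Graph (Fin n) (Fin m)} {cap : ℕ} {C : ℕ → ℕ} {S T : ℕ → Prop}
    {W : Finset ℕ}
    (h : ∀ e u w, NLink G e u w → C e < cap → S u → T w → w ∈ W) (hW : ∀ w ∈ W, w < n) :
    openEdges G cap C S T ≤ maxDegree G * W.card := by
  have : ((Finset.range m).filter fun e => C e < cap ∧ ∃ u w, NLink G e u w ∧ S u ∧ T w) ⊆
      W.biUnion fun w => (Finset.range m).filter fun e => ∃ u, NLink G e w u := by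
    intro e he
    simp only [Finset.mem_filter, Finset.mem_biUnion] at he ⊢
    obtain ⟨he, hC, u, w, hl, hS, hT⟩ := he
    exact ⟨w, h e u w hl hC hS hT, he, u, hl.symm⟩
  refine (Finset.card_le_card this).trans (Finset.card_biUnion_le.trans ?_)
  rw [mul_comm, ← smul_eq_mul]
  exact Finset.sum_le_card_nsmul _ _ _ fun w hw => card_incident_le G (hW w hw) m

/-- A finished ball, consisting of the vertices `v` with `b v ≠ 0` and `b v < R`: it contains the
vertices of the given tag outside `cut`, its radius is at most `ℓ / 2`, and few edges leave it. -/
structure SmallBall {n m : ℕ} (G : Graph (Fin n) (Fin m)) (ℓ cap q tag : ℕ) (C cut tagged : ℕ → ℕ)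
    (P : ℕ → ℕ → Prop) (b : ℕ → ℕ) (R size : ℕ) : Prop where
  radius : 2 * R ≤ ℓ + 4
  mem : ∀ v < n, b v ≠ 0 → b v < R → cut v = 0 ∧ P (b v) v
  core : ∀ v < n, tagged v = tag → cut v = 0 → b v ≠ 0 ∧ b v < R
  card : ((Finset.range n).filter fun v => b v ≠ 0 ∧ b v < R).card = size
  boundary : q * openEdges G cap C (fun u => b u ≠ 0 ∧ b u < R)
    (fun w => cut w = 0 ∧ ¬ (b w ≠ 0 ∧ b w < R)) ≤ maxDegree G * size

/-- The time for growing a ball. -/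
def growTime (n m ℓ : ℕ) : ℕ := 12 * n + (36 * m + 17) * (ℓ + 1) + 20

/-- The property `P t v`, for instance a bound for the label of a vertex `v` with mark `t`, has to be
inherited by neighbours with greater marks. -/
theorem runs_grow {n m : ℕ} {G : Graph (Fin n) (Fin m)} {k z ℓ a : ℕ} {s : Memory}
    {P : ℕ → ℕ → Prop} (ha : a ≠ aBall) (henv : Env G k z ℓ s)
    (hP : ∀ t t' e u w, NLink G e u w → s.arr aCong e < s.reg rCap → t < t' → P t u → P t' w)
    (hP1 : ∀ v < n, s.arr a v = s.reg rTag → P 1 v) :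
    Runs (grow a) s fun t s' => t ≤ growTime n m ℓ ∧
      SmallBall G ℓ (s.reg rCap) (s.reg rQ) (s.reg rTag) (s.arr aCong) (s.arr aCut) (s.arr a) P
        (s'.arr aBall) (s'.reg rRadNew) (s'.reg rSize) := by
  simp only [grow, runs_block_cons, runs_arith]
  refine (Runs.forLoop' (N := n) 10 (fun j s' =>
    (∀ v < j, s'.arr aBall v = if s.arr a v = s.reg rTag ∧ s.arr aCut v = 0 then 1 else 0) ∧
    s'.reg rSizeNew = countTagged j (s'.arr aBall)) (by simp [henv.regN]) rfl rfl ?_ ?_).mono ?_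
  · simp [countTagged]
  · rintro j s₁ hs₁ hj hjn ⟨h1, h2⟩
    have e1 : s₁.arr a = s.arr a := by
      rw [hs₁.arr a (by simp [forLoop, block, Prog.writesArr, ha.symm])]
      rfl
    have e2 := hs₁.arr aCut rfl
    have e3 := hs₁.reg rTag rfl
    simp at e2 e3
    have hc : ∀ x, countTagged (j + 1) (Function.update (s₁.arr aBall) j x) =
        countTagged j (s₁.arr aBall) + if x ≠ 0 then 1 else 0 := by
      intro x
      have : ((Finset.range j).filter fun v => Function.update (s₁.arr aBall) j x v ≠ 0) =
          (Finset.range j).filter fun v => s₁.arr aBall v ≠ 0 := by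
        refine Finset.filter_congr fun v hv => ?_
        rw [Function.update_of_ne (Finset.mem_range.1 hv).ne]
      rw [countTagged, countTagged, Finset.range_add_one, Finset.filter_insert,
        Function.update_self]
      split_ifs with hx
      · rw [Finset.card_insert_of_notMem (by simp), this]
      · rw [this]
        rfl
    have hu : ∀ x, (x = if s.arr a j = s.reg rTag ∧ s.arr aCut j = 0 then 1 else 0) →
        ∀ v < j + 1, Function.update (s₁.arr aBall) j x v =
          if s.arr a v = s.reg rTag ∧ s.arr aCut v = 0 then 1 else 0 := by
      intro x hx v hv
      rw [Function.update_apply]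
      by_cases hvj : v = j
      · rw [if_pos hvj, hx, hvj]
      · rw [if_neg hvj]
        exact h1 v (by omega)
    simp only [Nat.lt_succ_iff] at hu
    by_cases g1 : s.arr a j = s.reg rTag <;> by_cases g2 : s.arr aCut j = 0
    · simp [hj, e1, e2, e3, g1, g2, ha, h2, hc]
      exact hu 1 (by simp [g1, g2])
    · simp [hj, e1, e2, e3, g1, g2, ha, h2, hc]
      exact hu 0 (by simp [g2])
    · simp [hj, e1, e3, g1, ha, h2, hc]
      exact hu 0 (by simp [g1])
    · simp [hj, e1, e3, g1, ha, h2, hc]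
      exact hu 0 (by simp [g1])
  rintro t₁ s₁ hs₁ ⟨⟨h1, h2⟩, ht₁⟩
  have a1 := hs₁.reg rQ rfl
  have a2 := hs₁.reg rTag rfl
  have a3 := hs₁.reg rCap rfl
  have a4 := hs₁.arr aCut rfl
  have a5 := hs₁.arr aCong rfl
  simp at a1 a2 a3 a4 a5
  have henv₁ := (henv.setReg (r := rSizeNew) (by norm_num) 0).of_sameOff hs₁ rfl
  simp only [Operand.eval_reg, Operand.eval_const, ArithOp.eval_plus, add_zero]
  set L := Nat.log 2 n with hL
  refine (Runs.loop (φ := (36 * m + 17) * (s.reg rQ * (L + 1) + 1)) (fun φ s' =>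
    (s'.reg rGo = 0 ∧ ∃ r, s'.reg rRad = r + 1 ∧
      BallInv G (s.reg rCap) (s.arr aCong) (s.arr aCut) P (s'.arr aBall) (r + 1) ∧
      (∀ v < n, s.arr a v = s.reg rTag → s.arr aCut v = 0 → s'.arr aBall v = 1) ∧
      s'.reg rSize = countTagged n (s'.arr aBall) ∧ s'.reg rSizeNew = s'.reg rSize ∧
      (s.reg rQ + 1) ^ r ≤ s.reg rQ ^ r * (s'.reg rSize + 1) ∧
      φ = (36 * m + 17) * (s.reg rQ * (L + 1) + 1 - r)) ∨
    (s'.reg rGo ≠ 0 ∧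
      SmallBall G ℓ (s.reg rCap) (s.reg rQ) (s.reg rTag) (s.arr aCong) (s.arr aCut) (s.arr a) P
        (s'.arr aBall) (s'.reg rRadNew) (s'.reg rSize))) ?_ ?_).mono ?_
  · refine Or.inl ⟨by simp, 0, by simp, ⟨fun v hv => ?_, fun v hv hb => ?_, ?_⟩, ?_, ?_, ?_, ?_, ?_⟩
    · simp only [Memory.arr_setReg, h1 v hv]
      split_ifs <;> omega
    · simp only [Memory.arr_setReg, h1 v hv] at hb ⊢
      split_ifs at hb ⊢ with h
      · exact ⟨h.2, hP1 v hv h.1⟩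
      · exact absurd rfl hb
    · intro e u w hl hC hu hu'
      omega
    · intro v hv ht hc
      simp only [Memory.arr_setReg, h1 v hv, ht, hc, and_self, if_true]
    · simp [h2]
    · simp
    · simp
    · simp
  · rintro φ s₂ hs₂ (⟨hgo, r, g1, g2, g3, g4, g5, g6, rfl⟩ | ⟨hgo, -⟩) hb
    swap
    · exact absurd hb hgo
    have b1 := hs₂.reg rQ rfl
    have b3 := hs₂.reg rCap rfl
    have b4 := hs₂.arr aCut rfl
    have b5 := hs₂.arr aCong rfl
    simp only [Memory.reg_setReg, Memory.arr_setReg] at b1 b3 b4 b5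
    simp [a1, a3, a4, a5] at b1 b3 b4 b5
    have henv₂ := (((henv₁.setReg (r := rSize) (by norm_num) _).setReg (r := rRad)
      (by norm_num) _).setReg (r := rGo) (by norm_num) _).of_sameOff hs₂ rfl
    have hr : r ≤ s.reg rQ * (L + 1) := rounds_le (g4 ▸ countTagged_le n _) g6
    have hq : s.reg rQ * (L + 1) * 2 ≤ ℓ := by
      rw [henv.q, mul_assoc]
      exact Nat.div_mul_le_self _ _
    refine (runs_growRound (P := P) henv₂ (by rwa [b5, b3]) (by rwa [b5, b3, b4, g1]) g4 g5).mono ?_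
    rintro t₃ s₃ hs₃ ⟨ht₃, k1, k2, k3, new, k4, k5⟩
    rw [b5, b3, b4, g1] at k1
    rw [g1] at k2 k3 k5
    rw [b1] at k5
    rcases k5 with ⟨l1, l2, l3, l4, l5⟩ | ⟨l1, l2, l3⟩
    · refine ⟨_, Or.inl ⟨l5.trans hgo, r + 1, l4, k1, fun v hv ht hc => ?_, by rw [l2, k4],
        by rw [l2, l3], ?_, rfl⟩, ?_⟩
      · have := g3 v hv ht hc
        rcases k2 v hv with h | h <;> omega
      · rw [l2, pow_succ, pow_succ]
        calc (s.reg rQ + 1) ^ r * (s.reg rQ + 1)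
            ≤ s.reg rQ ^ r * (s₂.reg rSize + 1) * (s.reg rQ + 1) := Nat.mul_le_mul_right _ g6
          _ = s.reg rQ ^ r * ((s₂.reg rSize + 1) * (s.reg rQ + 1)) := mul_assoc _ _ _
          _ ≤ s.reg rQ ^ r * (s.reg rQ * (s₂.reg rSize + new + 1)) := by
              refine Nat.mul_le_mul_left _ ?_
              nlinarith
          _ = _ := (mul_assoc _ _ _).symm
      · have : s.reg rQ * (L + 1) + 1 - r = s.reg rQ * (L + 1) + 1 - (r + 1) + 1 := by omega
        rw [this]
        generalize s.reg rQ * (L + 1) + 1 - (r + 1) = y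
        rw [Nat.mul_add_one]
        omega
    · refine ⟨0, Or.inr ⟨by omega, ?_⟩, ?_⟩
      · have hin : ∀ v < n, (s₃.arr aBall v ≠ 0 ∧ s₃.arr aBall v < r + 1 + 1) ↔
            s₂.arr aBall v ≠ 0 := by
          intro v hv
          have := g2.le v hv
          rcases k2 v hv with h | h <;> omega
        rw [k3, l2]
        refine ⟨by omega, fun v hv h _ => k1.mem v hv h, fun v hv ht hc => ?_, ?_, ?_⟩
        · have := g3 v hv ht hc
          rcases k2 v hv with h | h <;> omega
        · rw [g4, countTagged]
          congr 1
          exact Finset.filter_congr fun v hv => hin v (Finset.mem_range.1 hv)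
        · have hnew : ((Finset.range n).filter fun v => s₃.arr aBall v ≠ 0 ∧
              s₂.arr aBall v = 0).card = new := by
            have := Finset.card_filter_add_card_filter_not (s := (Finset.range n).filter fun v =>
              s₃.arr aBall v ≠ 0) (fun v => s₂.arr aBall v = 0)
            rw [Finset.filter_filter, Finset.filter_filter, ← countTagged, k4, g4] at this
            have h' : ((Finset.range n).filter fun v => s₃.arr aBall v ≠ 0 ∧
                ¬ s₂.arr aBall v = 0) = (Finset.range n).filter fun v => s₂.arr aBall v ≠ 0 := by
              refine Finset.filter_congr fun v hv => ⟨fun h => h.2, fun h => ⟨?_, h⟩⟩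
              rcases k2 v (Finset.mem_range.1 hv) with h' | h' <;> omega
            rw [h', ← countTagged] at this
            omega
          have hle := openEdges_le (G := G) (cap := s.reg rCap) (C := s.arr aCong)
            (S := fun u => s₃.arr aBall u ≠ 0 ∧ s₃.arr aBall u < r + 1 + 1)
            (T := fun w => s.arr aCut w = 0 ∧ ¬ (s₃.arr aBall w ≠ 0 ∧ s₃.arr aBall w < r + 1 + 1))
            (W := (Finset.range n).filter fun v => s₃.arr aBall v ≠ 0 ∧ s₂.arr aBall v = 0) ?_ ?_
          · rw [hnew] at hle
            calc _ ≤ s.reg rQ * (maxDegree G * new) := Nat.mul_le_mul_left _ hle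
              _ = maxDegree G * (s.reg rQ * new) := by ring
              _ ≤ _ := Nat.mul_le_mul_left _ l1
          · rintro e u w hl hC ⟨hu1, hu2⟩ ⟨hw1, hw2⟩
            rw [Finset.mem_filter, Finset.mem_range]
            refine ⟨hl.symm.lt, k1.closed e u w hl hC hu1 hu2 hw1, ?_⟩
            by_contra hw
            exact hw2 ((hin w hl.symm.lt).2 hw)
          · intro w hw
            exact Finset.mem_range.1 (Finset.mem_filter.1 hw).1
      · have : s.reg rQ * (L + 1) + 1 - r = s.reg rQ * (L + 1) - r + 1 := by omega
        rw [this, Nat.mul_add_one]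
        omega
  · rintro t₂ s₂ hs₂ ⟨φ, (⟨hgo, -⟩ | ⟨hgo, h⟩), hb, ht₂⟩
    · exact absurd hgo hb
    · rw [runs_block_nil]
      refine ⟨?_, h⟩
      have hq : s.reg rQ * (L + 1) ≤ ℓ := by
        refine le_trans ?_ (Nat.div_mul_le_self ℓ ((L + 1) * 2))
        rw [henv.q, ← hL, ← mul_assoc]
        omega
      have := Nat.mul_le_mul_left (36 * m + 17) (Nat.succ_le_succ hq)
      simp only [Nat.succ_eq_add_one] at this
      unfold growTime
      omega

/-! ### A union of balls -/

theorem openEdges_le_add {n m : ℕ} {G : Graph (Fin n) (Fin m)} {cap : ℕ} {C : ℕ → ℕ}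
    {S T S₁ T₁ S₂ T₂ : ℕ → Prop}
    (h : ∀ u < n, ∀ w < n, S u → T w → S₁ u ∧ T₁ w ∨ S₂ u ∧ T₂ w) :
    openEdges G cap C S T ≤ openEdges G cap C S₁ T₁ + openEdges G cap C S₂ T₂ := by
  classical
  refine le_trans (Finset.card_le_card ?_) (Finset.card_union_le _ _)
  intro e he
  simp only [Finset.mem_union, Finset.mem_filter] at he ⊢
  obtain ⟨he, hC, u, w, hl, hS, hT⟩ := he
  rcases h u hl.lt w hl.symm.lt hS hT with ⟨h1, h2⟩ | ⟨h1, h2⟩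
  · exact Or.inl ⟨he, hC, u, w, hl, h1, h2⟩
  · exact Or.inr ⟨he, hC, u, w, hl, h1, h2⟩

theorem runs_absorb {n : ℕ} {s : Memory} (hn : s.reg rN = n) :
    Runs absorb s fun t s' => t ≤ 11 * n + 2 ∧
      (∀ v < n, s'.arr aCut v =
        if s.arr aBall v ≠ 0 ∧ s.arr aBall v < s.reg rRadNew then 1 else s.arr aCut v) ∧
      s'.reg rTotal = s.reg rTotal + ((Finset.range n).filter fun v =>
        s.arr aBall v ≠ 0 ∧ s.arr aBall v < s.reg rRadNew).card := by
  simp only [absorb]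
  refine (Runs.forLoop' (N := n) 9 (fun j s' =>
    (∀ v, s'.arr aCut v = if v < j ∧ s.arr aBall v ≠ 0 ∧ s.arr aBall v < s.reg rRadNew then 1
      else s.arr aCut v) ∧
    s'.reg rTotal = s.reg rTotal + ((Finset.range j).filter fun v =>
        s.arr aBall v ≠ 0 ∧ s.arr aBall v < s.reg rRadNew).card)
    (by simpa using hn) rfl rfl (by simp) ?_).mono ?_
  · rintro j s₁ hs₁ hj hjn ⟨h1, h2⟩
    have e1 := hs₁.arr aBall rfl
    have e2 := hs₁.reg rRadNew rfl
    have hstep : ∀ v, ¬ (s.arr aBall j ≠ 0 ∧ s.arr aBall j < s.reg rRadNew) →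
        s₁.arr aCut v = if v < j + 1 ∧ s.arr aBall v ≠ 0 ∧ s.arr aBall v < s.reg rRadNew then 1
          else s.arr aCut v := by
      intro v hv
      rw [h1 v]
      congr 1
      rcases eq_or_ne v j with rfl | hvj
      · simp [hv]
      · simp only [show v < j + 1 ↔ v < j by omega]
    rw [Finset.range_add_one, Finset.filter_insert]
    by_cases g1 : s.arr aBall j = 0
    · simp only [g1, ne_eq, not_true, false_and, if_false]
      simp [hj, e1, g1, h2]
      simpa [Nat.lt_succ_iff] using fun v => hstep v (by simp [g1])
    by_cases g2 : s.arr aBall j < s.reg rRadNew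
    · rw [if_pos ⟨g1, g2⟩, Finset.card_insert_of_notMem (by simp)]
      simp [hj, e1, e2, Nat.pos_of_ne_zero g1, g2, h2, Nat.add_assoc]
      refine ⟨fun v => ?_, g1⟩
      rw [Function.update_apply]
      by_cases hvj : v = j
      · rw [if_pos hvj, hvj, if_pos ⟨le_rfl, g1, g2⟩]
      · rw [if_neg hvj, h1 v]
        simp only [ne_eq, show v ≤ j ↔ v < j by omega]
    · rw [if_neg (fun h => g2 h.2)]
      simp [hj, e1, e2, Nat.pos_of_ne_zero g1, g2, h2]
      have h3 := fun v => hstep v (fun h => g2 h.2)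
      simp only [Nat.lt_succ_iff, ne_eq] at h3
      exact ⟨fun _ => h3, fun _ => h3⟩
  · rintro t s' hs' ⟨⟨h1, h2⟩, ht⟩
    refine ⟨ht, fun v hv => ?_, h2⟩
    rw [h1 v]
    simp only [hv, true_and]

/-- The state of the construction of a sparse cut when the first `i` indices have been dealt with:
`total` vertices form the one side, few edges of usage less than `cap` leave it, and it contains all
unmatched vertices of `A i'` or of `B i'` for each `i' < i`, unless it is large. -/
structure CutInv {n m : ℕ} (G : Graph (Fin n) (Fin m)) (cap q left : ℕ) (C tagA tagB cut : ℕ → ℕ)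
    (total i : ℕ) : Prop where
  le_one : ∀ v < n, cut v ≤ 1
  card : total = countTagged n cut
  sparse : q * openEdges G cap C (fun u => cut u ≠ 0) (fun w => cut w = 0) ≤ maxDegree G * total
  size : 8 * total ≤ 5 * n
  covered : 2 * total < left → ∀ i' < i, (∀ v < n, tagA v = i' + 1 → cut v ≠ 0) ∨
    (∀ v < n, tagB v = i' + 1 → cut v ≠ 0)

theorem card_union_ball {n : ℕ} {cut cut' b : ℕ → ℕ} {R : ℕ}
    (hb : ∀ v < n, b v ≠ 0 → b v < R → cut v = 0)
    (hcut : ∀ v < n, cut' v = if b v ≠ 0 ∧ b v < R then 1 else cut v) :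
    countTagged n cut' = countTagged n cut +
      ((Finset.range n).filter fun v => b v ≠ 0 ∧ b v < R).card := by
  rw [countTagged, countTagged, ← Finset.card_union_of_disjoint]
  · congr 1
    ext v
    simp only [Finset.mem_filter, Finset.mem_union, Finset.mem_range]
    by_cases hv : v < n
    · rw [hcut v hv]
      split_ifs with h <;> simp [hv, h]
    · simp [hv]
  · rw [Finset.disjoint_left]
    intro v hv hv'
    rw [Finset.mem_filter, Finset.mem_range] at hv hv'
    exact hv.2 (hb v hv.1 hv'.2.1 hv'.2.2)

/-- A ball may be added if it takes at most half of the vertices outside `cut`. Since `cut` has fewer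
than `n / 4` vertices before, it has at most `5 n / 8` after that. -/
theorem CutInv.union {n m : ℕ} {G : Graph (Fin n) (Fin m)} {ℓ cap q left : ℕ}
    {C tagA tagB cut : ℕ → ℕ} {total i : ℕ} (h : CutInv G cap q left C tagA tagB cut total i)
    (hleft : 2 * left ≤ n) (htotal : 2 * total < left) {tagged : ℕ → ℕ}
    (ht : tagged = tagA ∨ tagged = tagB) {P : ℕ → ℕ → Prop} {b : ℕ → ℕ} {R size : ℕ}
    (hb : SmallBall G ℓ cap q (i + 1) C cut tagged P b R size) (hsize : 2 * size + total ≤ n)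
    {cut' : ℕ → ℕ} (hcut : ∀ v < n, cut' v = if b v ≠ 0 ∧ b v < R then 1 else cut v) :
    CutInv G cap q left C tagA tagB cut' (total + size) (i + 1) := by
  have hmono : ∀ v < n, cut v ≠ 0 → cut' v ≠ 0 := by
    intro v hv hc
    rw [hcut v hv]
    split_ifs <;> simp_all
  refine ⟨fun v hv => ?_, ?_, ?_, by omega, fun _ i' hi' => ?_⟩
  · rw [hcut v hv]
    split_ifs
    exacts [le_rfl, h.le_one v hv]
  · rw [card_union_ball (fun v hv h1 h2 => (hb.mem v hv h1 h2).1) hcut, hb.card, h.card]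
  · have h1 : openEdges G cap C (fun u => cut' u ≠ 0) (fun w => cut' w = 0) ≤
        openEdges G cap C (fun u => cut u ≠ 0) (fun w => cut w = 0) +
        openEdges G cap C (fun u => b u ≠ 0 ∧ b u < R)
          (fun w => cut w = 0 ∧ ¬ (b w ≠ 0 ∧ b w < R)) := by
      refine openEdges_le_add fun u hu w hw h1 h2 => ?_
      rw [hcut u hu] at h1
      rw [hcut w hw] at h2
      split_ifs at h2 with h3
      split_ifs at h1 with h4
      · exact Or.inr ⟨h4, h2, h3⟩
      · exact Or.inl ⟨h1, h2⟩
    calc _ ≤ _ := Nat.mul_le_mul_left _ h1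
      _ ≤ _ := by
        rw [Nat.mul_add, Nat.mul_add]
        exact Nat.add_le_add h.sparse hb.boundary
  · rcases Nat.lt_succ_iff_lt_or_eq.1 hi' with hi' | rfl
    · exact (h.covered htotal i' hi').imp (fun h v hv ht => hmono v hv (h v hv ht))
        (fun h v hv ht => hmono v hv (h v hv ht))
    · have : ∀ v < n, tagged v = i' + 1 → cut' v ≠ 0 := by
        intro v hv ht
        by_cases hc : cut v = 0
        · rw [hcut v hv, if_pos (hb.core v hv ht hc)]
          exact one_ne_zero
        · exact hmono v hv hc
      rcases ht with rfl | rfl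
      exacts [Or.inl this, Or.inr this]

/-- The balls around the unmatched vertices of `A i` and of `B i` are disjoint. Hence one of the two
is so small that it fits. -/
theorem two_mul_size_add_le {n m : ℕ} {G : Graph (Fin n) (Fin m)} {ℓ cap q tag : ℕ}
    {C cut tagA tagB lab b b' : ℕ → ℕ} {R size R' size' : ℕ}
    (hA : SmallBall G ℓ cap q tag C cut tagA (fun t v => ℓ + 1 < lab v + t) b R size)
    (hB : SmallBall G ℓ cap q tag C cut tagB (fun t v => lab v + 1 ≤ t) b' R' size')
    (h : n < 2 * size + countTagged n cut) : 2 * size' + countTagged n cut ≤ n := by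
  have h1 := card_union_ball (cut' := fun v => if b v ≠ 0 ∧ b v < R then 1 else cut v)
    (fun v hv h1 h2 => (hA.mem v hv h1 h2).1) (fun v _ => rfl)
  have h2 := card_union_ball
    (cut' := fun v => if b' v ≠ 0 ∧ b' v < R' then 1 else if b v ≠ 0 ∧ b v < R then 1 else cut v)
    (fun v hv h1 h2 => by
      obtain ⟨h3, h4⟩ := hB.mem v hv h1 h2
      rw [if_neg]
      · exact h3
      · rintro ⟨h5, h6⟩
        have := (hA.mem v hv h5 h6).2
        have := hA.radius
        have := hB.radius
        omega) (fun v _ => rfl)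
  have h3 := countTagged_le n fun v =>
    if b' v ≠ 0 ∧ b' v < R' then 1 else if b v ≠ 0 ∧ b v < R then 1 else cut v
  rw [hA.card] at h1
  rw [hB.card] at h2
  omega

/-- If the cut contained the unmatched vertices of `A i` or of `B i` for all `i`, it would be at
least as large as the number of unmatched sources. -/
theorem CutInv.left_le {n m : ℕ} {G : Graph (Fin n) (Fin m)} {cap q left k : ℕ}
    {C tagA tagB cut : ℕ → ℕ} {total : ℕ} (h : CutInv G cap q left C tagA tagB cut total k)
    (hleft : left = countTagged n tagA) (htag : ∀ v < n, tagA v ≤ k)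
    (hdisj : ∀ v < n, tagA v = 0 ∨ tagB v = 0)
    (hle : ∀ i < k, ((Finset.range n).filter fun v => tagA v = i + 1).card ≤
      ((Finset.range n).filter fun v => tagB v = i + 1).card) : left ≤ 2 * total := by
  by_contra! hlt
  have hcov := h.covered hlt
  -- The sets of unmatched vertices of `A i` or `B i` that are contained in the cut.
  have h1 : ∀ i < k, ∃ S : Finset ℕ, ((Finset.range n).filter fun v => tagA v = i + 1).card ≤ S.card ∧
      (∀ v ∈ S, v < n ∧ (tagA v = i + 1 ∨ tagB v = i + 1) ∧ cut v ≠ 0) := by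
    intro i hi
    rcases hcov i hi with hc | hc
    · refine ⟨_, le_rfl, fun v hv => ?_⟩
      rw [Finset.mem_filter, Finset.mem_range] at hv
      exact ⟨hv.1, Or.inl hv.2, hc v hv.1 hv.2⟩
    · refine ⟨_, hle i hi, fun v hv => ?_⟩
      rw [Finset.mem_filter, Finset.mem_range] at hv
      exact ⟨hv.1, Or.inr hv.2, hc v hv.1 hv.2⟩
  choose! S hS hS' using h1
  have h2 : left ≤ ∑ i ∈ Finset.range k,
      ((Finset.range n).filter fun v => tagA v = i + 1).card := by
    rw [hleft, countTagged]
    refine le_trans (Finset.card_le_card ?_) Finset.card_biUnion_le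
    intro v hv
    simp only [Finset.mem_filter, Finset.mem_biUnion, Finset.mem_range] at hv ⊢
    have := htag v hv.1
    exact ⟨tagA v - 1, by omega, hv.1, by omega⟩
  have h3 : ∑ i ∈ Finset.range k, (S i).card ≤ total := by
    rw [← Finset.card_biUnion, h.card, countTagged]
    · refine Finset.card_le_card fun v hv => ?_
      simp only [Finset.mem_filter, Finset.mem_biUnion, Finset.mem_range] at hv ⊢
      obtain ⟨i, hi, hv⟩ := hv
      exact ⟨(hS' i hi v hv).1, (hS' i hi v hv).2.2⟩
    · intro i hi j hj hij
      rw [Function.onFun, Finset.disjoint_left]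
      intro v hv hv'
      have h4 := hS' i (by simpa using hi) v hv
      have h5 := hS' j (by simpa using hj) v hv'
      have := hdisj v h4.1
      omega
  have h4 := Finset.sum_le_sum fun i hi => hS i (Finset.mem_range.1 hi)
  omega

theorem runs_findCut {n m : ℕ} {G : Graph (Fin n) (Fin m)} {k z ℓ : ℕ} {s : Memory}
    (henv : Env G k z ℓ s) (hst : Stuck G k ℓ s)
    (hleft : s.reg rLeft = countTagged n (s.arr aTagA)) (hcard : 2 * s.reg rLeft ≤ n)
    (htag : ∀ v < n, s.arr aTagA v ≤ k) (hdisj : ∀ v < n, s.arr aTagA v = 0 ∨ s.arr aTagB v = 0)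
    (hle : ∀ i < k, ((Finset.range n).filter fun v => s.arr aTagA v = i + 1).card ≤
      ((Finset.range n).filter fun v => s.arr aTagB v = i + 1).card)
    (hcut : ∀ v, s.arr aCut v = 0) :
    Runs findCut s fun t s' => t ≤ k * (2 * growTime n m ℓ + 11 * n + 20) + 5 ∧
      s.reg rLeft ≤ 2 * s'.reg rTotal ∧
      CutInv G (s.reg rCap) (s.reg rQ) (s.reg rLeft) (s.arr aCong) (s.arr aTagA) (s.arr aTagB)
        (s'.arr aCut) (s'.reg rTotal) k := by
  simp only [findCut, runs_block_cons, runs_arith]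
  refine (Runs.forLoop' (N := k) (2 * growTime n m ℓ + 11 * n + 18) (fun i s' =>
    CutInv G (s.reg rCap) (s.reg rQ) (s.reg rLeft) (s.arr aCong) (s.arr aTagA) (s.arr aTagB)
        (s'.arr aCut) (s'.reg rTotal) i) (by simp [henv.regK]) rfl rfl ?_ ?_).mono ?_
  · constructor <;> simp [countTagged, openEdges, hcut]
  · rintro i s₁ hs₁ hi hik h1
    have henv₁ := (henv.setReg (r := rTotal) (by norm_num) 0).of_sameOff hs₁ rfl
    have a1 := hs₁.reg rCap rfl
    have a2 := hs₁.reg rQ rfl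
    have a3 := hs₁.reg rLeft rfl
    have a4 := hs₁.arr aCong rfl
    have a5 := hs₁.arr aTagA rfl
    have a6 := hs₁.arr aTagB rfl
    simp at a1 a2 a3 a4 a5 a6
    obtain ⟨lab, hlab, hsep⟩ := hst.sep i hik
    simp only [runs_block_cons, runs_arith, runs_cond]
    constructor
    swap
    · intro hlt
      simp [hi, a3] at hlt
      simp
      exact ⟨h1.le_one, h1.card, h1.sparse, h1.size, fun h => by omega⟩
    intro hlt
    simp [hi, a3] at hlt
    have henv₂ : Env G k z ℓ ((s₁.setReg rTag (i + 1)).setReg 0 (s₁.reg rTotal + s₁.reg rTotal)) := by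
      have := henv₁.setReg (r := rTag) (by norm_num) (i + 1)
      exact ⟨this.regN, this.regM, this.regK, this.regZ, this.regEll, this.cap, this.q, this.ends,
        this.deg, this.adj, this.exists_adj⟩
    simp [hi]
    refine (runs_grow (P := fun t v => ℓ + 1 < lab v + t) (by decide) henv₂ ?_ ?_).mono ?_
    · -- Labels decrease by at most one along an open edge, while marks increase.
      simp [a1, a4]
      intro t t' e u w hl hC htt hu
      have := hlab.le_succ e u w hl hC
      omega
    · simp [a5]
      intro v hv ht
      have := hsep v hv ht
      omega
    rintro t₂ s₂ hs₂ ⟨ht₂, hA⟩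
    simp [a1, a2, a4, a5] at hA
    have henv₃ := henv₂.of_sameOff hs₂ rfl
    have b1 := hs₂.reg rTotal rfl
    have b2 := hs₂.reg rTag rfl
    have b3 := hs₂.arr aCut rfl
    have b4 := hs₂.arr aCong rfl
    have b5 := hs₂.arr aTagB rfl
    have b6 := hs₂.reg rCap rfl
    have b7 := hs₂.reg rQ rfl
    have b8 := hs₂.reg rN rfl
    simp [a1, a2, a4, a6, henv₁.regN] at b1 b2 b3 b4 b5 b6 b7 b8
    have hfin : ∀ (s₃ : Memory) (tagged : ℕ → ℕ) (P : ℕ → ℕ → Prop),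
        tagged = s.arr aTagA ∨ tagged = s.arr aTagB → s₃.reg rN = n → s₃.reg rTotal = s₁.reg rTotal →
        s₃.arr aCut = s₁.arr aCut →
        SmallBall G ℓ (s.reg rCap) (s.reg rQ) (i + 1) (s.arr aCong) (s₁.arr aCut) tagged P
          (s₃.arr aBall) (s₃.reg rRadNew) (s₃.reg rSize) →
        2 * s₃.reg rSize + s₁.reg rTotal ≤ n →
        Runs absorb s₃ fun t s' => t ≤ 11 * n + 2 ∧
          CutInv G (s.reg rCap) (s.reg rQ) (s.reg rLeft) (s.arr aCong) (s.arr aTagA) (s.arr aTagB)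
            (s'.arr aCut) (s'.reg rTotal) (i + 1) := by
      intro s₃ tagged P ht hn h3 h4 hb hsize
      refine (runs_absorb hn).mono ?_
      rintro t s' - ⟨k1, k2, k3⟩
      rw [hb.card, h3] at k3
      rw [h4] at k2
      rw [k3]
      exact ⟨k1, h1.union hcard (by omega) ht hb hsize k2⟩
    refine ⟨fun hbig => ?_, fun hsmall => ?_⟩
    · have henv₄ : ∀ x y, Env G k z ℓ ((s₂.setReg 0 x).setReg 1 y) := fun x y =>
        ⟨henv₃.regN, henv₃.regM, henv₃.regK, henv₃.regZ, henv₃.regEll, henv₃.cap, henv₃.q,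
          henv₃.ends, henv₃.deg, henv₃.adj, henv₃.exists_adj⟩
      refine (runs_grow (P := fun t v => lab v + 1 ≤ t) (by decide) (henv₄ _ _) ?_ ?_).mono ?_
      · simp [b4, b6]
        intro t t' e u w hl hC htt hu
        have := hlab.le_succ e w u hl.symm hC
        omega
      · simp [b5, b2]
        intro v hv ht
        have := hlab.target v hv ht
        omega
      rintro t₃ s₃ hs₃ ⟨ht₃, hB⟩
      simp [b2, b3, b4, b5, b6, b7] at hB
      have c1 := hs₃.reg rTotal rfl
      have c2 := hs₃.reg rN rfl
      have c3 := hs₃.arr aCut rfl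
      simp [b1, b3, b8] at c1 c2 c3
      have hcard := two_mul_size_add_le hA hB (by rw [← h1.card]; omega)
      rw [← h1.card] at hcard
      refine (hfin s₃ _ _ (Or.inr rfl) c2 c1 c3 hB hcard).mono ?_
      rintro t₄ s₄ - ⟨ht₄, h4⟩
      exact ⟨h4, by omega⟩
    · refine (hfin _ _ _ (Or.inl rfl) (by simp [b8]) (by simp [b1]) (by simp [b3]) (by simpa using hA)
        (by simp; omega)).mono ?_
      rintro t₄ s₄ - ⟨ht₄, h4⟩
      exact ⟨h4, by omega⟩
  · rintro t' s' hs' ⟨h1, ht⟩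
    rw [runs_block_nil]
    refine ⟨?_, h1.left_le hleft htag hdisj hle, h1⟩
    rw [show 2 * growTime n m ℓ + 11 * n + 18 + 2 = 2 * growTime n m ℓ + 11 * n + 20 from rfl,
      Nat.mul_comm _ k] at ht
    omega

/-! ### Output of the cut -/

theorem map_val_filter_finRange (n : ℕ) (p : ℕ → Bool) :
    ((List.finRange n).filter fun v : Fin n => p v).map Fin.val = (List.range n).filter p := by
  rw [← List.map_coe_finRange_eq_range, List.filter_map]
  rfl

theorem runs_printCut {n : ℕ} {s : Memory} (hn : s.reg rN = n)
    (htotal : s.reg rTotal = ((List.finRange n).filter fun v : Fin n => decide (s.arr aCut v = 1)).length) :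
    Runs printCut s fun t s' => t ≤ 18 * n + 30 ∧
      HasOutput s' (0 ::
        (encodeList ((List.finRange n).filter fun v : Fin n => decide (s.arr aCut v = 1)) ++
        encodeList ((List.finRange n).filter fun v : Fin n => !decide (s.arr aCut v = 1)))) := by
  have hcompl : n - s.reg rTotal =
      ((List.finRange n).filter fun v : Fin n => !decide (s.arr aCut v = 1)).length := by
    have := List.length_eq_length_filter_add (l := List.finRange n)
      (fun v : Fin n => decide (s.arr aCut v = 1))
    rw [List.length_finRange] at this
    omega
  simp only [encodeList, map_val_filter_finRange n fun v => decide (s.arr aCut v = 1),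
    map_val_filter_finRange n fun v => !decide (s.arr aCut v = 1), ← htotal, ← hcompl]
  simp only [printCut, emit, runs_block_cons, runs_block_nil, runs_arith, runs_store]
  refine (Runs.forLoop' (N := n) 7 (fun j s' =>
    Printed 0 (0 :: s.reg rTotal :: (List.range j).filter fun v => decide (s.arr aCut v = 1))
      (s'.reg rOut) (s'.arr 1)) (by simpa using hn) rfl rfl ?_ ?_).mono ?_
  · have := ((show Printed 0 [] 0 (s.arr 1) by simp [Printed]).snoc 0).snoc (s.reg rTotal)
    simpa using this
  · rintro j s₁ hs₁ hj hjn h1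
    have e1 := hs₁.arr aCut rfl
    simp at e1
    rw [List.range_succ, List.filter_append]
    by_cases h : s.arr aCut j = 1
    · have := h1.snoc j
      simp [hj, e1, h]
      simpa using this
    · simp [hj, e1, h]
      exact h1
  rintro t₁ s₁ hs₁ ⟨h1, ht₁⟩
  have a1 := hs₁.arr aCut rfl
  have a2 := hs₁.reg rN rfl
  have a3 := hs₁.reg rTotal rfl
  simp [hn] at a1 a2 a3
  refine (Runs.forLoop' (N := n) 7 (fun j s' =>
    Printed 0 ((0 :: s.reg rTotal :: (List.range n).filter fun v => decide (s.arr aCut v = 1)) ++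
      ((n - s.reg rTotal) :: (List.range j).filter fun v => !decide (s.arr aCut v = 1)))
      (s'.reg rOut) (s'.arr 1)) (by simpa using a2) rfl rfl ?_ ?_).mono ?_
  · have := h1.snoc (n - s.reg rTotal)
    simpa [a2, a3] using this
  · rintro j s₂ hs₂ hj hjn h2
    have e1 := hs₂.arr aCut rfl
    simp [a1] at e1
    rw [List.range_succ, List.filter_append]
    by_cases h : s.arr aCut j = 1
    · simp [hj, e1, h]
      simpa using h2
    · have := h2.snoc j
      simp [hj, e1, h]
      simpa using this
  · rintro t₂ s₂ hs₂ ⟨h2, ht₂⟩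
    refine ⟨by omega, fun j hj => ?_⟩
    have := h2.2 j (by simpa using hj)
    simpa using this

/-! ### The sparsity of the cut -/

/-- An edge of the cut either has been used up or is open. -/
theorem card_edgesBetween_le {n m : ℕ} {G : Graph (Fin n) (Fin m)} {cap : ℕ} {C : ℕ → ℕ}
    {S T : ℕ → Prop} {X Y : Finset (Fin n)} (hX : ∀ v ∈ X, S v) (hY : ∀ v ∈ Y, T v) :
    (edgesBetween G X Y).ncard ≤
      ((Finset.range m).filter fun e => cap ≤ C e).card + openEdges G cap C S T := by
  classical
  refine le_trans ?_ (Finset.card_union_le _ _)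
  rw [← Set.ncard_image_of_injective _ Fin.val_injective, ← Set.ncard_coe_finset]
  refine Set.ncard_le_ncard ?_ (Finset.finite_toSet _)
  rintro _ ⟨e, ⟨x, hx, y, hy, hl⟩, rfl⟩
  rw [Finset.mem_coe, Finset.mem_union, Finset.mem_filter, Finset.mem_filter, Finset.mem_range]
  by_cases h : cap ≤ C e
  · exact Or.inl ⟨e.2, h⟩
  · exact Or.inr ⟨e.2, not_le.1 h, x, y, ⟨e.2, x.2, y.2, hl⟩, hX x hx, hY y hy⟩

theorem one_le_maxDegree {n m : ℕ} {G : Graph (Fin n) (Fin m)} {e : Fin m} {x y : Fin n}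
    (h : G.IsLink e x y) : 1 ≤ maxDegree G := by
  refine le_trans ?_ (ncard_incidenceSet_le G x)
  exact (Set.ncard_pos (Set.toFinite _)).2 ⟨e, y, h⟩

/-- The estimate behind the sparsity of the cut: few edges have been used up, and few of the
others cross the cut. -/
theorem edges_mul_le {K bl cr cap q L left total mn n : ℕ} {ℓ D : ℕ} {lg : ℝ}
    (hK : K ≤ bl + cr) (hbl : cap * bl ≤ ℓ * left) (hcr : q * cr ≤ D * total)
    (hcap : ℓ * ℓ < (cap + 1) * L) (hq : ℓ < (q + 1) * ((L + 1) * 2)) (hL : (L : ℝ) ≤ lg)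
    (hlg : 1 ≤ lg) (hD : 1 ≤ D) (hℓ : 32 * (D : ℝ) * lg ≤ ℓ) (hleft : left ≤ 2 * total)
    (hleft' : 2 * left ≤ n) (htotal : 8 * total ≤ 5 * n) (hmn : mn = min total (n - total)) :
    (K : ℝ) * ℓ ≤ 72 * D * lg * mn := by
  have hD' : (1 : ℝ) ≤ D := by exact_mod_cast hD
  have hDlg : lg ≤ D * lg := by nlinarith
  -- Since `cap ≥ ℓ² / (2 L)`, there are at most `2 L left / ℓ` blocked edges.
  have h1 : (bl : ℝ) * ℓ ≤ 2 * lg * left := by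
    have h2 : (cap : ℝ) * bl ≤ ℓ * left := by exact_mod_cast hbl
    have h3 : (ℓ : ℝ) * ℓ ≤ (cap + 1) * L := by exact_mod_cast hcap.le
    have h4 : (0 : ℝ) ≤ bl := Nat.cast_nonneg _
    have h5 : (0 : ℝ) ≤ L := Nat.cast_nonneg _
    have h6 : (0 : ℝ) < ℓ := by linarith
    have h7 : 2 * lg ≤ ℓ * ℓ := by nlinarith
    have h8 : (bl : ℝ) * (ℓ * ℓ) ≤ L * (ℓ * left) + L * bl := by nlinarith
    have h9 : (L : ℝ) * bl ≤ lg * bl := mul_le_mul_of_nonneg_right hL h4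
    have h10 : (L : ℝ) * (ℓ * left) ≤ lg * (ℓ * left) := by gcongr
    have h11 : (2 * lg) * bl ≤ (ℓ * ℓ) * bl := mul_le_mul_of_nonneg_right h7 h4
    refine le_of_mul_le_mul_right (a := (ℓ : ℝ)) ?_ h6
    nlinarith
  -- Since `ℓ ≥ 32 lg`, rounding takes away at most `1 / 8` of `ℓ / (2 (L + 1)) ≥ ℓ / (4 lg)`. Hence
  -- `q ≥ 7 ℓ / (32 lg)`.
  have h2 : (cr : ℝ) * ℓ * 7 ≤ 32 * (D * lg) * total := by
    have h3 : (q : ℝ) * cr ≤ D * total := by exact_mod_cast hcr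
    have h4 : (ℓ : ℝ) ≤ (q + 1) * ((L + 1) * 2) := by exact_mod_cast hq.le
    have h5 : (0 : ℝ) ≤ cr := Nat.cast_nonneg _
    have h6 : (L + 1) * 2 ≤ 4 * lg := by linarith
    have h7 : (ℓ : ℝ) ≤ (q + 1) * (4 * lg) := h4.trans (by gcongr)
    have h8 : (cr : ℝ) * ℓ ≤ cr * ((q + 1) * (4 * lg)) := mul_le_mul_of_nonneg_left h7 h5
    have h9 : (q * cr : ℝ) * (4 * lg) ≤ D * total * (4 * lg) := by gcongr
    have h10 : (cr : ℝ) * (32 * lg) ≤ cr * ℓ := mul_le_mul_of_nonneg_left (by linarith) h5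
    nlinarith
  have h3 : (K : ℝ) ≤ bl + cr := by exact_mod_cast hK
  -- The second side of the cut has at least `3 n / 8` vertices.
  have h4 : (3 : ℝ) * left ≤ 6 * mn ∧ (3 : ℝ) * total ≤ 5 * mn := by
    constructor
    · exact_mod_cast (by omega : 3 * left ≤ 6 * mn)
    · exact_mod_cast (by omega : 3 * total ≤ 5 * mn)
  have hlg0 : (0 : ℝ) ≤ D * lg := by linarith
  have h5 := mul_le_mul_of_nonneg_left h4.1 hlg0
  have h6 := mul_le_mul_of_nonneg_left h4.2 hlg0
  have h7 : lg * left ≤ D * lg * left := mul_le_mul_of_nonneg_right hDlg (Nat.cast_nonneg _)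
  have h8 : (K : ℝ) * ℓ ≤ (bl + cr) * ℓ := mul_le_mul_of_nonneg_right h3 (Nat.cast_nonneg _)
  have h9 : (0 : ℝ) ≤ D * lg * mn := mul_nonneg hlg0 (Nat.cast_nonneg _)
  nlinarith

theorem natLog_le_logb {n : ℕ} (hn : n ≠ 0) : (Nat.log 2 n : ℝ) ≤ Real.logb 2 n := by
  rw [Real.le_logb_iff_rpow_le (by norm_num) (by positivity), Real.rpow_natCast]
  exact_mod_cast Nat.pow_log_le_self 2 hn

/-- Both sides have at least `z / 2` vertices, as `left ≤ 2 |X|` and `|Y| ≥ 3 n / 8 ≥ 3 left / 4`. -/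
theorem CutInv.isCut {n m : ℕ} {G : Graph (Fin n) (Fin m)} {z ℓ left k : ℕ}
    {C tagA tagB cut : ℕ → ℕ} {total : ℕ} (hloop : G.Loopless)
    (h : CutInv G (ℓ * ℓ / Nat.log 2 n) (ℓ / ((Nat.log 2 n + 1) * 2)) left C tagA tagB cut total k)
    (hbl : ℓ * ℓ / Nat.log 2 n * ((Finset.range m).filter fun e =>
      ℓ * ℓ / Nat.log 2 n ≤ C e).card ≤ ℓ * left)
    (hz : z < left) (hleft : left ≤ 2 * total) (hcard : 2 * left ≤ n) (hℓ : 0 < ℓ)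
    (hΔ : 32 * (maxDegree G : ℝ) * Real.logb 2 n ≤ ℓ) {X Y : Finset (Fin n)}
    (hX : ∀ v, v ∈ X ↔ cut v = 1) (hY : ∀ v, v ∈ Y ↔ cut v ≠ 1) :
    X.card = total ∧ IsCut X Y ∧ (z : ℝ) / 2 ≤ X.card ∧ (z : ℝ) / 2 ≤ Y.card ∧
      sparsity G X Y ≤ 72 * maxDegree G * Real.logb 2 n / ℓ := by
  have hXc : X.card = total := by
    rw [h.card, countTagged, card_filter_range]
    congr 1
    ext v
    have := h.le_one v v.2
    simp only [hX, Finset.mem_filter, Finset.mem_univ, true_and]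
    omega
  have hdisj : Disjoint X Y := Finset.disjoint_left.2 fun v h1 h2 => (hY v).1 h2 ((hX v).1 h1)
  have hunion : X ∪ Y = Finset.univ := by
    ext v
    simpa [hX, hY] using em _
  have hsum : X.card + Y.card = n := by
    rw [← Finset.card_union_of_disjoint hdisj, hunion, Finset.card_univ, Fintype.card_fin]
  have hs := h.size
  refine ⟨hXc, ⟨hdisj, hunion, Finset.card_pos.1 (by omega), Finset.card_pos.1 (by omega)⟩, ?_, ?_,
    ?_⟩
  · rw [div_le_iff₀ (by norm_num)]
    exact_mod_cast (by omega : z ≤ X.card * 2)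
  · rw [div_le_iff₀ (by norm_num)]
    exact_mod_cast (by omega : z ≤ Y.card * 2)
  have hmin : 0 < min X.card Y.card := by omega
  rw [sparsity, div_le_div_iff₀ (by exact_mod_cast hmin) (by exact_mod_cast hℓ)]
  have hlg0 : 0 ≤ Real.logb 2 n :=
    (Nat.cast_nonneg (Nat.log 2 n)).trans (natLog_le_logb (by omega))
  -- With an edge in the cut, `n ≥ 2` and `Δ ≥ 1`, so that `log n` and `Δ log n` are positive.
  rcases (edgesBetween G X Y).eq_empty_or_nonempty with he | ⟨e, x, -, y, -, hl⟩
  · rw [he, Set.ncard_empty, Nat.cast_zero, zero_mul]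
    positivity
  have hxy : x ≠ y := hl.ne
  have hn : 2 ≤ n := by
    have := x.2
    have := y.2
    by_contra
    exact hxy (Fin.ext (by omega))
  have hL : 1 ≤ Nat.log 2 n := Nat.log_pos (by norm_num) hn
  have hlg := natLog_le_logb (n := n) (by omega)
  refine edges_mul_le (D := maxDegree G) (n := n) (total := total) (left := left)
    (card_edgesBetween_le (cap := ℓ * ℓ / Nat.log 2 n) (C := C) (S := fun u => cut u ≠ 0)
      (T := fun w => cut w = 0) ?_ ?_) hbl h.sparse ?_ ?_ hlg ?_ (one_le_maxDegree hl) hΔ hleft hcard hs ?_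
  · intro v hv
    simp [(hX v).1 hv]
  · intro v hv
    have := (hY v).1 hv
    have := h.le_one v v.2
    omega
  · exact (Nat.lt_mul_div_succ _ hL).trans_eq (mul_comm _ _)
  · exact (Nat.lt_mul_div_succ _ (by omega)).trans_eq (mul_comm _ _)
  · exact le_trans (by exact_mod_cast hL) hlg
  · omega

/-! ### Correctness of the routing -/

theorem length_filter_le_usage {n m k : ℕ} (L : List (Route n m k)) (e : Fin m) :
    (L.filter fun r => decide (e ∈ r.path.map Prod.fst)).length ≤ usage L e := by
  induction L with
  | nil => simp
  | cons r L ih =>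
    have h : usage (r :: L) e = r.count e + usage L e := by simp [usage]
    rw [h, List.filter_cons]
    split_ifs with he
    · have : 1 ≤ r.count e := by
        rw [Route.count, List.one_le_count_iff]
        obtain ⟨ew, h1, h2⟩ := List.mem_map.1 (of_decide_eq_true he)
        exact List.mem_map.2 ⟨ew, h1, by rw [h2]⟩
      rw [List.length_cons]
      omega
    · omega

/-- The recorded pairs and paths form a partial routing, and the words that have been output
describe it. -/
theorem LogInv.exists_routing {n m k : ℕ} {G : Graph (Fin n) (Fin m)} {A B : Fin k → Finset (Fin n)}
    {L : List (Route n m k)} {s : Memory} (h : LogInv G A B L s) :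
    ∃ (M : Fin k → Finset (Fin n × Fin n)) (P : Fin n × Fin n → List (Fin m × Fin n)),
      IsPartialRouting G A B M P ∧ routingValue M = L.length ∧
      (∀ c, (∀ e : Fin m, usage L e ≤ c) → CongestionAtMost M P c) ∧
      IsRoutingOutput M P (1 :: L.length :: L.flatMap Route.words) := by
  classical
  have hinjA := List.inj_on_of_nodup_map h.nodupA
  have hinjB := List.inj_on_of_nodup_map h.nodupB
  have hL : L.Nodup := h.nodupA.of_map _
  obtain ⟨T, hT⟩ : ∃ T, T = L.map fun r => (r.idx, r.src, r.tgt) := ⟨_, rfl⟩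
  have hTnd : T.Nodup := by
    rw [hT]
    refine List.Nodup.map_on (fun r hr r' hr' hrr => hinjA hr hr' ?_) hL
    simp only [Prod.mk.injEq] at hrr
    exact hrr.2.1
  have hTmem : ∀ i q, (i, q) ∈ T ↔ ∃ r ∈ L, r.idx = i ∧ (r.src, r.tgt) = q := by
    intro i q
    simp [hT]
  obtain ⟨P, hP⟩ : ∃ P : Fin n × Fin n → List (Fin m × Fin n),
      ∀ r ∈ L, P (r.src, r.tgt) = r.path := by
    refine ⟨fun q => if h : ∃ r ∈ L, (r.src, r.tgt) = q then h.choose.path else [], fun r hr => ?_⟩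
    have hex : ∃ r' ∈ L, (r'.src, r'.tgt) = (r.src, r.tgt) := ⟨r, hr, rfl⟩
    simp only [dif_pos hex]
    have := hex.choose_spec
    rw [hinjA this.1 hr (congrArg Prod.fst this.2)]
  obtain ⟨M, hM⟩ : ∃ M : Fin k → Finset (Fin n × Fin n),
      M = fun i => (T.toFinset.filter fun r => r.1 = i).image Prod.snd := ⟨_, rfl⟩
  have hMmem : ∀ i q, q ∈ M i ↔ (i, q) ∈ T := by
    intro i q
    simp only [hM, Finset.mem_image, Finset.mem_filter, List.mem_toFinset]
    constructor
    · rintro ⟨⟨j, q'⟩, ⟨h1, rfl⟩, rfl⟩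
      exact h1
    · exact fun h1 => ⟨(i, q), ⟨h1, rfl⟩, rfl⟩
  have hMr : ∀ i q, q ∈ M i → ∃ r ∈ L, r.idx = i ∧ (r.src, r.tgt) = q := fun i q hq =>
    (hTmem i q).1 ((hMmem i q).1 hq)
  refine ⟨M, P, ⟨?_, ?_, ?_⟩, ?_, ?_, T, hTnd, fun i q => (hMmem i q).symm, ?_⟩
  · intro i q hq
    obtain ⟨r, hr, rfl, rfl⟩ := hMr i q hq
    exact ⟨h.memA r hr, h.memB r hr⟩
  · intro i q hq q' hq' hqq
    obtain ⟨r, hr, rfl, rfl⟩ := hMr i q hq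
    obtain ⟨r', hr', -, rfl⟩ := hMr _ q' hq'
    rcases hqq with hqq | hqq
    · rw [hinjA hr hr' hqq]
    · rw [hinjB hr hr' hqq]
  · intro i q hq
    obtain ⟨r, hr, rfl, rfl⟩ := hMr i q hq
    rw [hP r hr]
    exact h.path r hr
  · have h1 : ∀ i, (M i).card = (T.toFinset.filter fun r => r.1 = i).card := by
      intro i
      rw [hM]
      refine Finset.card_image_of_injOn ?_
      rintro ⟨j, q⟩ hj ⟨j', q'⟩ hj' hqq
      simp only [Finset.coe_filter, Set.mem_ofPred_eq] at hj hj' hqq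
      rw [hj.2, hj'.2, hqq]
    rw [routingValue, Finset.sum_congr rfl fun i _ => h1 i,
      ← Finset.card_eq_sum_card_fiberwise (fun _ _ => Finset.mem_univ _),
      List.toFinset_card_of_nodup hTnd, hT, List.length_map]
  · intro c hc e
    refine le_trans ?_ ((length_filter_le_usage L e).trans (hc e))
    have hsub : ((Finset.univ.biUnion M).filter fun q => e ∈ (P q).map Prod.fst) ⊆
        ((L.filter fun r => decide (e ∈ r.path.map Prod.fst)).map
          fun r => (r.src, r.tgt)).toFinset := by
      intro q hq
      rw [Finset.mem_filter, Finset.mem_biUnion] at hq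
      obtain ⟨⟨i, -, hi⟩, hq⟩ := hq
      obtain ⟨r, hr, -, rfl⟩ := hMr i q hi
      rw [hP r hr] at hq
      rw [List.mem_toFinset]
      exact List.mem_map.2 ⟨r, List.mem_filter.2 ⟨hr, decide_eq_true hq⟩, rfl⟩
    refine (Finset.card_le_card hsub).trans ((List.toFinset_card_le _).trans ?_)
    rw [List.length_map]
  · rw [hT, List.length_map, List.flatMap_map]
    congr 2
    refine List.flatMap_congr fun r hr => ?_
    rw [hP r hr]
    rfl

theorem LogInv.hasOutput {n m k : ℕ} {G : Graph (Fin n) (Fin m)} {A B : Fin k → Finset (Fin n)}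
    {L : List (Route n m k)} {s : Memory} (h : LogInv G A B L s) :
    HasOutput ((s.setCell 1 0 1).setCell 1 1 (s.reg rCnt))
      (1 :: L.length :: L.flatMap Route.words) := by
  rintro (_ | _ | j) hj
  · simp
  · simp [h.cnt]
  · have := h.printed.2 j (by simpa using hj)
    simp
    rw [Nat.add_comm 2 j] at this
    simpa using this

/-! ### The whole program -/

/-- Of the vertices of `A i` and `B i` equally many have been matched. -/
theorem LogInv.card_tag_le {n m k : ℕ} {G : Graph (Fin n) (Fin m)} {A B : Fin k → Finset (Fin n)}
    {L : List (Route n m k)} {s : Memory} (h : LogInv G A B L s)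
    (hA : ∀ i j, i ≠ j → Disjoint (A i) (A j)) (hB : ∀ i j, i ≠ j → Disjoint (B i) (B j))
    (hAB : ∀ i, (A i).card ≤ (B i).card) : ∀ i < k,
      ((Finset.range n).filter fun v => s.arr aTagA v = i + 1).card ≤
        ((Finset.range n).filter fun v => s.arr aTagB v = i + 1).card := by
  have key : ∀ (A : Fin k → Finset (Fin n)) (f : Route n m k → Fin n) (tag : ℕ → ℕ),
      (∀ i j, i ≠ j → Disjoint (A i) (A j)) → (∀ r ∈ L, f r ∈ A r.idx) → (L.map f).Nodup →
      (∀ (v : Fin n) (i : Fin k), tag v = i + 1 ↔ v ∈ A i ∧ v ∉ L.map f) → ∀ i : Fin k,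
      ((Finset.range n).filter fun v => tag v = i + 1).card +
        (L.filter fun r => decide (r.idx = i)).length = (A i).card := by
    intro A f tag hA hf hnd htag i
    have hnd' : ((L.filter fun r => decide (r.idx = i)).map f).Nodup :=
      hnd.sublist (List.filter_sublist.map f)
    rw [card_filter_range, ← List.length_map f, ← List.toFinset_card_of_nodup hnd',
      ← Finset.card_union_of_disjoint]
    · congr 1
      ext v
      simp only [Finset.mem_union, Finset.mem_filter, Finset.mem_univ, true_and, htag,
        List.mem_toFinset, List.mem_map, List.mem_filter, decide_eq_true_eq]
      constructor
      · rintro (h | ⟨r, ⟨hr, rfl⟩, rfl⟩)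
        exacts [h.1, hf r hr]
      · intro hv
        by_cases h : ∃ r ∈ L, f r = v
        · obtain ⟨r, hr, rfl⟩ := h
          refine Or.inr ⟨r, ⟨hr, ?_⟩, rfl⟩
          by_contra hne
          exact Finset.disjoint_left.1 (hA _ _ hne) (hf r hr) hv
        · exact Or.inl ⟨hv, h⟩
    · rw [Finset.disjoint_left]
      intro v hv hv'
      obtain ⟨r, hr, rfl⟩ := List.mem_map.1 (List.mem_toFinset.1 hv')
      exact ((htag _ i).1 (Finset.mem_filter.1 hv).2).2
        (List.mem_map_of_mem (List.mem_of_mem_filter hr))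
  intro i hi
  have h1 := key A Route.src _ hA h.memA h.nodupA h.tagA ⟨i, hi⟩
  have h2 := key B Route.tgt _ hB h.memB h.nodupB h.tagB ⟨i, hi⟩
  have h3 := hAB ⟨i, hi⟩
  simp only at h1 h2
  omega

theorem two_mul_sum_card_le {n k : ℕ} {A B : Fin k → Finset (Fin n)}
    (hAB : ∀ i j, Disjoint (A i) (B j)) (hA : ∀ i j, i ≠ j → Disjoint (A i) (A j))
    (hB : ∀ i j, i ≠ j → Disjoint (B i) (B j)) (hcard : ∀ i, (A i).card ≤ (B i).card) :
    2 * ∑ i, (A i).card ≤ n := by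
  have h1 := Finset.sum_le_sum fun i (_ : i ∈ Finset.univ) => hcard i
  have h2 : ∑ i, (A i).card + ∑ i, (B i).card ≤ n := by
    rw [← Finset.card_biUnion (fun i _ j _ hij => hA i j hij),
      ← Finset.card_biUnion (fun i _ j _ hij => hB i j hij), ← Finset.card_union_of_disjoint]
    · exact (Finset.card_le_univ _).trans_eq (Fintype.card_fin n)
    · simp only [Finset.disjoint_biUnion_left, Finset.disjoint_biUnion_right]
      exact fun i _ j _ => hAB j i
  omega

/-- The time for the whole program. -/
def totalTime (n m k Δ ℓ : ℕ) : ℕ :=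
  phaseTime n m k Δ ℓ * (Nat.log 2 n + 2) + k * (2 * growTime n m ℓ + 23 * n + 34) +
    4 * Nat.log 2 n + 30 * m + 18 * n + 80

/-- Total correctness of the program, and its running time. -/
theorem runs_routeOrCut {n m k : ℕ} {G : Graph (Fin n) (Fin m)} {A B : Fin k → Finset (Fin n)}
    {z ℓ : ℕ} {x : List ℕ} (hℓ : 0 < ℓ) (hloop : G.Loopless) (hAB : ∀ i j, Disjoint (A i) (B j))
    (hA : ∀ i j, i ≠ j → Disjoint (A i) (A j)) (hB : ∀ i j, i ≠ j → Disjoint (B i) (B j))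
    (hcard : ∀ i, (A i).card ≤ (B i).card)
    (hΔ : 32 * (maxDegree G : ℝ) * Real.logb 2 n ≤ ℓ) (hx : IsInput G A B z ℓ x) :
    Runs routeOrCut (startMemory x) fun t s => t ≤ totalTime n m k (maxDegree G) ℓ ∧
      ∃ y, HasOutput s y ∧ IsCorrectOutput G A B z ℓ y := by
  obtain ⟨u, v, a, b, huv, ha, hb, rfl⟩ := hx
  obtain ⟨x, hx⟩ : ∃ x, x = [n, m, k, z, ℓ] ++
    (List.finRange m).flatMap (fun e => [(u e : ℕ), (v e : ℕ)]) ++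
      (List.finRange k).flatMap (fun i => encodeList (a i) ++ encodeList (b i)) := ⟨_, rfl⟩
  rw [← hx]
  obtain ⟨p, hp0, hp1, hp2, hp3⟩ := exists_offsets (fun e => [(u e : ℕ), (v e : ℕ)]) x
    ((List.finRange k).flatMap (fun i => encodeList (a i) ++ encodeList (b i))) 5 (by simp [hx])
  obtain ⟨p', hp0', hp1', hp2', -⟩ := exists_offsets
    (fun i => encodeList (a i) ++ encodeList (b i)) x [] (p m) (by rw [hp3, List.append_nil])
  have hp : ∀ j ≤ m, p j = 5 + 2 * j := by
    intro j hj
    induction j with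
    | zero => exact hp0
    | succ j ih =>
      have := hp1 ⟨j, hj⟩
      simp only [List.length_cons, List.length_nil] at this
      rw [this, ih (by omega)]
      ring
  have hcell : ∀ j, (startMemory x).arr 0 j = x.getD j 0 := fun j => rfl
  have hzero : ∀ c j, c ≠ 0 → (startMemory x).arr c j = 0 := fun c j hc => if_neg hc
  simp only [routeOrCut, runs_block_cons]
  refine (runs_readHeader (n := n) (m := m) (k := k) (z := z) (ℓ := ℓ) ?_ ?_ ?_ ?_ ?_).mono ?_
  iterate 5 · rw [hcell, hx]; rfl
  rintro t₁ s₁ hs₁ ⟨ht₁, a1, a2, a3, a4, a5, a6, a7, a8⟩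
  have a9 := hs₁.arr 0 rfl
  refine (runs_readEdges hloop huv (fun e => ?_) (fun e => ?_) a2 a8 fun w => ?_).mono ?_
  · have := hp2 e 0 (by simp)
    rw [hp e e.2.le] at this
    rw [a9, hcell]
    simpa using this
  · have := hp2 e 1 (by simp)
    rw [hp e e.2.le] at this
    rw [a9, hcell]
    simpa using this
  · rw [hs₁.arr aDeg rfl, hzero _ _ (by decide)]
  rintro t₂ s₂ hs₂ ⟨ht₂, b1, b2, b3, b4⟩
  have henv₂ : Env G k z ℓ s₂ := by
    refine ⟨?_, ?_, ?_, ?_, ?_, ?_, ?_, b2, b3, b4.sound, b4.complete⟩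
    · rw [hs₂.reg _ rfl, a1]
    · rw [hs₂.reg _ rfl, a2]
    · rw [hs₂.reg _ rfl, a3]
    · rw [hs₂.reg _ rfl, a4]
    · rw [hs₂.reg _ rfl, a5]
    · rw [hs₂.reg _ rfl, a6]
    · rw [hs₂.reg _ rfl, a7]
  refine (runs_readSets ha hb hA hB (p := p') hp1' (fun i j hj => ?_) henv₂.regK ?_ (fun w => ?_)
    (fun w => ?_)).mono ?_
  · rw [hs₂.arr 0 rfl, a9, hcell]
    exact hp2' i j hj
  · rw [b1, hp0', hp m le_rfl]
  · rw [hs₂.arr aTagA rfl, hs₁.arr aTagA rfl, hzero _ _ (by decide)]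
  · rw [hs₂.arr aTagB rfl, hs₁.arr aTagB rfl, hzero _ _ (by decide)]
  rintro t₃ s₃ hs₃ ⟨ht₃, c1, c2⟩
  have henv₃ := henv₂.of_sameOff hs₃ rfl
  have hsum := two_mul_sum_card_le hAB hA hB hcard
  refine (runs_routing hA hsum henv₃ c1 c2).mono ?_
  rintro t₄ s₄ hs₄ ⟨⟨L, hL, husage⟩, d1, d2, ht₄⟩
  have henv₄ := henv₃.of_sameOff hs₄ rfl
  have hcount := hL.card hA
  have htime : t₁ + (t₂ + (t₃ + (t₄ + (k * (2 * growTime n m ℓ + 11 * n + 20) + 18 * n + 50)))) ≤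
      totalTime n m k (maxDegree G) ℓ := by
    have : k * (2 * growTime n m ℓ + 23 * n + 34) =
        k * (2 * growTime n m ℓ + 11 * n + 20) + (12 * n + 14) * k := by ring
    unfold totalTime
    omega
  rw [runs_cond]
  simp only [Test.holds_lt, Operand.eval_reg, henv₄.regZ, not_lt]
  refine ⟨fun hz => ?_, fun hz => ?_⟩
  · simp only [runs_block_cons]
    refine (runs_findCut henv₄ (d2 hz) d1 (by omega) (fun w hw => hL.tagA_le ⟨w, hw⟩) ?_
      (hL.card_tag_le hA hB hcard) ?_).mono ?_
    · intro w hw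
      by_contra! hne
      obtain ⟨i, hi⟩ := hL.exists_tag (v := ⟨w, hw⟩) hne.1
      have hk := hL.tagB_le ⟨w, hw⟩
      have hj : s₄.arr aTagB w = (s₄.arr aTagB w - 1) + 1 := by have := hne.2; omega
      refine Finset.disjoint_left.1 (hAB i ⟨s₄.arr aTagB w - 1, ?_⟩)
        ((hL.tagA ⟨w, hw⟩ i).1 hi).1 ((hL.tagB ⟨w, hw⟩ _).1 hj).1
      simp only at hk
      omega
    · intro w
      rw [hs₄.arr aCut rfl, hs₃.arr aCut rfl, hs₂.arr aCut rfl, hs₁.arr aCut rfl,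
        hzero _ _ (by decide)]
    rintro t₅ s₅ hs₅ ⟨ht₅, e1, e2⟩
    have hst := d2 hz
    have hbl := hst.blocked
    rw [henv₄.cap] at hbl e2
    rw [henv₄.q] at e2
    obtain ⟨f1, f2⟩ := e2.isCut hloop hbl hz e1 (by omega) hℓ hΔ
      (X := Finset.univ.filter fun w : Fin n => s₅.arr aCut w = 1)
      (Y := Finset.univ.filter fun w : Fin n => ¬ s₅.arr aCut w = 1) (by simp) (by simp)
    have hX : Enumerates ((List.finRange n).filter fun w : Fin n => decide (s₅.arr aCut w = 1))
        (Finset.univ.filter fun w : Fin n => s₅.arr aCut w = 1) :=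
      ⟨(List.nodup_finRange n).filter _, by ext w; simp⟩
    have hY : Enumerates ((List.finRange n).filter fun w : Fin n => !decide (s₅.arr aCut w = 1))
        (Finset.univ.filter fun w : Fin n => ¬ s₅.arr aCut w = 1) :=
      ⟨(List.nodup_finRange n).filter _, by ext w; simp⟩
    refine (runs_printCut (n := n) ?_ ?_).mono ?_
    · rw [hs₅.reg rN rfl, henv₄.regN]
    · rw [← f1, ← hX.2, List.toFinset_card_of_nodup hX.1]
    rintro t₆ s₆ hs₆ ⟨ht₆, hout⟩
    rw [runs_block_nil, runs_block_nil]
    exact ⟨by omega, _, hout, Or.inr ⟨_, _, f2.1, f2.2.1, f2.2.2.1, f2.2.2.2, _, _, hX, hY, rfl⟩⟩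
  · simp only [runs_block_cons, runs_block_nil, runs_store]
    refine ⟨by omega, _, hL.hasOutput, Or.inl ?_⟩
    obtain ⟨M, P, g1, g2, g3, g4⟩ := hL.exists_routing
    refine ⟨M, P, g1, ?_, g3 _ fun e => (husage e e.2).trans_eq (sq ℓ).symm, g4⟩
    rw [g2, sub_le_iff_le_add]
    exact_mod_cast (by omega : ∑ i, (A i).card ≤ L.length + z)

/-! ### Running time and word length -/

theorem totalTime_le {n m k Δ ℓ : ℕ} (hn : 0 < n) (hk : 0 < k) (hℓ : 0 < ℓ) (hΔ : Δ ≤ ℓ) :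
    totalTime n m k Δ ℓ ≤ 2000 * (Nat.log 2 n + 2) * (ℓ ^ 3 * k * m + ℓ ^ 2 * k * n) := by
  obtain ⟨X, hX⟩ : ∃ X, X = ℓ ^ 3 * k * m := ⟨_, rfl⟩
  obtain ⟨Y, hY⟩ : ∃ Y, Y = ℓ ^ 2 * k * n := ⟨_, rfl⟩
  rw [← hX, ← hY]
  have hl2 : ℓ ≤ ℓ ^ 2 := Nat.le_self_pow two_ne_zero ℓ
  have hl3 : ℓ ≤ ℓ ^ 3 := Nat.le_self_pow three_ne_zero ℓ
  have hkl2 : ℓ * k ≤ ℓ ^ 2 * k := Nat.mul_le_mul_right k hl2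
  have h1 : ℓ * k ≤ Y := hY ▸ hkl2.trans (Nat.le_mul_of_pos_right _ hn)
  have h2 : k ≤ ℓ * k := Nat.le_mul_of_pos_left k hℓ
  have h3 : k * n ≤ Y := by
    rw [hY, mul_assoc]
    exact Nat.le_mul_of_pos_left _ (by positivity)
  have h4 : n ≤ k * n := Nat.le_mul_of_pos_left n hk
  have h5 : ℓ * k * m ≤ X := hX ▸ Nat.mul_le_mul_right m (Nat.mul_le_mul_right k hl3)
  have h6 : k * m ≤ ℓ * k * m := by
    rw [mul_assoc]
    exact Nat.le_mul_of_pos_left _ hℓ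
  have h7 : m ≤ k * m := Nat.le_mul_of_pos_left m hk
  have hsource : sourceTime Δ ℓ ≤ 157 * ℓ ^ 2 := by
    have : (16 * Δ + 25) * (ℓ + 1) ≤ (41 * ℓ) * (2 * ℓ) := Nat.mul_le_mul (by omega) (by omega)
    unfold sourceTime
    nlinarith
  have hphase : phaseTime n m k Δ ℓ ≤ 3 * X + 540 * Y := by
    have : k * (3 * n * sourceTime Δ ℓ + 3 * n + 12) ≤ 471 * Y + 3 * (k * n) + 12 * k := by
      calc k * (3 * n * sourceTime Δ ℓ + 3 * n + 12)
          ≤ k * (3 * n * (157 * ℓ ^ 2) + 3 * n + 12) := by gcongr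
        _ = 471 * Y + 3 * (k * n) + 12 * k := by rw [hY]; ring
    unfold phaseTime
    omega
  have hgrow : k * (2 * growTime n m ℓ + 23 * n + 34) ≤ 144 * X + 200 * Y := by
    have : k * (2 * growTime n m ℓ + 23 * n + 34) = 47 * (k * n) + 72 * (ℓ * k * m) + 72 * (k * m) +
        34 * (ℓ * k) + 108 * k := by
      unfold growTime
      ring
    omega
  have hlog : Nat.log 2 n ≤ n := Nat.log_le_self 2 n
  have h8 : 30 * m + 22 * n + 80 ≤ 30 * X + 110 * Y := by omega
  have h9 : 200 * (X + Y) ≤ 200 * (X + Y) * (Nat.log 2 n + 2) := Nat.le_mul_of_pos_right _ (by omega)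
  have h10 := Nat.mul_le_mul_right (Nat.log 2 n + 2) hphase
  unfold totalTime
  nlinarith

/-- For `n = 1` there are no edges; otherwise `log n ≥ 1`. -/
theorem maxDegree_le {n m : ℕ} {G : Graph (Fin n) (Fin m)} {ℓ : ℕ} (hloop : G.Loopless)
    (hΔ : 32 * (maxDegree G : ℝ) * Real.logb 2 n ≤ ℓ) : maxDegree G ≤ ℓ := by
  rcases Nat.lt_or_ge n 2 with hn | hn
  · refine Finset.sup_le fun v _ => ?_
    have : G.incidenceSet v = ∅ := by
      refine Set.eq_empty_of_forall_notMem ?_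
      rintro e ⟨w, hl⟩
      exact hl.ne (Fin.ext (by omega))
    rw [this, Set.ncard_empty]
    exact Nat.zero_le _
  · have h1 : (1 : ℝ) ≤ Real.logb 2 n :=
      le_trans (by exact_mod_cast Nat.log_pos (by norm_num) hn) (natLog_le_logb (by omega))
    have h2 : (0 : ℝ) ≤ maxDegree G := Nat.cast_nonneg _
    have : (maxDegree G : ℝ) ≤ ℓ := by nlinarith
    exact_mod_cast this

theorem bounded_startMemory {n m k : ℕ} {G : Graph (Fin n) (Fin m)} {A B : Fin k → Finset (Fin n)}
    {z ℓ : ℕ} {x : List ℕ} (hx : IsInput G A B z ℓ x) :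
    (startMemory x).Bounded (n + m + k + z + ℓ + 5) := by
  obtain ⟨u, v, a, b, -, ha, hb, rfl⟩ := hx
  refine ⟨fun c j => ?_, fun _ => Nat.zero_le _, Nat.zero_le _, Nat.zero_le _, Nat.zero_le _⟩
  simp only [startMemory]
  split_ifs
  swap
  · exact Nat.zero_le _
  have hlist : ∀ (l : List (Fin n)), l.Nodup → ∀ w ∈ encodeList l, w ≤ n := by
    intro l hl w hw
    rcases List.mem_cons.1 hw with rfl | hw
    · exact hl.length_le_card.trans_eq (Fintype.card_fin n)
    · obtain ⟨y, -, rfl⟩ := List.mem_map.1 hw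
      exact y.2.le
  generalize hy : [n, m, k, z, ℓ] ++ _ ++ _ = y
  have hmem : ∀ w ∈ y, w ≤ n + m + k + z + ℓ + 5 := by
    subst hy
    intro w hw
    simp only [List.mem_append, List.mem_cons, List.mem_flatMap, List.not_mem_nil, or_false] at hw
    rcases hw with ((rfl | rfl | rfl | rfl | rfl) | ⟨e, -, rfl | rfl⟩) | ⟨i, -, hw | hw⟩
    any_goals omega
    · have := hlist _ (ha i).1 w hw
      omega
    · have := hlist _ (hb i).1 w hw
      omega
  rw [List.getD_eq_getElem?_getD]
  rcases lt_or_ge j y.length with hj | hj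
  · rw [List.getElem?_eq_getElem hj]
    exact hmem _ (List.getElem_mem hj)
  · rw [List.getElem?_eq_none hj]
    exact Nat.zero_le _

end RouteOrCut

theorem mainTheorem6 :
    ∃ (prog : RouteOrCut.Prog) (c C d : ℕ),
      ∀ (n m k : ℕ) (G : Graph (Fin n) (Fin m)) (A B : Fin k → Finset (Fin n)) (z ℓ : ℕ)
        (x : List ℕ),
        0 < n → 0 < k → 0 < ℓ →
        G.vertexSet = Set.univ → G.edgeSet = Set.univ → G.Loopless →
        (∀ i j, Disjoint (A i) (B j)) →
        (∀ i j, i ≠ j → Disjoint (A i) (A j)) →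
        (∀ i j, i ≠ j → Disjoint (B i) (B j)) →
        (∀ i, (A i).card ≤ (B i).card) →
        32 * (RouteOrCut.maxDegree G : ℝ) * Real.logb 2 n ≤ ℓ →
        RouteOrCut.IsInput G A B z ℓ x →
        ∃ (t : ℕ) (s : RouteOrCut.Memory) (y : List ℕ),
          RouteOrCut.Exec ((n + m + k + z + ℓ + 2) ^ c) prog (RouteOrCut.startMemory x) t s ∧
          RouteOrCut.HasOutput s y ∧
          RouteOrCut.IsCorrectOutput G A B z ℓ y ∧
          (t : ℝ) ≤ C * (1 + Real.logb 2 n) ^ d *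
            ((ℓ : ℝ) ^ 3 * k * m + (ℓ : ℝ) ^ 2 * k * n) := by
  refine ⟨RouteOrCut.routeOrCut, 27, 4000, 1, ?_⟩
  intro n m k G A B z ℓ x hn hk hℓ _ _ hloop hAB hA hB hcard hΔ hx
  obtain ⟨W, t, s, hexec, ht, y, hout, hy⟩ :=
    RouteOrCut.runs_routeOrCut hℓ hloop hAB hA hB hcard hΔ hx
  have ht' := ht.trans (RouteOrCut.totalTime_le (m := m) hn hk hℓ (RouteOrCut.maxDegree_le hloop hΔ))
  refine ⟨t, s, y, ?_, hout, hy, ?_⟩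
  · refine (hexec.of_tame RouteOrCut.tame_routeOrCut (by omega)
      (RouteOrCut.bounded_startMemory hx) ?_).1
    obtain ⟨N, hN⟩ : ∃ N, N = n + m + k + z + ℓ + 2 := ⟨_, rfl⟩
    -- The running time is at most `4000 N ^ 6`, and the words are at most quadratic in it.
    have hN5 : 5 ≤ N := by omega
    have h1 : ℓ ^ 3 * k * m + ℓ ^ 2 * k * n ≤ 2 * N ^ 5 := by
      have h2 : ℓ ^ 3 * k * m ≤ N ^ 3 * N * N := by gcongr <;> omega
      have h3 : ℓ ^ 2 * k * n ≤ N ^ 2 * N * N := by gcongr <;> omega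
      have h4 : N ^ 2 * N * N ≤ N ^ 5 := by
        calc N ^ 2 * N * N = N ^ 4 := by ring
          _ ≤ N ^ 5 := Nat.pow_le_pow_right (by omega) (by norm_num)
      calc ℓ ^ 3 * k * m + ℓ ^ 2 * k * n ≤ N ^ 3 * N * N + N ^ 5 := Nat.add_le_add h2 (h3.trans h4)
        _ = 2 * N ^ 5 := by ring
    have h2 : Nat.log 2 n + 2 ≤ N := by
      have := Nat.log_le_self 2 n
      omega
    have h3 : t ≤ 4000 * N ^ 6 := by
      calc t ≤ 2000 * N * (2 * N ^ 5) := ht'.trans (by gcongr)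
        _ = 4000 * N ^ 6 := by ring
    have h4 : N ≤ N ^ 6 := Nat.le_self_pow (by norm_num) N
    have h5 : n + m + k + z + ℓ + 5 + 5 * t ≤ N ^ 13 := by
      calc n + m + k + z + ℓ + 5 + 5 * t ≤ 5 ^ 7 * N ^ 6 := by omega
        _ ≤ N ^ 7 * N ^ 6 := by gcongr
        _ = N ^ 13 := by ring
    rw [← hN]
    calc _ ≤ N ^ 13 * N ^ 13 + N ^ 13 := Nat.add_le_add (Nat.mul_le_mul h5 h5) h5
      _ ≤ N ^ 13 * N ^ 13 + N ^ 13 * N ^ 13 :=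
        Nat.add_le_add_left (Nat.le_mul_self _) _
      _ = 2 * N ^ 26 := by ring
      _ < N * N ^ 26 := Nat.mul_lt_mul_of_pos_right (by omega) (by positivity)
      _ = N ^ 27 := by ring
  · have h1 := RouteOrCut.natLog_le_logb (n := n) (by omega)
    have h2 : (0 : ℝ) ≤ Nat.log 2 n := Nat.cast_nonneg _
    have h3 : (t : ℝ) ≤ 2000 * ((Nat.log 2 n : ℝ) + 2) * ((ℓ : ℝ) ^ 3 * k * m + (ℓ : ℝ) ^ 2 * k * n) := by
      exact_mod_cast ht'
    refine h3.trans (mul_le_mul_of_nonneg_right ?_ (by positivity))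
    rw [pow_one]
    push_cast
    linarith
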